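/- Lemma 2.12. Let $G$ be a finite group, $t\in G$ an involution, $H=C_G(t)$, and suppose that the generalized Fitting subgroup $Q=F^*(H)$ is extraspecial of order $2^9$. Write $(SU_4(2)\times 3){:}2$ for the subgroup of index $2$ in $\mathrm{Aut}(SU_4(2))\times \mathrm{Sym}(3)$ which is not expressible as a direct product (of two non-trivial groups). Suppose that $$H/Q\cong \mathrm{Aut}(SU_4(2))\quad\text{or}\quad H/Q\cong (SU_4(2)\times 3){:}2,$$ and that $Q/\langle t\rangle$, with $H/Q$ acting by conjugation, is the natural $F^*(H/Q)$-module; that is, as a module for the subgroup $SU_4(2)$ of $F^*(H/Q)$ it is the natural $4$-dimensional module of $SU_4(2)$ over $\mathrm{GF}(4)$, regarded as a module over $\mathrm{GF}(2)$ (for some identification of this subgroup with the matrix group $SU_4(2)$). Then $G$ has a subgroup of index $2$. -/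

import Mathlib

/-! ### The generalized Fitting subgroup -/

/-- A group is quasisimple if it is perfect and its quotient by its centre is simple. -/
def IsQuasisimple (K : Type*) [Group K] : Prop :=
  Group.IsPerfect K ∧ IsSimpleGroup (K ⧸ Subgroup.center K)

/-- A component of a group is a subnormal quasisimple subgroup. -/
def IsComponent {G : Type*} [Group G] (K : Subgroup G) : Prop :=
  K.IsSubnormal ∧ IsQuasisimple K

/-- The Fitting subgroup `F(G)`: the subgroup generated by all nilpotent normal subgroups. -/
def fittingSubgroup (G : Type*) [Group G] : Subgroup G :=
  sSup {N : Subgroup G | N.Normal ∧ Group.IsNilpotent N}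

/-- The layer `E(G)`: the subgroup generated by all components. -/
def layer (G : Type*) [Group G] : Subgroup G :=
  sSup {K : Subgroup G | IsComponent K}

/-- The generalized Fitting subgroup `F*(G) = F(G) E(G)`. -/
def generalizedFitting (G : Type*) [Group G] : Subgroup G :=
  fittingSubgroup G ⊔ layer G

theorem IsQuasisimple.of_mulEquiv {K L : Type*} [Group K] [Group L] (e : K ≃* L)
    (h : IsQuasisimple K) : IsQuasisimple L := by
  obtain ⟨h1, h2⟩ := h
  refine ⟨Group.IsPerfect.ofSurjective (f := e.toMonoidHom) e.surjective, ?_⟩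
  have hmap : (Subgroup.center K).map (e : K →* L) = Subgroup.center L := by
    ext y
    simp only [Subgroup.mem_map, Subgroup.mem_center_iff]
    constructor
    · rintro ⟨x, hx, rfl⟩ z
      obtain ⟨w, rfl⟩ := e.surjective z
      simpa using congrArg e (hx w)
    · intro hy
      refine ⟨e.symm y, fun g => e.injective ?_, by simp⟩
      simpa using hy (e g)
  exact (QuotientGroup.congr _ _ e hmap).symm.isSimpleGroup

instance fittingSubgroup_normal (G : Type*) [Group G] : (fittingSubgroup G).Normal :=
  Subgroup.sSup_normal _ fun _ hN => hN.1

instance layer_normal (G : Type*) [Group G] : (layer G).Normal := by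
  refine ⟨fun n hn g => ?_⟩
  have key : layer G ≤ (layer G).comap (MulAut.conj g).toMonoidHom := by
    refine sSup_le fun K hK => ?_
    rw [← Subgroup.map_le_iff_le_comap]
    refine le_sSup (a := K.map (MulAut.conj g).toMonoidHom) ⟨?_, ?_⟩
    · exact hK.1.map (MulAut.conj g).surjective
    · exact hK.2.of_mulEquiv
        (K.equivMapOfInjective (MulAut.conj g).toMonoidHom (MulAut.conj g).injective)
  exact key hn

instance generalizedFitting_normal (G : Type*) [Group G] : (generalizedFitting G).Normal := by
  unfold generalizedFitting
  infer_instance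

/-! ### Extraspecial groups -/

/-- A `p`-group is extraspecial if its centre, its derived subgroup and its Frattini subgroup
coincide and have order `p`. -/
def IsExtraspecial (p : ℕ) (P : Type*) [Group P] : Prop :=
  IsPGroup p P ∧ Nat.card (Subgroup.center P) = p ∧
    commutator P = Subgroup.center P ∧ frattini P = Subgroup.center P

/-! ### The special unitary group `SU₄(2)` -/

/-- The field with four elements. -/
abbrev F4 : Type := GaloisField 2 2

/-- The nontrivial automorphism `x ↦ x ^ 2` of the field with four elements. -/
noncomputable instance F4.instStarRing : StarRing F4 where
  star x := x ^ 2
  star_involutive x := by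
    have h : Nat.card F4 = 4 := GaloisField.card 2 2 two_ne_zero
    have : Fintype F4 := Fintype.ofFinite F4
    have h4 : x ^ 4 = x := by
      have := FiniteField.pow_card x
      rwa [← Nat.card_eq_fintype_card, h] at this
    change (x ^ 2) ^ 2 = x
    rw [← pow_mul]
    exact h4
  star_mul x y := by
    change (x * y) ^ 2 = y ^ 2 * x ^ 2
    ring
  star_add x y := add_pow_char x y 2

/-- `SU₄(2)`: the `4 × 4` matrices over the field with four elements that preserve the
nondegenerate hermitian form `∑ i, x i * (y i) ^ 2` and have determinant `1`. The involution
`star` on `F4` is the nontrivial automorphism, so these are the unitary groups in the usual sense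
even though the characteristic is `2`. -/
abbrev SU42 : Type := Matrix.specialUnitaryGroup (Fin 4) F4

/-! ### The group `(SU₄(2) × 3):2` -/

/-- A group is expressible as a direct product if it is the internal direct product of two
nontrivial normal subgroups. -/
def IsDirectlyDecomposable (G : Type*) [Group G] : Prop :=
  ∃ A B : Subgroup G, A.Normal ∧ B.Normal ∧ A ≠ ⊥ ∧ B ≠ ⊥ ∧ IsCompl A B

/-- `X` is isomorphic to `(SU₄(2) × 3):2`, the subgroup of index `2` in `Aut(SU₄(2)) × Sym(3)`
that is not expressible as a direct product. -/
def IsSU42Times3Colon2 (X : Type*) [Group X] : Prop :=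
  ∃ D : Subgroup (MulAut SU42 × Equiv.Perm (Fin 3)),
    D.index = 2 ∧ ¬ IsDirectlyDecomposable D ∧ Nonempty (X ≃* D)

/-! ### The natural module -/

/-- Let `Z` and `Q` be normal subgroups of `H`. The action of `H` on `Q / (Z ∩ Q)` by conjugation
makes it the natural module for `F*(H / Q)`: there are an embedding `ψ` of `SU₄(2)` into
`F*(H / Q)` and an isomorphism `e` of `Q / (Z ∩ Q)` with the additive group of the space of column
vectors of length `4` over the field with four elements, such that every element of `H` that lies
over `ψ A` acts on `Q / (Z ∩ Q)` as the matrix `A` acts on column vectors. If `F*(H / Q)` is `SU₄(2)`,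
then `ψ` is an isomorphism; if it is `SU₄(2) × 3`, then `ψ` is an isomorphism onto its layer, and
the condition says that the restriction to `SU₄(2)` is the natural `SU₄(2)`-module. -/
def IsNaturalModule {H : Type*} [Group H] (Q Z : Subgroup H) [Q.Normal] [Z.Normal] : Prop :=
  ∃ (ψ : SU42 →* generalizedFitting (H ⧸ Q))
    (e : (Q ⧸ Z.subgroupOf Q) ≃* Multiplicative (Fin 4 → F4)),
    Function.Injective ψ ∧
      ∀ (A : SU42) (h : H), (h : H ⧸ Q) = (ψ A : H ⧸ Q) →
        ∀ x : Q, (e (MulAut.conjNormal h x : Q)).toAdd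
          = (A : Matrix (Fin 4) (Fin 4) F4).mulVec (e (x : Q ⧸ Z.subgroupOf Q)).toAdd

instance zpowers_subgroupOf_centralizer_normal {G : Type*} [Group G] (t : G) :
    ((Subgroup.zpowers t).subgroupOf (Subgroup.centralizer {t})).Normal := by
  refine ⟨fun n hn g => ?_⟩
  obtain ⟨k, hk⟩ := Subgroup.mem_zpowers_iff.1 (Subgroup.mem_subgroupOf.1 hn)
  have hg : Commute (g : G) t := (Subgroup.mem_centralizer_singleton_iff.1 g.2)
  have h2 : g * n * g⁻¹ = n := by
    apply Subtype.ext
    have := (hg.zpow_right k).eq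
    rw [hk] at this
    simp [this]
  rwa [h2]

/-!
# A subgroup of index two by transfer

Let `C` be the centralizer of `t`. The quotient `V = Q / ⟨t⟩` is the space of column vectors of
length `4` over the field with four elements, commutators and squares in `Q` are given by the trace
of the hermitian form and by its values on the diagonal, and every element of `C` acts on `V` by a
linear or by a semilinear map. This defines a sign character of `C` with values in `{1, -1}`, which
is nontrivial because all automorphisms of `SU₄(2)`, in particular the field automorphism, are induced
by `C`. The kernel of its transfer to `G` is the required subgroup, once the transfer is shown to be
nontrivial (`LocalData.exists_index_two`).

The transfer is evaluated at an element `d` of `C` that acts on `V` as a suitable semilinear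
involution `sig` and has square `1` or `t` (`LocalData.exists_sig_sq`). Cosets of `C` correspond to
conjugates `s = g t g⁻¹` of `t`. An orbit of length one of `d` on the cosets, that is, a conjugate
`s` commuting with `d`, contributes a sign exactly if `d` is *twisted* at `s`: the element `g⁻¹ d g`
of `C` acts semilinearly. Orbits of length two contribute only if `d ^ 2 = t`, and then in terms of the
conjugates at which `t` is twisted. Hence it suffices to count: `d` is twisted at an odd number of
conjugates (`LocalData.odd_ncard_twisted`), and `t` at a number divisible by four
(`LocalData.four_dvd_ncard_twisted`).

Both counts let `2`-subgroups of `Q` act by conjugation, and rest on the fact that an element of `Q`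
is never twisted at a conjugate `s ≠ t` of `t` that lies in `Q` and commutes with it
(`LocalData.isLin_conj_of_commute`). If it were, then, as the relation `s ∈ Q` is symmetric between
`s` and `t` (`LocalData.conj_mem_of_conj_mem`), the group `g⁻¹ Q g` would contain elements acting
semilinearly on `V`, and commutators with them would enlarge `Q ∩ g⁻¹ Q g` to a maximal abelian
subgroup centralized by an element that does not belong to it.

The passage from the hypotheses to this description of `C` uses that `SU₄(2)` is simple
(`SU42.normal_eq_top`), so that the copy of `SU₄(2)` in the natural module condition is the normal
one on which all automorphisms are induced (`range_eq_of_le_generalizedFitting`,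
`hasFullNormalCopy_of_not_decomposable`), and that the additive maps commuting with `SU₄(2)` are
scalars (`exists_smul_of_commute`). The latter makes the commutator form, the squaring map and the
action of the elements inducing the field automorphism unique up to scalars (`eq_tr4_herm`,
`eq_herm_self`, `linear_or_semilinear`, `NaturalData.exists_smul_star`).
-/


/-! ### The field with four elements -/

theorem F4.natCard : Nat.card F4 = 4 := GaloisField.card 2 2 two_ne_zero

theorem F4.pow_four (x : F4) : x ^ 4 = x := by
  have : Fintype F4 := Fintype.ofFinite F4
  have := FiniteField.pow_card x
  rwa [← Nat.card_eq_fintype_card, F4.natCard] at this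

theorem F4.star_def (x : F4) : star x = x ^ 2 := rfl

theorem F4.exists_omega : ∃ a : F4, a ^ 2 = a + 1 := by
  classical
  have : Fintype F4 := Fintype.ofFinite F4
  by_contra! h
  have h2 : (Finset.univ : Finset F4) ⊆ {0, 1} := by
    intro a _
    have h4 := F4.pow_four a
    have h3 := h a
    have : a * (a + 1) * (a ^ 2 + a + 1) = 0 := by grind
    rcases mul_eq_zero.1 this with h5 | h5
    · rcases mul_eq_zero.1 h5 with h6 | h6
      · simp [h6]
      · have : a = 1 := by grind
        simp [this]
    · exact absurd (by grind) h3
  have h3 := Finset.card_le_card h2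
  rw [Finset.card_univ, ← Nat.card_eq_fintype_card, F4.natCard] at h3
  have := Finset.card_le_two (a := (0 : F4)) (b := 1)
  omega

/-- A primitive cube root of unity in the field with four elements. -/
noncomputable def om : F4 := F4.exists_omega.choose

theorem om_sq : om ^ 2 = om + 1 := F4.exists_omega.choose_spec

theorem star_om : star om = om + 1 := om_sq

theorem om_ne_zero : om ≠ 0 := by
  intro h; have := om_sq; rw [h] at this; simp at this

theorem om_ne_one : om ≠ 1 := by
  intro h; have := om_sq; rw [h] at this; grind

theorem om_add_one_ne_zero : om + 1 ≠ 0 := by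
  intro h; exact om_ne_one (by grind)

theorem F4.cases (a : F4) : a = 0 ∨ a = 1 ∨ a = om ∨ a = om + 1 := by
  have h4 := F4.pow_four a
  have hw := om_sq
  have : a * ((a + 1) * ((a + om) * (a + om + 1))) = 0 := by grind
  simp only [mul_eq_zero] at this
  rcases this with h | h | h | h
  · exact .inl h
  · exact .inr (.inl (by grind))
  · exact .inr (.inr (.inl (by grind)))
  · exact .inr (.inr (.inr (by grind)))

theorem F4.pow_three {a : F4} (h : a ≠ 0) : a ^ 3 = 1 := by
  have := F4.pow_four a
  exact mul_left_cancel₀ h (by linear_combination this)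

theorem F4.mul_star_self {a : F4} (h : a ≠ 0) : a * star a = 1 := by
  rw [F4.star_def, ← F4.pow_three h]; ring

theorem F4.fixed_iff (a : F4) : star a = a ↔ a = 0 ∨ a = 1 := by
  rw [F4.star_def]
  constructor
  · intro h
    have : a * (a + 1) = 0 := by grind
    rcases mul_eq_zero.1 this with h | h
    · exact .inl h
    · exact .inr (by grind)
  · rintro (h | h) <;> simp [h]

/-- The trace of the field with four elements over its prime field, as an element of the
former. -/
noncomputable def tr4 (a : F4) : F4 := a + star a

theorem tr4_add (a b : F4) : tr4 (a + b) = tr4 a + tr4 b := by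
  simp only [tr4, star_add]; ring

theorem tr4_star (a : F4) : tr4 (star a) = tr4 a := by
  simp only [tr4, star_star]; ring

theorem tr4_eq_zero_or_one (a : F4) : tr4 a = 0 ∨ tr4 a = 1 := by
  rw [← F4.fixed_iff]
  simp only [tr4, star_add, star_star]; ring

theorem tr4_eq_zero_iff (a : F4) : tr4 a = 0 ↔ star a = a := by
  simp only [tr4]
  constructor <;> intro h <;> grind

theorem tr4_om : tr4 om = 1 := by
  have := star_om
  simp only [tr4]; grind

/-- Two elements of the field with four elements agree when all their multiples have equal trace. -/
theorem eq_of_tr4_mul {a b : F4} (h : ∀ c, tr4 (c * a) = tr4 (c * b)) : a = b := by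
  have h1 := h 1
  have h2 := h om
  have hw := om_sq
  simp only [tr4, F4.star_def] at h1 h2
  grind

/-! ### The hermitian space -/

/-- The space of column vectors on which `SU₄(2)` acts. -/
abbrev V4 : Type := Fin 4 → F4

/-- The standard hermitian form, linear in the first variable. -/
noncomputable def herm (x y : V4) : F4 := ∑ i, x i * star (y i)

theorem herm_eq (x y : V4) : herm x y =
    x 0 * star (y 0) + x 1 * star (y 1) + x 2 * star (y 2) + x 3 * star (y 3) := by
  simp [herm, Fin.sum_univ_four]

@[simp] theorem herm_add_left (x y z : V4) : herm (x + y) z = herm x z + herm y z := by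
  simp [herm, add_mul, Finset.sum_add_distrib]

@[simp] theorem herm_add_right (x y z : V4) : herm x (y + z) = herm x y + herm x z := by
  simp [herm, mul_add, Finset.sum_add_distrib]

@[simp] theorem herm_smul_left (a : F4) (x y : V4) : herm (a • x) y = a * herm x y := by
  simp [herm, Finset.mul_sum, mul_assoc]

@[simp] theorem herm_smul_right (a : F4) (x y : V4) : herm x (a • y) = star a * herm x y := by
  simp only [herm, Finset.mul_sum, Pi.smul_apply, smul_eq_mul, star_mul]
  exact Finset.sum_congr rfl fun i _ => by ring

@[simp] theorem herm_zero_left (y : V4) : herm 0 y = 0 := by simp [herm]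

@[simp] theorem herm_zero_right (y : V4) : herm y 0 = 0 := by simp [herm]

theorem star_herm (x y : V4) : star (herm x y) = herm y x := by
  simp only [herm, star_sum, star_mul, star_star]

theorem star_herm_self (x : V4) : star (herm x x) = herm x x := star_herm x x

theorem herm_single (x : V4) (i : Fin 4) : herm x (Pi.single i 1) = x i := by
  simp [herm, Pi.single_apply, apply_ite star]

theorem eq_zero_of_herm {x : V4} (h : ∀ y, herm x y = 0) : x = 0 := by
  ext i; simpa [herm_single] using h (Pi.single i 1)

theorem V4.add_self (x : V4) : x + x = 0 := by
  ext i; exact CharTwo.add_self_eq_zero _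

theorem V4.eq_of_add_eq_zero {x y : V4} (h : x + y = 0) : x = y := by
  have : x + y + y = y := by rw [h, zero_add]
  rwa [add_assoc, V4.add_self, add_zero] at this

theorem V4.neg_eq (x : V4) : -x = x := by
  rw [neg_eq_iff_add_eq_zero, V4.add_self]

theorem exists_herm_ne_zero {x : V4} (h : x ≠ 0) : ∃ y, herm x y ≠ 0 := by
  by_contra! h2
  exact h (eq_zero_of_herm h2)

/-- The action of `SU₄(2)` on column vectors. -/
noncomputable def SU42.act (A : SU42) (x : V4) : V4 := A.1.mulVec x

theorem SU42.act_add (A : SU42) (x y : V4) : A.act (x + y) = A.act x + A.act y :=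
  Matrix.mulVec_add _ _ _

theorem SU42.act_smul (A : SU42) (a : F4) (x : V4) : A.act (a • x) = a • A.act x :=
  Matrix.mulVec_smul _ _ _

theorem SU42.act_zero (A : SU42) : A.act 0 = 0 := Matrix.mulVec_zero _

theorem SU42.act_mul (A B : SU42) (x : V4) : (A * B).act x = A.act (B.act x) := by
  simp [SU42.act, Matrix.mulVec_mulVec]

theorem SU42.act_one (x : V4) : (1 : SU42).act x = x := by simp [SU42.act]

theorem SU42.act_inv_act (A : SU42) (x : V4) : A⁻¹.act (A.act x) = x := by
  rw [← SU42.act_mul, inv_mul_cancel, SU42.act_one]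

theorem SU42.act_act_inv (A : SU42) (x : V4) : A.act (A⁻¹.act x) = x := by
  rw [← SU42.act_mul, mul_inv_cancel, SU42.act_one]

theorem SU42.act_injective (A : SU42) : Function.Injective A.act :=
  Function.LeftInverse.injective A.act_inv_act

theorem SU42.ext_act {A B : SU42} (h : ∀ x, A.act x = B.act x) : A = B := by
  apply Subtype.ext
  apply Matrix.mulVec_injective
  funext x
  exact h x

theorem herm_eq_dotProduct (x y : V4) : herm x y = x ⬝ᵥ star y := rfl

theorem SU42.herm_act (A : SU42) (x y : V4) : herm (A.act x) (A.act y) = herm x y := by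
  have h := (Matrix.mem_unitaryGroup_iff'.1 (Matrix.mem_specialUnitaryGroup_iff.1 A.2).1)
  rw [herm_eq_dotProduct, herm_eq_dotProduct, SU42.act, SU42.act, Matrix.star_mulVec,
    dotProduct_comm, ← Matrix.dotProduct_mulVec, Matrix.mulVec_mulVec]
  rw [Matrix.star_eq_conjTranspose] at h
  rw [h, Matrix.one_mulVec, dotProduct_comm]

theorem SU42.exists_act_eq (f : V4 →ₗ[F4] V4) (hf : ∀ x y, herm (f x) (f y) = herm x y)
    (hd : LinearMap.det f = 1) : ∃ A : SU42, ∀ x, A.act x = f x := by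
  have hm : ∀ x, (LinearMap.toMatrix' f).mulVec x = f x := fun x => by
    rw [← Matrix.toLin'_apply, Matrix.toLin'_toMatrix']
  refine ⟨⟨LinearMap.toMatrix' f, ?_⟩, hm⟩
  rw [Matrix.mem_specialUnitaryGroup_iff, Matrix.mem_unitaryGroup_iff']
  refine ⟨?_, by rw [LinearMap.det_toMatrix', hd]⟩
  ext i j
  have h := hf (Pi.single j 1) (Pi.single i 1)
  rw [herm_single] at h
  rw [Matrix.mul_apply]
  simp only [Matrix.star_apply, LinearMap.toMatrix'_apply]
  rw [Matrix.one_apply]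
  rw [herm] at h
  rw [← show (Pi.single j (1 : F4) : V4) i = if i = j then 1 else 0 from by
    simp [Pi.single_apply], ← h]
  exact Finset.sum_congr rfl fun k _ => mul_comm _ _

/-- A linear isometry whose fourth power is the identity has determinant `1`, because
`a ^ 4 = a` in the field with four elements. -/
theorem SU42.exists_act_eq_of_iterate (f : V4 →ₗ[F4] V4)
    (hf : ∀ x y, herm (f x) (f y) = herm x y) (h4 : ∀ x, f (f (f (f x))) = x) :
    ∃ A : SU42, ∀ x, A.act x = f x := by
  refine SU42.exists_act_eq f hf ?_
  have : f ∘ₗ f ∘ₗ f ∘ₗ f = LinearMap.id := LinearMap.ext h4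
  have h := congrArg LinearMap.det this
  simp only [LinearMap.det_comp, LinearMap.det_id] at h
  rw [← F4.pow_four (LinearMap.det f), ← h]
  ring

/-! ### Unipotent elements fixing a singular vector -/

/-- The linear map `x ↦ x + h(x,v) w + (h(x,w) + m h(x,v)) v`. For a singular vector `v`, a vector
`w` orthogonal to `v` and `m` of trace `h(w,w)` it is an element of the unipotent radical of the
stabilizer of `v` in `SU₄(2)`. -/
noncomputable def unipFun (v w : V4) (m : F4) : V4 →ₗ[F4] V4 where
  toFun x := x + herm x v • w + (herm x w + m * herm x v) • v
  map_add' x y := by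
    simp only [herm_add_left]; module
  map_smul' a x := by
    simp only [herm_smul_left, RingHom.id_apply]; module

theorem unipFun_apply (v w : V4) (m : F4) (x : V4) :
    unipFun v w m x = x + herm x v • w + (herm x w + m * herm x v) • v := rfl

/-- For a fixed singular vector `v` these maps are closed under composition. -/
theorem unipFun_unipFun {v w1 w2 : V4} (hv : herm v v = 0) (h1 : herm w1 v = 0)
    (h2 : herm w2 v = 0) (m1 m2 : F4) (x : V4) :
    unipFun v w1 m1 (unipFun v w2 m2 x) = unipFun v (w1 + w2) (m1 + m2 + herm w2 w1) x := by
  have h1' : herm v w1 = 0 := by rw [← star_herm, h1, star_zero]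
  simp only [unipFun_apply, herm_add_left, herm_smul_left, herm_add_right, hv, h1', h2]
  module

/-- These maps lie in `SU₄(2)`: by `unipFun_unipFun` their fourth power is the identity. -/
theorem exists_unip {v w : V4} {m : F4} (hv : herm v v = 0) (hw : herm w v = 0)
    (hm : tr4 m = herm w w) :
    ∃ A : SU42, ∀ x, A.act x = x + herm x v • w + (herm x w + m * herm x v) • v := by
  have hw' : herm v w = 0 := by rw [← star_herm, hw, star_zero]
  refine SU42.exists_act_eq_of_iterate (unipFun v w m) (fun x y => ?_) (fun x => ?_)
  · simp only [unipFun_apply, herm_add_left, herm_smul_left, herm_add_right, herm_smul_right, hv,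
      hw', hw, ← hm, star_add, star_mul, star_herm, tr4]
    grind
  · have hw2 : herm (w + w) v = 0 := by simp [hw]
    rw [unipFun_unipFun hv hw hw, unipFun_unipFun hv hw hw, unipFun_unipFun hv hw2 hw2]
    have e : m + m + herm w w + (m + m + herm w w) = 0 := CharTwo.add_self_eq_zero _
    simp [unipFun_apply, V4.add_self, e]

theorem exists_transvection {c : V4} (hc : herm c c = 0) :
    ∃ A : SU42, ∀ x, A.act x = x + herm x c • c := by
  obtain ⟨A, hA⟩ := exists_unip (v := c) (w := 0) (m := 1) hc (by simp) (by simp [tr4]; grind)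
  exact ⟨A, fun x => by simp [hA]⟩


/-! ### Transvections generate `SU₄(2)` -/

open Classical in
/-- The unitary transvection `x ↦ x + h(x,c) c` for a singular vector `c`; the identity if `c` is
not singular. -/
noncomputable def tv (c : V4) : SU42 :=
  if h : herm c c = 0 then (exists_transvection h).choose else 1

theorem tv_act {c : V4} (hc : herm c c = 0) (x : V4) : (tv c).act x = x + herm x c • c := by
  rw [tv, dif_pos hc]
  exact (exists_transvection hc).choose_spec x

theorem tv_mul_self {c : V4} (hc : herm c c = 0) : tv c * tv c = 1 := by
  refine SU42.ext_act fun x => ?_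
  rw [SU42.act_mul, tv_act hc, tv_act hc, SU42.act_one, herm_add_left, herm_smul_left, hc,
    mul_zero, add_zero, add_assoc, V4.add_self, add_zero]

theorem tv_inv {c : V4} (hc : herm c c = 0) : (tv c)⁻¹ = tv c :=
  inv_eq_of_mul_eq_one_left (tv_mul_self hc)

theorem tv_conj (A : SU42) {c : V4} (hc : herm c c = 0) : A * tv c * A⁻¹ = tv (A.act c) := by
  refine SU42.ext_act fun x => ?_
  have hc' : herm (A.act c) (A.act c) = 0 := by rw [SU42.herm_act, hc]
  rw [SU42.act_mul, SU42.act_mul, tv_act hc, tv_act hc', SU42.act_add, SU42.act_smul,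
    SU42.act_act_inv]
  congr 2
  rw [← SU42.herm_act A, SU42.act_act_inv]

theorem tv_smul {a : F4} (ha : a ≠ 0) {c : V4} (hc : herm c c = 0) : tv (a • c) = tv c := by
  refine SU42.ext_act fun x => ?_
  have hc' : herm (a • c) (a • c) = 0 := by simp [hc]
  rw [tv_act hc, tv_act hc', herm_smul_right, smul_smul]
  congr 2
  rw [mul_comm, ← mul_assoc, F4.mul_star_self ha, one_mul]

theorem tv_zero : tv 0 = 1 := by
  refine SU42.ext_act fun x => ?_
  rw [tv_act (by simp), SU42.act_one]; simp

/-- A chosen nonzero singular vector. -/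
noncomputable def v0 : V4 := ![1, 1, 0, 0]

theorem herm_v0 (x : V4) : herm x v0 = x 0 + x 1 := by simp [herm_eq, v0]

theorem v0_sing : herm v0 v0 = 0 := by
  rw [herm_v0]; simp [v0, CharTwo.add_self_eq_zero]

theorem v0_ne_zero : v0 ≠ 0 := fun h => by simpa [v0] using congrFun h 0

theorem F4.norm_eq_one_iff {a : F4} : a * star a = 1 ↔ a ≠ 0 :=
  ⟨fun h h0 => by simp [h0] at h, F4.mul_star_self⟩

theorem F4.norm_zero_or_one (a : F4) : a = 0 ∧ a * star a = 0 ∨ a ≠ 0 ∧ a * star a = 1 := by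
  by_cases h : a = 0
  · simp [h]
  · exact .inr ⟨h, F4.mul_star_self h⟩

/-- For every nonzero `b` some singular vector is orthogonal neither to `v0` nor to `b`. If `b` is
singular, this vector is an intermediate step between the two in chains of transvections. -/
theorem exists_sing_not_orthogonal {b : V4} (hb0 : b ≠ 0) :
    ∃ c : V4, herm c c = 0 ∧ herm v0 c ≠ 0 ∧ herm b c ≠ 0 := by
  by_contra! h
  have hw := om_sq
  have h1 := h ![1, om, 0, 0] (by simp [herm_eq, F4.star_def]; grind)
    (by simp [herm_eq, v0, F4.star_def]; have := om_ne_zero; grind)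
  have h2 := h ![1, om + 1, 0, 0] (by simp [herm_eq, F4.star_def]; grind)
    (by simp [herm_eq, v0, F4.star_def]; have := om_ne_one; grind)
  have h3 := h ![1, 0, 1, 0] (by simp [herm_eq]; grind) (by simp [herm_eq, v0])
  have h4 := h ![1, 0, 0, 1] (by simp [herm_eq]; grind) (by simp [herm_eq, v0])
  simp [herm_eq, F4.star_def] at h1 h2 h3 h4
  apply hb0
  have e1 : b 1 = 0 := by grind
  have e0 : b 0 = 0 := by grind
  ext i
  fin_cases i <;> simp <;> grind

/-- The product of the transvections with centres `e i + a • e j` and `e i + e j` is diagonal. -/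
theorem exists_diag_mem {T : Subgroup SU42} (hT : ∀ c, herm c c = 0 → tv c ∈ T) {i j : Fin 4}
    (hij : i ≠ j) {a : F4} (ha : a ≠ 0) : ∃ D ∈ T, ∀ x : V4, (D.act x) i = star a * x i ∧
      (D.act x) j = a * x j ∧ ∀ k, k ≠ i → k ≠ j → (D.act x) k = x k := by
  have hs : ∀ b : F4, b ≠ 0 →
      herm (Pi.single i 1 + b • Pi.single j 1) (Pi.single i 1 + b • Pi.single j 1) = 0 := by
    intro b hb
    have := F4.mul_star_self hb
    simp [herm_single, hij, hij.symm]
    grind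
  refine ⟨tv (Pi.single i 1 + a • Pi.single j 1) * tv (Pi.single i 1 + (1 : F4) • Pi.single j 1),
    T.mul_mem (hT _ (hs a ha)) (hT _ (hs 1 one_ne_zero)), fun x => ?_⟩
  have := F4.mul_star_self ha
  rw [SU42.act_mul, tv_act (hs a ha), tv_act (hs 1 one_ne_zero)]
  simp only [herm_add_right, herm_smul_right, herm_single, Pi.add_apply, Pi.smul_apply,
    smul_eq_mul, star_one, one_mul, mul_one, Pi.single_eq_same,
    Pi.single_eq_of_ne hij, Pi.single_eq_of_ne hij.symm]
  refine ⟨by grind, by grind, fun k hk1 hk2 => ?_⟩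
  simp [Pi.single_eq_of_ne hk1, Pi.single_eq_of_ne hk2]

/-- A subgroup containing all transvections is transitive on nonzero singular vectors. -/
theorem exists_mem_act_eq_v0 {T : Subgroup SU42} (hT : ∀ c, herm c c = 0 → tv c ∈ T) {x : V4}
    (hx : herm x x = 0) (hx0 : x ≠ 0) : ∃ B ∈ T, B.act x = v0 := by
  obtain ⟨c, hc, hvc, hxc⟩ := exists_sing_not_orthogonal hx0
  -- If `h(y,z) = 1`, then the transvection with centre `y + z` maps `y` to `z`.
  have key : ∀ y z : V4, herm y y = 0 → herm z z = 0 → herm y z = 1 →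
      ∃ B ∈ T, B.act y = z := by
    intro y z hy hz hyz
    have hzy : herm z y = 1 := by rw [← star_herm, hyz, star_one]
    have hs : herm (y + z) (y + z) = 0 := by
      simp [hy, hz, hyz, hzy]; grind
    refine ⟨tv (y + z), hT _ hs, ?_⟩
    rw [tv_act hs, herm_add_right, hy, hyz, zero_add, one_smul, ← add_assoc, V4.add_self, zero_add]
  have hxc' : herm c x ≠ 0 := by rw [← star_herm]; simpa using hxc
  obtain ⟨B1, hB1, h1⟩ := key x ((star (herm x c))⁻¹ • c) hx (by simp [hc])
    (by simp [hxc])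
  obtain ⟨B2, hB2, h2⟩ := key c ((star (herm c v0))⁻¹ • v0) hc (by simp [v0_sing])
    (by
      have : herm c v0 ≠ 0 := by rw [← star_herm]; simpa using hvc
      simp [this])
  have h3 : ∃ m : F4, m ≠ 0 ∧ (B2 * B1).act x = m • v0 := by
    refine ⟨(star (herm x c))⁻¹ * (star (herm c v0))⁻¹, ?_, ?_⟩
    · have : herm c v0 ≠ 0 := by rw [← star_herm]; simpa using hvc
      simp [hxc, this]
    · rw [SU42.act_mul, h1, SU42.act_smul, h2, smul_smul]
  obtain ⟨m, hm, h3⟩ := h3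
  obtain ⟨D1, hD1, d1⟩ := exists_diag_mem hT (i := 0) (j := 2) (by decide) hm
  obtain ⟨D2, hD2, d2⟩ := exists_diag_mem hT (i := 1) (j := 3) (by decide) hm
  refine ⟨D2 * D1 * (B2 * B1), T.mul_mem (T.mul_mem hD2 hD1) (T.mul_mem hB2 hB1), ?_⟩
  rw [SU42.act_mul, h3, SU42.act_mul]
  have e := F4.mul_star_self hm
  have f0 := (d1 (m • v0)).1
  have f2 := (d1 (m • v0)).2.1
  have f1 := (d1 (m • v0)).2.2 1 (by decide) (by decide)
  have f3 := (d1 (m • v0)).2.2 3 (by decide) (by decide)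
  set y := D1.act (m • v0)
  have g1 := (d2 y).1
  have g3 := (d2 y).2.1
  have g0 := (d2 y).2.2 0 (by decide) (by decide)
  have g2 := (d2 y).2.2 2 (by decide) (by decide)
  simp [v0] at f0 f1 f2 f3
  ext i
  fin_cases i
  · simp [v0, g0, f0]; rw [mul_comm]; exact e
  · simp [v0, g1, f1]; rw [mul_comm]; exact e
  · simp [v0, g2, f2]
  · simp [v0, g3, f3]

theorem exists_act_sing_eq {x y : V4} (hx : herm x x = 0) (hx0 : x ≠ 0) (hy : herm y y = 0)
    (hy0 : y ≠ 0) : ∃ A : SU42, A.act x = y := by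
  obtain ⟨B, -, hB⟩ := exists_mem_act_eq_v0 (T := ⊤) (by simp) hx hx0
  obtain ⟨C, -, hC⟩ := exists_mem_act_eq_v0 (T := ⊤) (by simp) hy hy0
  refine ⟨C⁻¹ * B, ?_⟩
  rw [SU42.act_mul, hB, ← hC, SU42.act_inv_act]

/-- The stabilizer of `v0` contains elements, generated by transvections, that change the last two
coordinates of a vector `f` with `h(f, v0) = 1` by a singular vector. -/
theorem exists_mem_shift {T : Subgroup SU42} (hT : ∀ c, herm c c = 0 → tv c ∈ T) {f : V4}
    (hf : herm f v0 = 1) {p q : F4} (hpq : p * star p + q * star q = 0) :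
    ∃ B ∈ T, B.act v0 = v0 ∧ (B.act f) 2 = f 2 + p ∧ (B.act f) 3 = f 3 + q := by
  set w : V4 := ![0, 0, p, q] with hw
  have hww : herm w w = 0 := by simpa [herm_eq, hw] using hpq
  have hwv : herm w v0 = 0 := by simp [herm_v0, hw]
  have hvw : herm v0 w = 0 := by rw [← star_herm, hwv, star_zero]
  have hs : herm (w + v0) (w + v0) = 0 := by simp [hww, hwv, hvw, v0_sing]
  refine ⟨tv w * tv (w + v0), T.mul_mem (hT _ hww) (hT _ hs), ?_, ?_, ?_⟩
  · rw [SU42.act_mul, tv_act hs, tv_act hww]; simp [hvw, v0_sing]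
  · rw [SU42.act_mul, tv_act hs, tv_act hww]
    simp only [herm_add_left, herm_add_right, herm_smul_left, hvw, hf, hww, Pi.add_apply,
      Pi.smul_apply, smul_eq_mul]
    simp [hw, v0]; grind
  · rw [SU42.act_mul, tv_act hs, tv_act hww]
    simp only [herm_add_left, herm_add_right, herm_smul_left, hvw, hf, hww, Pi.add_apply,
      Pi.smul_apply, smul_eq_mul]
    simp [hw, v0]; grind

/-- A vector that completes `v0` to a hyperbolic pair. -/
noncomputable def f0 : V4 := ![om, om + 1, 0, 0]

theorem herm_f0_v0 : herm f0 v0 = 1 := by simp [herm_v0, f0]; grind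

/-- The stabilizer of `v0` in the group generated by the transvections is transitive on the singular
vectors `f` with `h(f, v0) = 1`. The last two coordinates of `f` are removed first: every pair of
field elements is the sum of two pairs that are singular. -/
theorem exists_mem_act_f0 {T : Subgroup SU42} (hT : ∀ c, herm c c = 0 → tv c ∈ T) {f : V4}
    (hf : herm f v0 = 1) (hff : herm f f = 0) :
    ∃ B ∈ T, B.act v0 = v0 ∧ B.act f = f0 := by
  have step : ∃ B ∈ T, B.act v0 = v0 ∧ (B.act f) 2 = 0 ∧ (B.act f) 3 = 0 := by
    have two : ∀ p q r s : F4, p * star p + q * star q = 0 → r * star r + s * star s = 0 →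
        f 2 + p + r = 0 → f 3 + q + s = 0 →
        ∃ B ∈ T, B.act v0 = v0 ∧ (B.act f) 2 = 0 ∧ (B.act f) 3 = 0 := by
      intro p q r s h1 h2 h3 h4
      obtain ⟨B, hB, b0, b2, b3⟩ := exists_mem_shift hT hf h1
      have hf' : herm (B.act f) v0 = 1 := by rw [← hf, ← SU42.herm_act B f v0, b0]
      obtain ⟨C, hC, c0, c2, c3⟩ := exists_mem_shift hT hf' h2
      refine ⟨C * B, T.mul_mem hC hB, ?_, ?_, ?_⟩
      · rw [SU42.act_mul, b0, c0]
      · rw [SU42.act_mul, c2, b2, h3]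
      · rw [SU42.act_mul, c3, b3, h4]
    have hw := om_sq
    rcases F4.norm_zero_or_one (f 2) with ⟨h2, h2'⟩ | ⟨h2, h2'⟩ <;>
      rcases F4.norm_zero_or_one (f 3) with ⟨h3, h3'⟩ | ⟨h3, h3'⟩
    · exact two 0 0 0 0 (by simp) (by simp) (by simp [h2]) (by simp [h3])
    · simp only [F4.star_def] at h3'
      exact two (f 3) (om * f 3) (f 3) ((om + 1) * f 3) (by simp only [F4.star_def]; grind)
        (by simp only [F4.star_def]; grind) (by grind) (by grind)
    · simp only [F4.star_def] at h2'
      exact two (om * f 2) (f 2) ((om + 1) * f 2) (f 2) (by simp only [F4.star_def]; grind)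
        (by simp only [F4.star_def]; grind) (by grind) (by grind)
    · exact two (f 2) (f 3) 0 0 (by grind) (by simp) (by grind) (by grind)
  obtain ⟨B, hB, b0, b2, b3⟩ := step
  have h1 : herm (B.act f) v0 = 1 := by rw [← hf, ← SU42.herm_act B f v0, b0]
  have h2 : herm (B.act f) (B.act f) = 0 := by rw [SU42.herm_act, hff]
  rw [herm_v0] at h1
  rw [herm_eq, b2, b3] at h2
  have hw := om_sq
  simp only [F4.star_def, zero_mul, add_zero] at h2
  rcases F4.cases ((B.act f) 0) with h | h | h | h
  · rw [h] at h1 h2; grind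
  · rw [h] at h1 h2; grind
  · refine ⟨B, hB, b0, ?_⟩
    ext i
    fin_cases i <;> simp [f0] <;> grind
  · refine ⟨tv v0 * B, T.mul_mem (hT _ v0_sing) hB, ?_, ?_⟩
    · rw [SU42.act_mul, b0, tv_act v0_sing, v0_sing, zero_smul, add_zero]
    · rw [SU42.act_mul, tv_act v0_sing, herm_v0]
      ext i
      fin_cases i <;> simp [f0, v0] <;> grind

theorem SU42.apply_eq_act (A : SU42) (i j : Fin 4) : A.1 i j = A.act (Pi.single j 1) i := by
  simp [SU42.act]

theorem eq_one_of_fixes {C : SU42} (d0 : C.act (Pi.single 0 1) = Pi.single 0 1)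
    (d1 : C.act (Pi.single 1 1) = Pi.single 1 1) (d2 : C.act (Pi.single 2 1) = Pi.single 2 1) :
    C = 1 := by
  have a0 : C.act (Pi.single 3 1) 0 = 0 := by
    rw [← herm_single (C.act _) 0, ← d0, SU42.herm_act, herm_single]; simp
  have a1 : C.act (Pi.single 3 1) 1 = 0 := by
    rw [← herm_single (C.act _) 1, ← d1, SU42.herm_act, herm_single]; simp
  have a2 : C.act (Pi.single 3 1) 2 = 0 := by
    rw [← herm_single (C.act _) 2, ← d2, SU42.herm_act, herm_single]; simp
  have hdiag : C.1 = Matrix.diagonal ![1, 1, 1, C.act (Pi.single 3 1) 3] := by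
    ext i j
    rw [SU42.apply_eq_act]
    fin_cases j
    · simp only [Fin.zero_eta, d0]; fin_cases i <;> simp
    · simp only [Fin.mk_one, d1]; fin_cases i <;> simp
    · simp only [Fin.reduceFinMk, d2]; fin_cases i <;> simp
    · simp only [Fin.reduceFinMk]
      fin_cases i
      · simpa using a0
      · simpa using a1
      · simpa using a2
      · simp
  have hdet := (Matrix.mem_specialUnitaryGroup_iff.1 C.2).2
  rw [hdiag, Matrix.det_diagonal] at hdet
  simp only [Fin.prod_univ_four, Matrix.cons_val, one_mul] at hdet
  apply Subtype.ext
  rw [hdiag, hdet]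
  ext i j
  fin_cases i <;> fin_cases j <;> simp

/-- The unitary transvections generate `SU₄(2)`: an arbitrary element can be multiplied by
transvections until it fixes the hyperbolic pair `v0`, `f0`, then until it also fixes the third
basis vector, and the determinant takes care of the last one. -/
theorem eq_top_of_tv_mem {T : Subgroup SU42} (hT : ∀ c, herm c c = 0 → tv c ∈ T) : T = ⊤ := by
  rw [Subgroup.eq_top_iff']
  intro A
  have hw := om_sq
  obtain ⟨B1, hB1, h1⟩ := exists_mem_act_eq_v0 hT (x := A.act v0)
    (by rw [SU42.herm_act, v0_sing])
    (fun h => v0_ne_zero (A.act_injective (by rw [h, SU42.act_zero])))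
  have hf0 : herm f0 f0 = 0 := by simp [herm_eq, f0, F4.star_def]; grind
  obtain ⟨B2, hB2, h2, h3⟩ := exists_mem_act_f0 hT (f := (B1 * A).act f0)
    (by rw [← herm_f0_v0, ← SU42.herm_act (B1 * A) f0 v0, SU42.act_mul _ _ v0, h1])
    (by rw [SU42.herm_act, hf0])
  suffices h : B2 * B1 * A ∈ T by
    rw [Subgroup.mul_mem_cancel_left _ (T.mul_mem hB2 hB1)] at h
    exact h
  rw [← SU42.act_mul] at h3
  rw [← h1, ← SU42.act_mul, ← SU42.act_mul, h1] at h2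
  rw [← mul_assoc] at h3
  generalize B2 * B1 * A = C at h2 h3
  clear h1 hB1 hB2 A B1 B2
  -- `C` fixes `v0` and `f0`, hence the first two basis vectors.
  have c1 : C.act (Pi.single 1 1) = Pi.single 1 1 := by
    have e : (Pi.single 1 1 : V4) = f0 + om • v0 := by
      ext i; fin_cases i <;> simp [f0, v0] <;> grind
    rw [e, SU42.act_add, SU42.act_smul, h2, h3]
  have c0 : C.act (Pi.single 0 1) = Pi.single 0 1 := by
    have e : (Pi.single 0 1 : V4) = v0 + Pi.single 1 1 := by
      ext i; fin_cases i <;> simp [v0]; grind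
    rw [e, SU42.act_add, c1, h2]
  have orth : ∀ D : SU42, D.act (Pi.single 0 1) = Pi.single 0 1 →
      D.act (Pi.single 1 1) = Pi.single 1 1 → ∀ k : Fin 4, k ≠ 0 → k ≠ 1 →
      D.act (Pi.single k 1) 0 = 0 ∧ D.act (Pi.single k 1) 1 = 0 ∧
      D.act (Pi.single k 1) 2 * star (D.act (Pi.single k 1) 2) +
        D.act (Pi.single k 1) 3 * star (D.act (Pi.single k 1) 3) = 1 := by
    intro D d0 d1 k k0 k1
    have e0 : D.act (Pi.single k 1) 0 = 0 := by
      rw [← herm_single (D.act _) 0, ← d0, SU42.herm_act, herm_single]; simp [k0.symm]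
    have e1 : D.act (Pi.single k 1) 1 = 0 := by
      rw [← herm_single (D.act _) 1, ← d1, SU42.herm_act, herm_single]; simp [k1.symm]
    have e2 : herm (D.act (Pi.single k 1)) (D.act (Pi.single k 1)) = 1 := by
      rw [SU42.herm_act, herm_single]; simp
    rw [herm_eq, e0, e1] at e2
    exact ⟨e0, e1, by simpa using e2⟩
  -- An element of `T` fixing the first two basis vectors makes the last coordinate of the image
  -- of the third one vanish.
  have swap : ∃ B ∈ T, (B * C).act (Pi.single 0 1) = Pi.single 0 1 ∧
      (B * C).act (Pi.single 1 1) = Pi.single 1 1 ∧ (B * C).act (Pi.single 2 1) 3 = 0 := by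
    obtain ⟨e0, e1, e2⟩ := orth C c0 c1 2 (by decide) (by decide)
    rcases F4.norm_zero_or_one (C.act (Pi.single 2 1) 3) with ⟨h, h'⟩ | ⟨h, h'⟩
    · exact ⟨1, T.one_mem, by simpa using c0, by simpa using c1, by simpa using h⟩
    · have e3 : C.act (Pi.single 2 1) 2 = 0 := by
        rcases F4.norm_zero_or_one (C.act (Pi.single 2 1) 2) with ⟨g, g'⟩ | ⟨g, g'⟩
        · exact g
        · rw [h', g'] at e2; grind
      have hs : herm ![0, 0, 1, 1] ![0, 0, 1, 1] = 0 := by simp [herm_eq]; grind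
      refine ⟨tv ![0, 0, 1, 1], hT _ hs, ?_, ?_, ?_⟩
      · rw [SU42.act_mul, c0, tv_act hs]; simp [herm_eq]
      · rw [SU42.act_mul, c1, tv_act hs]; simp [herm_eq]
      · rw [SU42.act_mul, tv_act hs]; simp [herm_eq, e3]; grind
  obtain ⟨B, hB, b0, b1, b3⟩ := swap
  rw [← Subgroup.mul_mem_cancel_left _ hB]
  generalize B * C = C at *
  obtain ⟨e0, e1, e2⟩ := orth C b0 b1 2 (by decide) (by decide)
  rw [b3] at e2
  have hp : C.act (Pi.single 2 1) 2 ≠ 0 := by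
    rw [← F4.norm_eq_one_iff]; simpa using e2
  obtain ⟨D, hD, d⟩ := exists_diag_mem hT (i := 2) (j := 3) (by decide) hp
  rw [← Subgroup.mul_mem_cancel_left _ hD]
  have dc : ∀ k : Fin 4, k ≠ 2 → k ≠ 3 → C.act (Pi.single k 1) = Pi.single k 1 →
      (D * C).act (Pi.single k 1) = Pi.single k 1 := by
    intro k k2 k3 hk
    rw [SU42.act_mul, hk]
    obtain ⟨g2, g3, g⟩ := d (Pi.single k 1)
    ext i
    by_cases i2 : i = 2
    · rw [i2, g2, Pi.single_eq_of_ne k2.symm, mul_zero]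
    · by_cases i3 : i = 3
      · rw [i3, g3, Pi.single_eq_of_ne k3.symm, mul_zero]
      · rw [g i i2 i3]
  have d2 : (D * C).act (Pi.single 2 1) = Pi.single 2 1 := by
    rw [SU42.act_mul]
    obtain ⟨g2, g3, g⟩ := d (C.act (Pi.single 2 1))
    have g0 := g 0 (by decide) (by decide)
    have g1 := g 1 (by decide) (by decide)
    have := F4.mul_star_self hp
    ext i
    fin_cases i
    · simp [g0, e0]
    · simp [g1, e1]
    · simp only [Fin.reduceFinMk, Pi.single_eq_same, g2]; rw [mul_comm]; exact this
    · simp [g3, b3]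
  have d0 := dc 0 (by decide) (by decide) b0
  have d1 := dc 1 (by decide) (by decide) b1
  rw [eq_one_of_fixes d0 d1 d2]
  exact T.one_mem


/-! ### Simplicity of `SU₄(2)` -/

/-- A matrix for which all singular vectors are eigenvectors is scalar, and a scalar matrix of
determinant `a ^ 4 = a = 1` is the identity. -/
theorem exists_act_ne_smul {g : SU42} (hg : g ≠ 1) :
    ∃ c : V4, herm c c = 0 ∧ c ≠ 0 ∧ ∀ a : F4, g.act c ≠ a • c := by
  by_contra! h
  apply hg
  have hne : ∀ i j : Fin 4, i ≠ j → ∃ a : F4,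
      g.act (Pi.single i 1 + Pi.single j 1) = a • (Pi.single i 1 + Pi.single j 1) := by
    intro i j hij
    refine h _ ?_ ?_
    · simp [herm_single, hij, hij.symm]; grind
    · intro h0
      have := congrFun h0 i
      simp [hij] at this
  have hne2 : ∀ i j : Fin 4, i ≠ j → ∃ a : F4,
      g.act (Pi.single i 1 + om • Pi.single j 1) = a • (Pi.single i 1 + om • Pi.single j 1) := by
    intro i j hij
    refine h _ ?_ ?_
    · have := F4.mul_star_self om_ne_zero
      simp [herm_single, hij, hij.symm]
      grind
    · intro h0
      have := congrFun h0 i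
      simp [hij] at this
  -- Basis vectors are eigenvectors: off-diagonal coordinates vanish.
  have off : ∀ i j : Fin 4, i ≠ j → ∀ k, k ≠ i → k ≠ j → g.act (Pi.single i 1) k = 0 := by
    intro i j hij k hki hkj
    obtain ⟨a, ha⟩ := hne i j hij
    obtain ⟨b, hb⟩ := hne2 i j hij
    have h1 := congrFun ha k
    have h2 := congrFun hb k
    rw [SU42.act_add] at h1 h2
    rw [SU42.act_smul] at h2
    simp [hki, hkj] at h1 h2
    have := om_ne_one
    grind
  have off' : ∀ i k : Fin 4, k ≠ i → g.act (Pi.single i 1) k = 0 := by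
    intro i k hki
    obtain ⟨j, hj1, hj2⟩ : ∃ j : Fin 4, j ≠ i ∧ j ≠ k := by
      revert i k; decide
    exact off i j hj1.symm k hki hj2.symm
  have eig : ∀ i, g.act (Pi.single i 1) = g.act (Pi.single 0 1) 0 • Pi.single i 1 := by
    intro i
    ext k
    by_cases hki : k = i
    · subst hki
      by_cases hk : k = 0
      · subst hk; simp
      · obtain ⟨a, ha⟩ := hne 0 k (Ne.symm hk)
        have h1 := congrFun ha 0
        have h2 := congrFun ha k
        rw [SU42.act_add] at h1 h2
        have e1 := off' k 0 (Ne.symm hk)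
        have e2 := off' 0 k hk
        simp [hk, Ne.symm hk, e1, e2] at h1 h2
        simp [h1, h2]
    · rw [off' i k hki]; simp [hki]
  set a := g.act (Pi.single 0 1) 0 with ha
  have hdiag : g.1 = Matrix.diagonal fun _ => a := by
    ext i j
    rw [SU42.apply_eq_act, eig, Matrix.diagonal_apply]
    simp [Pi.single_apply]
  have hdet := (Matrix.mem_specialUnitaryGroup_iff.1 g.2).2
  rw [hdiag, Matrix.det_diagonal, Finset.prod_const, Finset.card_univ, Fintype.card_fin,
    F4.pow_four] at hdet
  apply Subtype.ext
  rw [hdiag, hdet]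
  exact Matrix.diagonal_one

/-- Two singular vectors are related if the product of their transvections lies in `N`. -/
def TvRel (N : Subgroup SU42) (a b : V4) : Prop := tv a * tv b ∈ N

section
variable {N : Subgroup SU42} {a b c : V4}

theorem TvRel.symm (ha : herm a a = 0) (hb : herm b b = 0) (h : TvRel N a b) : TvRel N b a := by
  have := N.inv_mem h
  rwa [mul_inv_rev, tv_inv ha, tv_inv hb] at this

theorem TvRel.trans (hb : herm b b = 0) (h : TvRel N a b) (h' : TvRel N b c) :
    TvRel N a c := by
  have := N.mul_mem h h'
  rwa [mul_assoc, ← mul_assoc (tv b), tv_mul_self hb, one_mul] at this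

theorem TvRel.smul_right {m : F4} (hm : m ≠ 0) (hb : herm b b = 0) :
    TvRel N a (m • b) ↔ TvRel N a b := by
  rw [TvRel, tv_smul hm hb, TvRel]

variable [hN : N.Normal]

theorem TvRel.act (A : SU42) (ha : herm a a = 0) (hb : herm b b = 0) (h : TvRel N a b) :
    TvRel N (A.act a) (A.act b) := by
  have := hN.conj_mem _ h A
  rw [TvRel, ← tv_conj A ha, ← tv_conj A hb]
  simpa [mul_assoc] using this

/-- The unipotent radical of the stabilizer of `a` is transitive on the singular points that are
not orthogonal to `a`. -/
theorem TvRel.of_not_orthogonal (ha : herm a a = 0) (hb : herm b b = 0) (hc : herm c c = 0)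
    (hab : herm b a ≠ 0) (hac : herm c a ≠ 0) (h : TvRel N a b) : TvRel N a c := by
  have hb' : herm ((herm b a)⁻¹ • b) ((herm b a)⁻¹ • b) = 0 := by simp [hb]
  have hc' : herm ((herm c a)⁻¹ • c) ((herm c a)⁻¹ • c) = 0 := by simp [hc]
  rw [← TvRel.smul_right (inv_ne_zero hac) hc]
  rw [← TvRel.smul_right (inv_ne_zero hab) hb] at h
  have e1 : herm ((herm b a)⁻¹ • b) a = 1 := by simp [hab]
  have e2 : herm ((herm c a)⁻¹ • c) a = 1 := by simp [hac]
  generalize (herm b a)⁻¹ • b = b' at *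
  generalize (herm c a)⁻¹ • c = c' at *
  have hd : herm (b' + c') a = 0 := by rw [herm_add_left, e1, e2]; grind
  have hd' : herm a (b' + c') = 0 := by rw [← star_herm, hd, star_zero]
  obtain ⟨A, hA⟩ := exists_unip (v := a) (w := b' + c') (m := herm b' c') ha hd (by
    simp [tr4, star_herm, hb', hc', add_comm])
  have := h.act A ha hb'
  have f1 : A.act a = a := by rw [hA, ha, hd']; simp
  have f2 : A.act b' = c' := by
    rw [hA, e1, herm_add_right, hb']
    have : herm b' c' + herm b' c' = 0 := CharTwo.add_self_eq_zero _
    simp [this, ← add_assoc, V4.add_self]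
  rwa [f1, f2] at this

/-- A nontrivial normal subgroup contains the product of two noncommuting transvections. A
commutator of an element of `N` with a transvection is a product of two transvections; if these
commute, then conjugating by a third one and multiplying makes them noncommuting. -/
theorem exists_tvRel (h : N ≠ ⊥) : ∃ a b : V4, herm a a = 0 ∧ herm b b = 0 ∧ herm b a ≠ 0 ∧
    TvRel N a b := by
  obtain ⟨g, hg, hg1⟩ := N.bot_or_exists_ne_one.resolve_left h
  obtain ⟨c, hc, hc0, hgc⟩ := exists_act_ne_smul hg1
  have hgcs : herm (g.act c) (g.act c) = 0 := by rw [SU42.herm_act, hc]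
  have hrel : TvRel N (g.act c) c := by
    rw [TvRel, ← tv_conj g hc]
    have := N.mul_mem hg (hN.conj_mem _ (N.inv_mem hg) (tv c))
    rw [tv_inv hc] at this
    simpa [mul_assoc] using this
  by_cases hne : herm c (g.act c) = 0
  swap
  · exact ⟨_, _, hgcs, hc, hne, hrel⟩
  obtain ⟨B, hB⟩ := exists_act_sing_eq hc hc0 v0_sing v0_ne_zero
  have hrel' := hrel.act B hgcs hc
  rw [hB] at hrel'
  have hbs : herm (B.act (g.act c)) (B.act (g.act c)) = 0 := by rw [SU42.herm_act, hgcs]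
  have hbv : herm (B.act (g.act c)) v0 = 0 := by
    rw [← hB, SU42.herm_act, ← star_herm, hne, star_zero]
  have hbn : ∀ a : F4, B.act (g.act c) ≠ a • v0 := by
    intro a ha
    apply hgc a
    apply B.act_injective
    rw [ha, SU42.act_smul, hB]
  generalize B.act (g.act c) = b at *
  -- A singular vector orthogonal to `v0` but not to `b`.
  obtain ⟨z, hz, hzv, hzb⟩ : ∃ z : V4, herm z z = 0 ∧ herm v0 z = 0 ∧ herm b z ≠ 0 := by
    by_contra! hall
    have hw := om_sq
    have h1 := hall ![0, 0, 1, 1] (by simp [herm_eq]; grind) (by simp [herm_eq, v0])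
    have h2 := hall ![0, 0, 1, om] (by simp [herm_eq, F4.star_def]; grind) (by simp [herm_eq, v0])
    simp [herm_eq, F4.star_def] at h1 h2
    have h0 := om_ne_zero
    rw [herm_v0] at hbv
    apply hbn (b 0)
    ext i
    fin_cases i <;> simp [v0] <;> grind
  have hr2 := hrel'.act (tv z) hbs v0_sing
  rw [tv_act hz v0, hzv, zero_smul, add_zero] at hr2
  have hs : herm ((tv z).act b) ((tv z).act b) = 0 := by rw [SU42.herm_act, hbs]
  refine ⟨_, _, hbs, hs, ?_, hrel'.trans v0_sing (hr2.symm hs v0_sing)⟩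
  rw [tv_act hz, herm_add_left, hbs, zero_add, herm_smul_left, ← star_herm b z,
    F4.mul_star_self hzb]
  exact one_ne_zero

end

/-- `SU₄(2)` is simple. All products of two transvections lie in `N`, as the graph of
nonorthogonality on the singular points is connected; since the product of the five transvections
with centres on a totally isotropic line is trivial, every transvection lies in `N`. -/
theorem SU42.normal_eq_top {N : Subgroup SU42} [hN : N.Normal] (h : N ≠ ⊥) : N = ⊤ := by
  obtain ⟨a, b, ha, hb, hab, hrel⟩ := exists_tvRel h
  have ha0 : a ≠ 0 := by rintro rfl; simp at hab
  have all : ∀ x y : V4, herm x x = 0 → herm y y = 0 → herm y x ≠ 0 → TvRel N x y := by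
    intro x y hx hy hxy
    have hx0 : x ≠ 0 := by rintro rfl; simp at hxy
    obtain ⟨A, hA⟩ := exists_act_sing_eq ha ha0 hx hx0
    have := hrel.act A ha hb
    rw [hA] at this
    refine this.of_not_orthogonal hx (by rw [SU42.herm_act, hb]) hy ?_ hxy
    rwa [← hA, SU42.herm_act]
  have all0 : ∀ y : V4, herm y y = 0 → y ≠ 0 → TvRel N v0 y := by
    intro y hy hy0
    obtain ⟨c, hc, h1, h2⟩ := exists_sing_not_orthogonal hy0
    refine (all v0 c v0_sing hc ?_).trans hc (all c y hc hy h2)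
    rw [← star_herm]; simpa using h1
  have any : ∀ x y : V4, herm x x = 0 → x ≠ 0 → herm y y = 0 → y ≠ 0 → TvRel N x y :=
    fun x y hx hx0 hy hy0 => ((all0 x hx hx0).symm v0_sing hx).trans v0_sing (all0 y hy hy0)
  have hq : herm (![0, 0, 1, 1] : V4) ![0, 0, 1, 1] = 0 := by simp [herm_eq]; grind
  have hvq : herm v0 ![0, 0, 1, 1] = 0 := by simp [herm_eq, v0]
  have hqv : herm ![0, 0, 1, 1] v0 = 0 := by simp [herm_v0]
  set q : V4 := ![0, 0, 1, 1] with hqdef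
  have hs : ∀ m : F4, herm (v0 + m • q) (v0 + m • q) = 0 := by
    intro m; simp [hq, hvq, hqv, v0_sing]
  have hs0 : ∀ m : F4, v0 + m • q ≠ 0 := by
    intro m h0
    have := congrFun h0 0
    simp [v0, hqdef] at this
  have hq0 : q ≠ 0 := fun h0 => by simpa [hqdef] using congrFun h0 2
  have five : tv v0 * tv q * (tv (v0 + (1 : F4) • q) * tv (v0 + om • q)) =
      tv (v0 + (om + 1) • q) := by
    refine SU42.ext_act fun x => ?_
    rw [SU42.act_mul, SU42.act_mul, SU42.act_mul, tv_act v0_sing, tv_act hq, tv_act (hs _),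
      tv_act (hs _), tv_act (hs _)]
    simp only [herm_add_left, herm_add_right, herm_smul_left, herm_smul_right, hq, hvq, hqv,
      v0_sing, star_one, star_om, star_add]
    have hw := om_sq
    ext i
    simp only [Pi.add_apply, Pi.smul_apply, smul_eq_mul]
    grind
  have hmem : tv (v0 + (om + 1) • q) ∈ N := by
    rw [← five]
    exact N.mul_mem (any _ _ v0_sing v0_ne_zero hq hq0) (any _ _ (hs _) (hs0 _) (hs _) (hs0 _))
  refine eq_top_of_tv_mem fun c hc => ?_
  by_cases hc0 : c = 0
  · rw [hc0, tv_zero]; exact N.one_mem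
  · have := N.mul_mem (any c _ hc hc0 (hs (om + 1)) (hs0 _)) hmem
    rwa [mul_assoc, tv_mul_self (hs _), mul_one] at this

theorem tv_v0_ne_one : tv v0 ≠ 1 := by
  intro h
  have h1 := tv_act v0_sing f0
  rw [h, SU42.act_one, herm_f0_v0, one_smul] at h1
  exact v0_ne_zero (by simpa using h1)

instance SU42.isSimpleGroup : IsSimpleGroup SU42 where
  exists_pair_ne := ⟨_, _, tv_v0_ne_one⟩
  eq_bot_or_eq_top_of_normal _ _ := or_iff_not_imp_left.2 SU42.normal_eq_top

theorem SU42.exists_not_commute : ∃ A B : SU42, A * B ≠ B * A := by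
  by_contra! h
  have hf : herm f0 f0 = 0 := by
    have := om_sq
    simp [herm_eq, f0, F4.star_def]; grind
  have h1 := tv_conj (tv f0) v0_sing
  rw [h (tv f0) (tv v0), mul_assoc, mul_inv_cancel, mul_one] at h1
  have hv : herm v0 f0 = 1 := by rw [← star_herm, herm_f0_v0, star_one]
  have e : (tv f0).act v0 = v0 + f0 := by rw [tv_act hf, hv, one_smul]
  have hs : herm (v0 + f0) (v0 + f0) = 0 := by rw [← e, SU42.herm_act, v0_sing]
  have h2 := congrArg (fun A => SU42.act A v0) h1
  simp only [e, tv_act v0_sing, tv_act hs, v0_sing, herm_add_right, hv, zero_add, one_smul,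
    zero_smul, add_zero, ← add_assoc, V4.add_self] at h2
  have := congrFun h2 1
  simp [f0, v0] at this
  exact om_ne_zero this


open scoped commutatorElement

/-! ### Components and the generalized Fitting subgroup -/

section Components
variable {X : Type*} [Group X]

theorem IsQuasisimple.commutator_eq {K : Subgroup X} (hK : IsQuasisimple K) : ⁅K, K⁆ = K := by
  rw [← Subgroup.map_subtype_commutator, hK.1.commutator_eq_top, ← MonoidHom.range_eq_map,
    Subgroup.range_subtype]

/-- A normal subgroup of a quasisimple group is everything or central. -/
theorem IsQuasisimple.eq_top_or_le_center {K : Type*} [Group K] (hK : IsQuasisimple K)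
    (M : Subgroup K) [M.Normal] : M = ⊤ ∨ M ≤ Subgroup.center K := by
  have := hK.2
  have hn : (M.map (QuotientGroup.mk' (Subgroup.center K))).Normal :=
    Subgroup.Normal.map inferInstance _ (QuotientGroup.mk'_surjective _)
  rcases hn.eq_bot_or_eq_top with h | h
  · right
    rwa [Subgroup.map_eq_bot_iff, QuotientGroup.ker_mk'] at h
  · left
    have hdec : ∀ k : K, ∃ m ∈ M, ∃ z ∈ Subgroup.center K, k = m * z := by
      intro k
      have : QuotientGroup.mk' (Subgroup.center K) k ∈
          M.map (QuotientGroup.mk' (Subgroup.center K)) := by rw [h]; trivial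
      obtain ⟨m, hm, hmk⟩ := this
      refine ⟨m, hm, m⁻¹ * k, QuotientGroup.eq.1 hmk, by simp⟩
    rw [eq_top_iff, ← hK.1.commutator_eq_top, commutator_def, Subgroup.commutator_le]
    intro g _ g' _
    obtain ⟨m, hm, z, hz, rfl⟩ := hdec g
    obtain ⟨m', hm', z', hz', rfl⟩ := hdec g'
    rw [Subgroup.mem_center_iff] at hz hz'
    have e : ⁅m * z, m' * z'⁆ = ⁅m, m'⁆ := by
      have h1 : m * z * (m' * z') = m * m' * (z * z') := by
        rw [mul_assoc, ← mul_assoc z, ← hz m']; group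
      have h2 : m' * z' * (m * z) = m' * m * (z * z') := by
        rw [mul_assoc, ← mul_assoc z', ← hz' m, mul_assoc m, hz z', mul_assoc]
      rw [commutatorElement_def, commutatorElement_def]
      calc _ = (m * z * (m' * z')) * (m' * z' * (m * z))⁻¹ := by group
        _ = _ := by rw [h1, h2]; group
    rw [e, commutatorElement_def]
    exact M.mul_mem (M.mul_mem (M.mul_mem hm hm') (M.inv_mem hm)) (M.inv_mem hm')

/-- A component is contained in a given normal subgroup or commutes with it. -/
theorem IsComponent.le_or_commutator_eq_bot {K : Subgroup X} (hK : IsComponent K)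
    (N : Subgroup X) [N.Normal] : K ≤ N ∨ ⁅K, N⁆ = ⊥ := by
  have hKK := hK.2.commutator_eq
  -- The statement is carried up along a subnormal series from `K` to the whole group.
  have key : ∀ Y : Subgroup X, Y.IsSubnormal → K ≤ Y → (K ≤ N ∨ ⁅K, N ⊓ Y⁆ = ⊥) →
      K ≤ N ∨ ⁅K, N⁆ = ⊥ := by
    intro Y hY
    induction hY with
    | top => intro _ h; simpa using h
    | step H Y hHY _ hn ih =>
      intro hKH h
      refine ih (hKH.trans hHY) (h.imp_right fun h => ?_)
      have h1 : ⁅N ⊓ Y, K⁆ ≤ N ⊓ H := by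
        rw [Subgroup.commutator_le]
        intro n hn' k hk
        refine ⟨?_, ?_⟩
        · rw [commutatorElement_def, mul_assoc, mul_assoc, ← mul_assoc k]
          exact N.mul_mem hn'.1 (Subgroup.Normal.conj_mem inferInstance _ (N.inv_mem hn'.1) k)
        · have := hn.conj_mem ⟨k, hHY (hKH hk)⟩ (hKH hk) ⟨n, hn'.2⟩
          rw [commutatorElement_def]
          exact H.mul_mem this (H.inv_mem (hKH hk))
      have h2 : ⁅⁅N ⊓ Y, K⁆, K⁆ = ⊥ := by
        rw [eq_bot_iff, ← h, Subgroup.commutator_comm K]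
        exact Subgroup.commutator_mono h1 le_rfl
      have h3 : ⁅⁅K, N ⊓ Y⁆, K⁆ = ⊥ := by rw [Subgroup.commutator_comm K]; exact h2
      have h4 := Subgroup.commutator_commutator_eq_bot_of_rotate h3 h2
      rwa [hKK] at h4
  refine key K hK.1 le_rfl ?_
  have := Subgroup.Normal.subgroupOf (H := N) inferInstance K
  rcases hK.2.eq_top_or_le_center (N.subgroupOf K) with h | h
  · exact .inl (Subgroup.subgroupOf_eq_top.1 h)
  · right
    rw [Subgroup.commutator_eq_bot_iff_le_centralizer]
    intro k hk
    rw [Subgroup.mem_centralizer_iff]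
    rintro n ⟨hn, hnK⟩
    have : (⟨n, hnK⟩ : K) ∈ Subgroup.center K := h hn
    have := Subgroup.mem_center_iff.1 this ⟨k, hk⟩
    exact (congrArg Subtype.val this).symm

variable {S : Type*} [Group S] [IsSimpleGroup S]

theorem isMulCommutative_of_card_dvd_three {C : Type*} [Group C] (h : Nat.card C ∣ 3) (a b : C) :
    a * b = b * a := by
  rcases (Nat.dvd_prime Nat.prime_three).1 h with h | h
  · have := (Nat.card_eq_one_iff_unique.1 h).1
    exact Subsingleton.elim _ _
  · have : Fact (Nat.Prime 3) := ⟨Nat.prime_three⟩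
    have := isCyclic_of_prime_card h
    exact (IsCyclic.commGroup (α := C)).mul_comm a b

/-- The generalized Fitting subgroup is contained in the product of a normal simple nonabelian
subgroup and its centralizer. -/
theorem generalizedFitting_le (hS : ∃ a b : S, a * b ≠ b * a) (j : S →* X)
    (hj : Function.Injective j) [hI : j.range.Normal] :
    generalizedFitting X ≤ j.range ⊔ Subgroup.centralizer (j.range : Set X) := by
  have hcomp : ∀ N : Subgroup X, N.Normal → N ⊓ j.range = ⊥ ∨ j.range ≤ N := by
    intro N hN
    have : (N.comap j).Normal := hN.comap j
    rcases this.eq_bot_or_eq_top with h | h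
    · left
      rw [eq_bot_iff]
      rintro _ ⟨h1, s, rfl⟩
      have : s ∈ N.comap j := h1
      rw [h, Subgroup.mem_bot] at this
      simp [this]
    · right
      rintro _ ⟨s, rfl⟩
      have : s ∈ N.comap j := by rw [h]; trivial
      exact this
  refine sup_le (sSup_le ?_) (sSup_le ?_)
  · rintro N ⟨hN, hnil⟩
    refine le_trans ?_ le_sup_right
    rcases hcomp N hN with h | h
    · intro n hn
      rw [Subgroup.mem_centralizer_iff]
      intro i hi
      exact (Subgroup.commute_of_normal_of_disjoint N j.range hN hI (disjoint_iff.2 h) n i hn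
        hi).symm
    · exfalso
      let f : S →* N := j.codRestrict N fun s => h ⟨s, rfl⟩
      have hf : Function.Injective f := fun a b hab => hj (congrArg Subtype.val hab)
      have : Group.IsSolvable S := Group.isSolvable_of_isSolvable_injective hf
      obtain ⟨a, b, hab⟩ := hS
      exact hab (IsSimpleGroup.comm_iff_isSolvable.2 this a b)
  · intro K hK
    rcases IsComponent.le_or_commutator_eq_bot hK j.range with h | h
    · exact h.trans le_sup_left
    · rw [Subgroup.commutator_eq_bot_iff_le_centralizer] at h
      exact h.trans le_sup_right

/-- A normal simple nonabelian subgroup whose centralizer has order dividing `3` is the only copy of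
itself inside the generalized Fitting subgroup: modulo it, that subgroup is covered by the abelian
centralizer. -/
theorem range_eq_of_le_generalizedFitting [Finite S] (hS : ∃ a b : S, a * b ≠ b * a) (j : S →* X)
    (hj : Function.Injective j) [hI : j.range.Normal]
    (hC : Nat.card (Subgroup.centralizer (j.range : Set X)) ∣ 3) (p : S →* X)
    (hp : Function.Injective p) (hpF : p.range ≤ generalizedFitting X) : p.range = j.range := by
  have hle := hpF.trans (generalizedFitting_le hS j hj)
  let q := QuotientGroup.mk' j.range
  have hcomm : ∀ a b : S, q (p a) * q (p b) = q (p b) * q (p a) := by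
    have hq : ∀ a : S, ∃ c ∈ Subgroup.centralizer (j.range : Set X), q (p a) = q c := by
      intro a
      obtain ⟨i, hi, c, hc, e⟩ := Subgroup.mem_sup_of_normal_left.1 (hle ⟨a, rfl⟩)
      refine ⟨c, hc, ?_⟩
      rw [← e, map_mul, show q i = 1 from (QuotientGroup.eq_one_iff i).2 hi, one_mul]
    intro a b
    obtain ⟨c, hc, e⟩ := hq a
    obtain ⟨d, hd, e'⟩ := hq b
    have := isMulCommutative_of_card_dvd_three hC ⟨c, hc⟩ ⟨d, hd⟩
    rw [e, e', ← map_mul, ← map_mul, show c * d = d * c from congrArg Subtype.val this]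
  have hker : (q.comp p).ker = ⊤ := by
    refine ((q.comp p).normal_ker.eq_bot_or_eq_top).resolve_left fun h => ?_
    obtain ⟨a, b, hab⟩ := hS
    apply hab
    apply (MonoidHom.ker_eq_bot_iff _).1 h
    simpa using hcomm a b
  have hpj : p.range ≤ j.range := by
    rintro _ ⟨a, rfl⟩
    have : a ∈ (q.comp p).ker := by rw [hker]; trivial
    exact (QuotientGroup.eq_one_iff _).1 this
  have hfin : Finite j.range := Finite.of_surjective j.rangeRestrict j.rangeRestrict_surjective
  refine Subgroup.eq_of_le_of_card_ge hpj (le_of_eq ?_)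
  rw [← Nat.card_congr (MonoidHom.ofInjective hj).toEquiv,
    ← Nat.card_congr (MonoidHom.ofInjective hp).toEquiv]

/-- `X` has a normal subgroup isomorphic to `S` on which it induces all automorphisms, and whose
centralizer has order dividing `3`. -/
def HasFullNormalCopy (S X : Type*) [Group S] [Group X] : Prop :=
  ∃ j : S →* X, Function.Injective j ∧ j.range.Normal ∧
    (∀ α : MulAut S, ∃ x : X, ∀ a, x * j a * x⁻¹ = j (α a)) ∧
    Nat.card (Subgroup.centralizer (j.range : Set X)) ∣ 3

theorem HasFullNormalCopy.of_mulEquiv {S X Y : Type*} [Group S] [Group X] [Group Y] (e : Y ≃* X)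
    (h : HasFullNormalCopy S X) : HasFullNormalCopy S Y := by
  obtain ⟨j, hj, hn, hα, hC⟩ := h
  have hr : (e.symm.toMonoidHom.comp j).range = j.range.comap e.toMonoidHom := by
    ext y
    simp only [MonoidHom.mem_range, Subgroup.mem_comap, MonoidHom.comp_apply]
    refine exists_congr fun a => ?_
    simp [MulEquiv.symm_apply_eq]
  refine ⟨e.symm.toMonoidHom.comp j, e.symm.injective.comp hj, ?_, ?_, ?_⟩
  · rw [hr]; exact hn.comap _
  · intro α
    obtain ⟨x, hx⟩ := hα α
    refine ⟨e.symm x, fun a => e.injective ?_⟩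
    simpa using hx a
  · rw [hr]
    convert hC using 1
    refine Nat.card_congr (e.toEquiv.subtypeEquiv fun y => ?_)
    simp only [Subgroup.mem_centralizer_iff]
    constructor
    · intro h z hz
      have := h (e.symm z) (by simpa using hz)
      simpa using congrArg e this
    · intro h z hz
      have := h (e z) (by simpa using hz)
      exact e.injective (by simpa using this)

theorem eq_one_of_forall_commute {a : S} (hS : ∃ a b : S, a * b ≠ b * a)
    (h : ∀ b : S, a * b = b * a) : a = 1 := by
  rcases (Subgroup.instNormalCenter (G := S)).eq_bot_or_eq_top with hc | hc
  · have : a ∈ Subgroup.center S := Subgroup.mem_center_iff.2 fun g => (h g).symm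
    rwa [hc, Subgroup.mem_bot] at this
  · obtain ⟨x, y, hxy⟩ := hS
    have : y ∈ Subgroup.center S := by rw [hc]; trivial
    exact absurd (Subgroup.mem_center_iff.1 this x) hxy

theorem mulAut_conj_injective (hS : ∃ a b : S, a * b ≠ b * a) :
    Function.Injective (MulAut.conj : S →* MulAut S) := by
  rw [injective_iff_map_eq_one]
  intro a ha
  refine eq_one_of_forall_commute hS fun b => ?_
  have := congrArg (fun f : MulAut S => f b) ha
  simp only [MulAut.conj_apply, MulAut.one_apply] at this
  rwa [mul_inv_eq_iff_eq_mul] at this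

theorem mulAut_mul_conj {S : Type*} [Group S] (α : MulAut S) (a : S) :
    α * MulAut.conj a * α⁻¹ = MulAut.conj (α a) := by
  ext b
  simp

theorem eq_one_of_commute_conj (hS : ∃ a b : S, a * b ≠ b * a) {α : MulAut S}
    (h : ∀ a, α * MulAut.conj a = MulAut.conj a * α) : α = 1 := by
  ext a
  apply mulAut_conj_injective hS
  rw [← mulAut_mul_conj, h]
  simp

theorem hasFullNormalCopy_mulAut (hS : ∃ a b : S, a * b ≠ b * a) :
    HasFullNormalCopy S (MulAut S) := by
  refine ⟨MulAut.conj, mulAut_conj_injective hS, ⟨?_⟩, fun α => ⟨α, mulAut_mul_conj α⟩, ?_⟩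
  · rintro _ ⟨a, rfl⟩ α
    exact ⟨α a, (mulAut_mul_conj α a).symm⟩
  · have : Subgroup.centralizer ((MulAut.conj : S →* MulAut S).range : Set (MulAut S)) = ⊥ := by
      rw [eq_bot_iff]
      intro α hα
      rw [Subgroup.mem_centralizer_iff] at hα
      exact eq_one_of_commute_conj hS fun a => (hα _ ⟨a, rfl⟩).symm
    rw [this]
    simp

/-- A subgroup of index `2` of `Aut(S) × Sym(3)` that is not a direct product meets the second
factor in its subgroup of order `3` and projects onto the first factor. -/
theorem hasFullNormalCopy_of_not_decomposable (hS : ∃ a b : S, a * b ≠ b * a)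
    (D : Subgroup (MulAut S × Equiv.Perm (Fin 3))) (hD : D.index = 2)
    (hdec : ¬ IsDirectlyDecomposable D) : HasFullNormalCopy S D := by
  have hDn : D.Normal := Subgroup.normal_of_index_eq_two hD
  have hmul := @Subgroup.mul_mem_iff_of_index_two _ _ _ hD
  -- Simple nonabelian groups have no quotient of order two.
  have hinn : ∀ a : S, ((MulAut.conj a, 1) : MulAut S × Equiv.Perm (Fin 3)) ∈ D := by
    let f : S →* MulAut S × Equiv.Perm (Fin 3) := (MonoidHom.inl _ _).comp MulAut.conj
    have hfn : (D.comap f).Normal := hDn.comap f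
    have : D.comap f = ⊤ := by
      refine hfn.eq_bot_or_eq_top.resolve_left fun h => ?_
      obtain ⟨a, b, hab⟩ := hS
      have hm : f (a * b * a⁻¹ * b⁻¹) ∈ D := by
        simp only [map_mul, map_inv, hmul, D.inv_mem_iff]; tauto
      have : a * b * a⁻¹ * b⁻¹ ∈ D.comap f := hm
      rw [h, Subgroup.mem_bot] at this
      apply hab
      rw [mul_inv_eq_one, mul_inv_eq_iff_eq_mul] at this
      exact this
    intro a
    have : a ∈ D.comap f := by rw [this]; trivial
    exact this
  let W : Subgroup (Equiv.Perm (Fin 3)) := D.comap (MonoidHom.inr _ _)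
  have hWmem : ∀ s, s ∈ W ↔ ((1, s) : MulAut S × Equiv.Perm (Fin 3)) ∈ D := fun s => Iff.rfl
  have hWtop : ∃ s, s ∉ W := by
    by_contra! hall
    apply hdec
    refine ⟨(Subgroup.prod ⊥ ⊤).subgroupOf D, (Subgroup.prod ⊤ ⊥).subgroupOf D, ?_, ?_, ?_, ?_,
      ?_⟩
    · have : (Subgroup.prod (⊥ : Subgroup (MulAut S)) (⊤ : Subgroup (Equiv.Perm (Fin 3)))).Normal :=
        inferInstance
      exact this.subgroupOf D
    · have : (Subgroup.prod (⊤ : Subgroup (MulAut S)) (⊥ : Subgroup (Equiv.Perm (Fin 3)))).Normal :=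
        inferInstance
      exact this.subgroupOf D
    · intro h
      have h1 := hall (Equiv.swap 0 1)
      have h2 : (⟨(1, Equiv.swap 0 1), h1⟩ : D) ∈ (Subgroup.prod ⊥ ⊤).subgroupOf D := by
        rw [Subgroup.mem_subgroupOf, Subgroup.mem_prod]; simp
      rw [h, Subgroup.mem_bot] at h2
      have h3 := congrArg (fun x : D => x.1.2) h2
      have h4 : Equiv.swap (0 : Fin 3) 1 = 1 := h3
      exact absurd h4 (by decide)
    · intro h
      obtain ⟨a, b, hab⟩ := hS
      have h2 : (⟨(MulAut.conj a, 1), hinn a⟩ : D) ∈ (Subgroup.prod ⊤ ⊥).subgroupOf D := by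
        rw [Subgroup.mem_subgroupOf, Subgroup.mem_prod]; simp
      rw [h, Subgroup.mem_bot] at h2
      have h3 : MulAut.conj a = 1 := congrArg (fun x : D => x.1.1) h2
      have h4 : a = 1 := mulAut_conj_injective ⟨a, b, hab⟩ (by rw [h3, map_one])
      simp [h4] at hab
    · rw [isCompl_iff, disjoint_iff, codisjoint_iff]
      constructor
      · rw [eq_bot_iff]
        rintro ⟨⟨x, s⟩, hx⟩ ⟨h1, h2⟩
        simp [Subgroup.mem_subgroupOf, Subgroup.mem_prod] at h1 h2
        simp [h1, h2]
      · rw [eq_top_iff]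
        rintro ⟨⟨x, s⟩, hx⟩ -
        have hs : ((1, s) : MulAut S × Equiv.Perm (Fin 3)) ∈ D := hall s
        have hx1 : ((x, 1) : MulAut S × Equiv.Perm (Fin 3)) ∈ D := by
          have := D.mul_mem hx (D.inv_mem hs)
          simpa using this
        have e : (⟨(x, s), hx⟩ : D) = ⟨(1, s), hs⟩ * ⟨(x, 1), hx1⟩ := by
          apply Subtype.ext; simp
        rw [e]
        refine Subgroup.mul_mem_sup ?_ ?_ <;>
          (rw [Subgroup.mem_subgroupOf, Subgroup.mem_prod]; simp)
  obtain ⟨s0, hs0⟩ := hWtop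
  have hWindex : W.index = 2 := by
    rw [Subgroup.index_eq_two_iff]
    refine ⟨s0, fun s => ?_⟩
    have h1 : ((1, s * s0) : MulAut S × Equiv.Perm (Fin 3)) = (1, s) * (1, s0) := by simp
    rw [hWmem, hWmem, h1, hmul]
    rw [hWmem] at hs0
    simp only [hs0, iff_false, xor_def]
    tauto
  have hWcard : Nat.card W = 3 := by
    have h1 := W.card_mul_index
    rw [hWindex, Nat.card_eq_fintype_card (α := Equiv.Perm (Fin 3)), Fintype.card_perm] at h1
    simp [Nat.factorial] at h1
    omega
  let j : S →* D := ((MonoidHom.inl _ _).comp MulAut.conj).codRestrict D hinn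
  have hj1 : ∀ a, (j a).1 = (MulAut.conj a, 1) := fun a => rfl
  refine ⟨j, ?_, ⟨?_⟩, ?_, ?_⟩
  · intro a b hab
    exact mulAut_conj_injective hS (congrArg (fun x : D => x.1.1) hab)
  · rintro _ ⟨a, rfl⟩ ⟨⟨x, s⟩, hx⟩
    refine ⟨x a, Subtype.ext ?_⟩
    simp [hj1, ← mulAut_mul_conj x a]
  · intro α
    obtain ⟨s, hs⟩ : ∃ s, ((α, s) : MulAut S × Equiv.Perm (Fin 3)) ∈ D := by
      by_cases h : ((α, 1) : MulAut S × Equiv.Perm (Fin 3)) ∈ D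
      · exact ⟨1, h⟩
      · refine ⟨s0, ?_⟩
        have e : ((α, s0) : MulAut S × Equiv.Perm (Fin 3)) = (α, 1) * (1, s0) := by simp
        rw [e, hmul]
        rw [hWmem] at hs0
        tauto
    refine ⟨⟨(α, s), hs⟩, fun a => Subtype.ext ?_⟩
    simp [hj1, ← mulAut_mul_conj α a]
  · have hmem : ∀ x : D, x ∈ Subgroup.centralizer (j.range : Set D) → x.1.1 = 1 := by
      intro x hx
      rw [Subgroup.mem_centralizer_iff] at hx
      refine eq_one_of_commute_conj hS fun a => ?_
      exact (congrArg (fun x : D => x.1.1) (hx _ ⟨a, rfl⟩)).symm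
    have hcard : Nat.card (Subgroup.centralizer (j.range : Set D)) = Nat.card W := by
      refine Nat.card_congr ⟨fun x => ⟨x.1.1.2, ?_⟩, fun s => ⟨⟨(1, s.1), s.2⟩, ?_⟩, ?_, ?_⟩
      · rw [hWmem]
        have := x.1.2
        have h1 := hmem x.1 x.2
        rwa [← h1]
      · rw [Subgroup.mem_centralizer_iff]
        rintro _ ⟨a, rfl⟩
        apply Subtype.ext
        simp [hj1]
      · rintro ⟨x, hx⟩
        apply Subtype.ext
        apply Subtype.ext
        have := hmem x hx
        simp [← this]
      · intro s; rfl
    rw [hcard, hWcard]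

end Components


/-! ### Counting with conjugation actions of `2`-groups -/

section Counting
variable {G : Type*} [Group G]

/-- The conjugation action of a subgroup on an invariant set. -/
@[reducible] def conjActionOn (P : Subgroup G) (N : Set G)
    (hN : ∀ a ∈ P, ∀ s ∈ N, a * s * a⁻¹ ∈ N) : MulAction P N where
  smul a s := ⟨a.1 * s.1 * a.1⁻¹, hN _ a.2 _ s.2⟩
  one_smul s := Subtype.ext (by change 1 * s.1 * 1⁻¹ = s.1; simp)
  mul_smul a b s := Subtype.ext (by
    change (a.1 * b.1) * s.1 * (a.1 * b.1)⁻¹ = a.1 * (b.1 * s.1 * b.1⁻¹) * a.1⁻¹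
    group)

theorem conj_eq_iff {a s : G} : a * s * a⁻¹ = s ↔ a * s = s * a := mul_inv_eq_iff_eq_mul

theorem ncard_modEq_fixed [Finite G] {P : Subgroup G} (hP : IsPGroup 2 P) {N : Set G}
    (hN : ∀ a ∈ P, ∀ s ∈ N, a * s * a⁻¹ ∈ N) :
    N.ncard ≡ {s | s ∈ N ∧ ∀ a ∈ P, a * s = s * a}.ncard [MOD 2] := by
  let := conjActionOn P N hN
  have h := hP.card_modEq_card_fixedPoints N
  have e : Nat.card (MulAction.fixedPoints P N) =
      {s | s ∈ N ∧ ∀ a ∈ P, a * s = s * a}.ncard := by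
    refine Nat.card_congr ⟨fun s => ⟨s.1.1, s.1.2, fun a ha => ?_⟩,
      fun s => ⟨⟨s.1, s.2.1⟩, fun a => ?_⟩, fun s => rfl, fun s => rfl⟩
    · exact conj_eq_iff.1 (congrArg Subtype.val (s.2 ⟨a, ha⟩))
    · exact Subtype.ext (conj_eq_iff.2 (s.2.2 a.1 a.2))
  rwa [e] at h

/-- The hypothesis says that all orbits of `P` on `N` have more than two elements; as `P` is a
`2`-group, their lengths are then multiples of `4`. -/
theorem four_dvd_ncard [Finite G] {P : Subgroup G} (hP : IsPGroup 2 P) {N : Set G}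
    (hN : ∀ a ∈ P, ∀ s ∈ N, a * s * a⁻¹ ∈ N)
    (h : ∀ s ∈ N, ∃ x ∈ P, ∃ y ∈ P, x * s ≠ s * x ∧ y * s ≠ s * y ∧
      (x⁻¹ * y) * s ≠ s * (x⁻¹ * y)) : 4 ∣ N.ncard := by
  classical
  let := conjActionOn P N hN
  have : Fintype (Quotient (MulAction.orbitRel P N)) := Fintype.ofFinite _
  change 4 ∣ Nat.card N
  rw [Nat.card_congr (MulAction.selfEquivSigmaOrbits P N), Nat.card_sigma]
  refine Finset.dvd_sum fun q _ => ?_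
  obtain ⟨n, hn⟩ := hP.card_orbit q.out
  rw [hn]
  obtain ⟨x, hx, y, hy, h1, h2, h3⟩ := h q.out.1 q.out.2
  have three : 2 < Nat.card (MulAction.orbit P q.out) := by
    change 2 < Set.ncard (MulAction.orbit P q.out)
    rw [Set.two_lt_ncard_iff]
    refine ⟨q.out, (⟨x, hx⟩ : P) • q.out, (⟨y, hy⟩ : P) • q.out, MulAction.mem_orbit_self _,
      MulAction.mem_orbit _ _, MulAction.mem_orbit _ _, fun e => h1 ?_, fun e => h2 ?_,
      fun e => h3 ?_⟩
    · exact conj_eq_iff.1 (congrArg Subtype.val e).symm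
    · exact conj_eq_iff.1 (congrArg Subtype.val e).symm
    · have e' : x * q.out.1 * x⁻¹ = y * q.out.1 * y⁻¹ := congrArg Subtype.val e
      rw [← conj_eq_iff]
      calc x⁻¹ * y * q.out.1 * (x⁻¹ * y)⁻¹ = x⁻¹ * (y * q.out.1 * y⁻¹) * x := by group
        _ = q.out.1 := by rw [← e']; group
  rw [hn] at three
  have : 2 ≤ n := by
    by_contra hlt
    have : n = 0 ∨ n = 1 := by omega
    rcases this with rfl | rfl <;> simp at three
  exact pow_dvd_pow 2 this

theorem ncard_conj_mul_card [Finite G] (K : Subgroup G) (u : G) :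
    {s | ∃ h ∈ K, s = h * u * h⁻¹}.ncard * Nat.card (K ⊓ Subgroup.centralizer {u} : Subgroup G) =
      Nat.card K := by
  let := conjActionOn K Set.univ (fun _ _ _ _ => trivial)
  have h := Nat.card_congr (MulAction.orbitProdStabilizerEquivGroup K
    (⟨u, trivial⟩ : (Set.univ : Set G)))
  rw [Nat.card_prod] at h
  rw [← h]
  congr 1
  · refine Nat.card_congr ⟨fun s => ⟨⟨s.1, trivial⟩, ?_⟩, fun s => ⟨s.1.1, ?_⟩, fun s => rfl,
      fun s => rfl⟩
    · obtain ⟨h, hh, e⟩ := s.2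
      exact ⟨⟨h, hh⟩, Subtype.ext e.symm⟩
    · obtain ⟨h, e⟩ := s.2
      exact ⟨h.1, h.2, (congrArg Subtype.val e).symm⟩
  · refine Nat.card_congr ⟨fun s => ⟨⟨s.1, s.2.1⟩, ?_⟩, fun s => ⟨s.1.1, s.1.2, ?_⟩, fun s => rfl,
      fun s => rfl⟩
    · refine Subtype.ext (conj_eq_iff.2 ?_)
      exact (Subgroup.mem_centralizer_singleton_iff.1 s.2.2)
    · exact Subgroup.mem_centralizer_singleton_iff.2 (conj_eq_iff.1 (congrArg Subtype.val s.2))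

/-- A set with a fixed-point-free involution has even cardinality. -/
theorem even_ncard_of_involution {α : Type*} [Finite α] (N : Set α) (f : α → α)
    (h1 : ∀ s ∈ N, f s ∈ N) (h2 : ∀ s ∈ N, f (f s) = s) (h3 : ∀ s ∈ N, f s ≠ s) :
    Even N.ncard := by
  classical
  have : Fintype α := Fintype.ofFinite α
  have h := Finset.sum_involution (s := N.toFinset) (f := fun _ => (1 : ZMod 2))
    (fun a _ => f a) (fun _ _ => rfl) (fun a ha _ => h3 a (by simpa using ha))
    (fun a ha => by simpa using h1 a (by simpa using ha))
    (fun a ha => h2 a (by simpa using ha))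
  rw [Finset.sum_const, nsmul_one, ZMod.natCast_eq_zero_iff_even] at h
  rwa [Set.ncard_eq_toFinset_card']

end Counting

/-- The number of nonzero singular vectors is odd: on the set of all singular vectors, `v ↦ star v`,
replaced by the shift by `(1,1,1,1)` where `star v = v`, is a fixed-point-free involution. -/
theorem odd_ncard_singular : Odd {v : V4 | herm v v = 0 ∧ v ≠ 0}.ncard := by
  classical
  have hc : herm (fun _ => 1 : V4) (fun _ => 1) = 0 := by simp [herm_eq]; grind
  have hfix : ∀ v : V4, star v = v → ∀ i, star (v i) = v i := fun v h i => congrFun h i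
  have h : Even {v : V4 | herm v v = 0}.ncard := by
    refine even_ncard_of_involution _ (fun v => if star v = v then v + fun _ => 1 else star v)
      (fun v hv => ?_) (fun v hv => ?_) (fun v hv => ?_)
    · simp only [Set.mem_ofPred_eq] at hv ⊢
      split_ifs with hs
      · have hi := hfix v hs
        simp only [herm_eq, Pi.add_apply, star_add, star_one, hi] at hv ⊢
        grind
      · have := congrArg star hv
        simp only [herm_eq, Pi.star_apply, star_add, star_mul, star_star, star_zero] at this ⊢
        grind
    · by_cases hs : star v = v
      · have hs2 : star (v + fun _ => 1) = v + fun _ => 1 := by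
          rw [star_add, hs]; congr 1; ext i; simp
        simp only [hs, if_true, hs2]
        rw [add_assoc, V4.add_self, add_zero]
      · have hs2 : ¬ v = star v := fun h => hs h.symm
        simp [hs, hs2]
    · by_cases hs : star v = v
      · simp only [hs, if_true]
        intro h
        have := congrFun h 0
        simp at this
      · simp [hs]
  have e : {v : V4 | herm v v = 0} = insert 0 {v : V4 | herm v v = 0 ∧ v ≠ 0} := by
    ext v
    simp only [Set.mem_ofPred_eq, Set.mem_insert_iff]
    by_cases hv : v = 0 <;> simp [hv]
  rw [e, Set.ncard_insert_of_notMem (by simp)] at h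
  rwa [Nat.even_add_one, Nat.not_even_iff_odd] at h


/-! ### The local structure of the centralizer of the involution -/

/-- The semilinear involution `x ↦ star x + s • (1,1,1,1)`, where `s` is the sum of the coordinates
of `star x`. Its fixed vectors form a totally singular space over the field with two elements. -/
noncomputable def sig (v : V4) : V4 := fun i => star (v i) + ∑ k, star (v k)

/-- A map of the hermitian space commutes with scalars. For an additive map this says that it is
linear. -/
def IsLin (f : V4 → V4) : Prop := ∀ (a : F4) v, f (a • v) = a • f v

section Centralizer
variable {G : Type*} [Group G]

theorem self_mem_centralizer (t : G) : t ∈ Subgroup.centralizer {t} :=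
  Subgroup.mem_centralizer_singleton_iff.2 rfl

theorem mul_comm_of_mem {t x : G} (hx : x ∈ Subgroup.centralizer {t}) : x * t = t * x :=
  Subgroup.mem_centralizer_singleton_iff.1 hx

theorem conj_mem_centralizer {t g y : G} (h : y * (g * t * g⁻¹) = g * t * g⁻¹ * y) :
    g⁻¹ * y * g ∈ Subgroup.centralizer {t} := by
  rw [Subgroup.mem_centralizer_singleton_iff]
  calc g⁻¹ * y * g * t = g⁻¹ * (y * (g * t * g⁻¹)) * g := by group
    _ = t * (g⁻¹ * y * g) := by rw [h]; group

theorem card_centralizer_inf_conj (t g : G) :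
    Nat.card (Subgroup.centralizer {t} ⊓ Subgroup.centralizer {g * t * g⁻¹} : Subgroup G) =
      Nat.card (Subgroup.centralizer {t} ⊓ Subgroup.centralizer {g⁻¹ * t * g} : Subgroup G) := by
  refine Nat.card_congr ((MulAut.conj g⁻¹).toEquiv.subtypeEquiv fun x => ?_)
  simp only [Subgroup.mem_inf, Subgroup.mem_centralizer_singleton_iff, MulEquiv.toEquiv_eq_coe,
    EquivLike.coe_coe, MulAut.conj_apply, inv_inv]
  have e1 : g⁻¹ * x * g * t = t * (g⁻¹ * x * g) ↔ x * (g * t * g⁻¹) = g * t * g⁻¹ * x := by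
    rw [show g⁻¹ * x * g * t = g⁻¹ * (x * (g * t * g⁻¹)) * g by group,
      show t * (g⁻¹ * x * g) = g⁻¹ * (g * t * g⁻¹ * x) * g by group]
    simp
  have e2 : g⁻¹ * x * g * (g⁻¹ * t * g) = g⁻¹ * t * g * (g⁻¹ * x * g) ↔ x * t = t * x := by
    rw [show g⁻¹ * x * g * (g⁻¹ * t * g) = g⁻¹ * (x * t) * g by group,
      show g⁻¹ * t * g * (g⁻¹ * x * g) = g⁻¹ * (t * x) * g by group]
    simp
  rw [e1, e2, and_comm]

end Centralizer

/-- `Q` is a normal subgroup of the centralizer of the involution `t` that contains `t`, and `pi`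
identifies `Q / ⟨t⟩` with the hermitian space. The values of `pi` off `Q` do not matter. -/
structure VectorQuotient {G : Type*} [Group G] (t : G) (Q : Subgroup G) (pi : G → V4) : Prop where
  t_ne : t ≠ 1
  t_sq : t * t = 1
  t_mem : t ∈ Q
  le : Q ≤ Subgroup.centralizer {t}
  normal : ∀ h ∈ Subgroup.centralizer {t}, ∀ x ∈ Q, h * x * h⁻¹ ∈ Q
  pi_mul : ∀ x ∈ Q, ∀ y ∈ Q, pi (x * y) = pi x + pi y
  pi_surj : ∀ v, ∃ x ∈ Q, pi x = v
  pi_eq_zero : ∀ x ∈ Q, pi x = 0 → x = 1 ∨ x = t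
  pi_t : pi t = 0

namespace VectorQuotient

variable {G : Type*} [Group G] {t : G} {Q : Subgroup G} {pi : G → V4} (D : VectorQuotient t Q pi)
include D

theorem pi_one : pi 1 = 0 := by
  have := D.pi_mul 1 Q.one_mem 1 Q.one_mem
  simpa using this

theorem pi_inv {x : G} (hx : x ∈ Q) : pi x⁻¹ = pi x := by
  have := D.pi_mul x hx x⁻¹ (Q.inv_mem hx)
  rw [mul_inv_cancel, D.pi_one] at this
  exact (V4.eq_of_add_eq_zero this.symm).symm

theorem pi_eq_iff {x y : G} (hx : x ∈ Q) (hy : y ∈ Q) : pi x = pi y ↔ x = y ∨ x = y * t := by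
  constructor
  · intro h
    have h1 := D.pi_mul y⁻¹ (Q.inv_mem hy) x hx
    rw [D.pi_inv hy, h, V4.add_self] at h1
    rcases D.pi_eq_zero _ (Q.mul_mem (Q.inv_mem hy) hx) h1 with h2 | h2
    · exact .inl (inv_mul_eq_one.1 h2).symm
    · exact .inr (inv_mul_eq_iff_eq_mul.1 h2)
  · rintro (rfl | rfl)
    · rfl
    · rw [D.pi_mul y hy t D.t_mem, D.pi_t, add_zero]

theorem sq_mem {x : G} (hx : x ∈ Q) : x * x = 1 ∨ x * x = t := by
  refine D.pi_eq_zero _ (mul_mem hx hx) ?_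
  rw [D.pi_mul x hx x hx, V4.add_self]

theorem conj_eq_or {x y : G} (hx : x ∈ Q) (hy : y ∈ Q) :
    x * y * x⁻¹ = y ∨ x * y * x⁻¹ = y * t := by
  have h := D.normal x (D.le hx) y hy
  refine (D.pi_eq_iff h hy).1 ?_
  rw [D.pi_mul _ (mul_mem hx hy) _ (inv_mem hx), D.pi_mul x hx y hy, D.pi_inv hx, add_comm (pi x),
    add_assoc, V4.add_self, add_zero]

end VectorQuotient

/-- The structure of the centralizer of `t` in terms of its action `rho` on the hermitian space:
commutators and squares in `Q` are given by the hermitian form, all elements act linearly or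
semilinearly, `SU₄(2)` is induced, and so is the semilinear involution `sig`. The values of `rho`
off the centralizer do not matter. -/
structure LocalData {G : Type*} [Group G] (t : G) (Q : Subgroup G) (pi : G → V4)
    (rho : G → V4 → V4) : Prop extends VectorQuotient t Q pi where
  rho_pi : ∀ h ∈ Subgroup.centralizer {t}, ∀ x ∈ Q, rho h (pi x) = pi (h * x * h⁻¹)
  commute_iff : ∀ x ∈ Q, ∀ y ∈ Q, x * y = y * x ↔ tr4 (herm (pi x) (pi y)) = 0
  sq_iff : ∀ x ∈ Q, x * x = 1 ↔ herm (pi x) (pi x) = 0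
  exists_rho : ∀ A : SU42, ∃ h ∈ Subgroup.centralizer {t}, ∀ v, rho h v = A.act v
  semilinear : ∀ h ∈ Subgroup.centralizer {t},
    (∀ (a : F4) v, rho h (a • v) = a • rho h v) ∨ ∀ (a : F4) v, rho h (a • v) = star a • rho h v
  mem_of_rho : ∀ h ∈ Subgroup.centralizer {t}, (∀ v, rho h v = v) → (∃ k, h ^ 2 ^ k = 1) → h ∈ Q
  exists_sig : ∃ d ∈ Subgroup.centralizer {t}, (∃ k, d ^ 2 ^ k = 1) ∧ ∀ v, rho d v = sig v

namespace LocalData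

variable {G : Type*} [Group G] {t : G} {Q : Subgroup G} {pi : G → V4} {rho : G → V4 → V4}
  (D : LocalData t Q pi rho)
include D

local notation "C(" t ")" => Subgroup.centralizer {t}

theorem rho_mul {g h : G} (hg : g ∈ C(t)) (hh : h ∈ C(t)) (v : V4) :
    rho (g * h) v = rho g (rho h v) := by
  obtain ⟨x, hx, rfl⟩ := D.pi_surj v
  rw [D.rho_pi _ (mul_mem hg hh) _ hx, D.rho_pi h hh x hx,
    D.rho_pi g hg _ (D.normal h hh x hx)]
  congr 1; group

theorem rho_one (v : V4) : rho 1 v = v := by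
  obtain ⟨x, hx, rfl⟩ := D.pi_surj v
  rw [D.rho_pi 1 (one_mem _) x hx]; simp

theorem rho_inv_rho {g : G} (hg : g ∈ C(t)) (v : V4) : rho g⁻¹ (rho g v) = v := by
  rw [← D.rho_mul (inv_mem hg) hg, inv_mul_cancel, D.rho_one]

theorem rho_rho_inv {g : G} (hg : g ∈ C(t)) (v : V4) : rho g (rho g⁻¹ v) = v := by
  rw [← D.rho_mul hg (inv_mem hg), mul_inv_cancel, D.rho_one]

theorem rho_add {g : G} (hg : g ∈ C(t)) (v w : V4) : rho g (v + w) = rho g v + rho g w := by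
  obtain ⟨x, hx, rfl⟩ := D.pi_surj v
  obtain ⟨y, hy, rfl⟩ := D.pi_surj w
  rw [← D.pi_mul x hx y hy, D.rho_pi g hg _ (mul_mem hx hy), D.rho_pi g hg x hx,
    D.rho_pi g hg y hy, ← D.pi_mul _ (D.normal g hg x hx) _ (D.normal g hg y hy)]
  congr 1; group

theorem rho_zero {g : G} (hg : g ∈ C(t)) : rho g 0 = 0 := by
  have := D.rho_add hg 0 0
  simpa using this

theorem rho_of_mem {x : G} (hx : x ∈ Q) (v : V4) : rho x v = v := by
  obtain ⟨y, hy, rfl⟩ := D.pi_surj v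
  rw [D.rho_pi x (D.le hx) y hy, D.pi_mul _ (mul_mem hx hy) _ (Q.inv_mem hx), D.pi_inv hx,
    D.pi_mul x hx y hy, add_comm (pi x), add_assoc, V4.add_self, add_zero]

theorem tr4_rho {g : G} (hg : g ∈ C(t)) (v w : V4) :
    tr4 (herm (rho g v) (rho g w)) = tr4 (herm v w) := by
  obtain ⟨x, hx, rfl⟩ := D.pi_surj v
  obtain ⟨y, hy, rfl⟩ := D.pi_surj w
  rw [D.rho_pi g hg x hx, D.rho_pi g hg y hy]
  have h1 := D.commute_iff x hx y hy
  have h2 := D.commute_iff _ (D.normal g hg x hx) _ (D.normal g hg y hy)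
  have h3 : g * x * g⁻¹ * (g * y * g⁻¹) = g * y * g⁻¹ * (g * x * g⁻¹) ↔ x * y = y * x := by
    rw [show g * x * g⁻¹ * (g * y * g⁻¹) = g * (x * y) * g⁻¹ by group,
      show g * y * g⁻¹ * (g * x * g⁻¹) = g * (y * x) * g⁻¹ by group]
    simp
  rcases tr4_eq_zero_or_one (herm (pi x) (pi y)) with h | h <;>
    rcases tr4_eq_zero_or_one (herm (pi (g * x * g⁻¹)) (pi (g * y * g⁻¹))) with h' | h' <;>
    simp_all

theorem rho_smul_of_not_isLin {g : G} (hg : g ∈ C(t)) (hl : ¬ IsLin (rho g)) (a : F4) (v : V4) :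
    rho g (a • v) = star a • rho g v := (D.semilinear g hg).resolve_left hl a v

/-- Elements not acting linearly are semi-isometries. -/
theorem herm_rho_of_not_isLin {g : G} (hg : g ∈ C(t)) (hl : ¬ IsLin (rho g)) (v w : V4) :
    herm (rho g v) (rho g w) = star (herm v w) := by
  refine eq_of_tr4_mul fun c => ?_
  rw [← herm_smul_left, ← star_star c, ← D.rho_smul_of_not_isLin hg hl, D.tr4_rho hg,
    herm_smul_left, ← tr4_star, star_mul, mul_comm]

theorem not_isLin_of_semilinear {g : G} (hg : g ∈ C(t))
    (h : ∀ (a : F4) v, rho g (a • v) = star a • rho g v) : ¬ IsLin (rho g) := by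
  intro hl
  have h1 := (hl om v0).symm.trans (h om v0)
  have h0 : rho g v0 ≠ 0 := by
    intro h0
    apply v0_ne_zero
    rw [← D.rho_inv_rho hg v0, h0, D.rho_zero (inv_mem hg)]
  have h2 : (om + star om) • rho g v0 = 0 := by rw [add_smul, ← h1, V4.add_self]
  have h3 : om + star om = 1 := tr4_om
  rw [h3, one_smul] at h2
  exact h0 h2

theorem isLin_mul {g h : G} (hg : g ∈ C(t)) (hh : h ∈ C(t)) :
    IsLin (rho (g * h)) ↔ (IsLin (rho g) ↔ IsLin (rho h)) := by
  by_cases h1 : IsLin (rho g) <;> by_cases h2 : IsLin (rho h) <;>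
    simp only [h1, h2, iff_true, iff_false, not_true]
  · intro a v; rw [D.rho_mul hg hh, D.rho_mul hg hh, h2, h1]
  · refine D.not_isLin_of_semilinear (mul_mem hg hh) fun a v => ?_
    rw [D.rho_mul hg hh, D.rho_mul hg hh, D.rho_smul_of_not_isLin hh h2, h1]
  · refine D.not_isLin_of_semilinear (mul_mem hg hh) fun a v => ?_
    rw [D.rho_mul hg hh, D.rho_mul hg hh, h2, D.rho_smul_of_not_isLin hg h1]
  · intro a v
    rw [D.rho_mul hg hh, D.rho_mul hg hh, D.rho_smul_of_not_isLin hh h2,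
      D.rho_smul_of_not_isLin hg h1, star_star]

theorem isLin_of_mem {x : G} (hx : x ∈ Q) : IsLin (rho x) := by
  intro a v; rw [D.rho_of_mem hx, D.rho_of_mem hx]

theorem isLin_conj {g h : G} (hg : g ∈ C(t)) (hh : h ∈ C(t)) :
    IsLin (rho (g * h * g⁻¹)) ↔ IsLin (rho h) := by
  have h1 : IsLin (rho g) ↔ IsLin (rho g⁻¹) := by
    have := D.isLin_mul hg (inv_mem hg)
    rw [mul_inv_cancel] at this
    exact this.1 (D.isLin_of_mem Q.one_mem)
  rw [D.isLin_mul (mul_mem hg hh) (inv_mem hg), D.isLin_mul hg hh]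
  tauto

theorem isPGroup : IsPGroup 2 Q := by
  intro x
  refine ⟨2, Subtype.ext ?_⟩
  have : (x.1 * x.1) * (x.1 * x.1) = 1 := by
    rcases D.sq_mem x.2 with h | h <;> rw [h]
    · simp
    · exact D.t_sq
  simpa [pow_succ, mul_assoc] using this

/-- Noncommuting elements of `Q` have commutator `t`. -/
theorem conj_eq_mul_t {x y : G} (hx : x ∈ Q) (hy : y ∈ Q) (h : x * y ≠ y * x) :
    x * y * x⁻¹ = y * t := by
  have h1 : pi (x * y * x⁻¹) = pi y := by
    rw [← D.rho_pi x (D.le hx) y hy, D.rho_of_mem hx]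
  refine ((D.pi_eq_iff (mul_mem (mul_mem hx hy) (inv_mem hx)) hy).1 h1).resolve_left fun h2 => ?_
  exact h (conj_eq_iff.1 h2)

/-- A commuting element of `Q` has image fixed by the action. -/
theorem rho_pi_of_commute {y x : G} (hy : y ∈ C(t)) (hx : x ∈ Q) (h : x * y = y * x) :
    rho y (pi x) = pi x := by
  rw [D.rho_pi y hy x hx, ← h, mul_inv_cancel_right]

/-- A `2`-element of the centralizer of `t` with at most two conjugates under `Q` lies in `Q`. -/
theorem mem_of_few_conjugates {y : G} (hy : y ∈ C(t)) (h2 : ∃ k, y ^ 2 ^ k = 1)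
    (h : ∀ x1 ∈ Q, ∀ x2 ∈ Q, x1 * y = y * x1 ∨ x2 * y = y * x2 ∨
      (x1⁻¹ * x2) * y = y * (x1⁻¹ * x2)) : y ∈ Q := by
  have key : ∀ v w : V4, rho y v = v ∨ rho y w = w ∨ rho y (v + w) = v + w := by
    intro v w
    obtain ⟨x1, h1, rfl⟩ := D.pi_surj v
    obtain ⟨x2, h2, rfl⟩ := D.pi_surj w
    refine (h x1 h1 x2 h2).imp (D.rho_pi_of_commute hy h1)
      (Or.imp (D.rho_pi_of_commute hy h2) fun h3 => ?_)
    have := D.rho_pi_of_commute hy (mul_mem (inv_mem h1) h2) h3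
    rwa [D.pi_mul _ (inv_mem h1) _ h2, D.pi_inv h1] at this
  -- Every line over the field with four elements contains a fixed vector.
  have line : ∀ v : V4, v ≠ 0 → ∃ a : F4, a ≠ 0 ∧ rho y (a • v) = a • v := by
    intro v _
    rcases key v (om • v) with h | h | h
    · exact ⟨1, one_ne_zero, by simpa using h⟩
    · exact ⟨om, om_ne_zero, h⟩
    · exact ⟨1 + om, by rw [add_comm]; exact om_add_one_ne_zero, by
        rwa [add_smul, one_smul]⟩
  refine D.mem_of_rho y hy ?_ h2
  by_cases hl : IsLin (rho y)
  · intro v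
    by_cases hv : v = 0
    · rw [hv, D.rho_zero hy]
    · obtain ⟨a, ha, e⟩ := line v hv
      rw [hl] at e
      exact smul_right_injective V4 ha e
  · exfalso
    have moved : ∀ c : V4, c ≠ 0 → rho y c = c → rho y (om • c) ≠ om • c := by
      intro c hc h1 h2
      rw [D.rho_smul_of_not_isLin hy hl, h1, star_om, add_smul, one_smul] at h2
      exact hc (by simpa using h2)
    obtain ⟨a, ha, e1⟩ := line (Pi.single 0 1) (by simp)
    obtain ⟨b, hb, e2⟩ := line (Pi.single 1 1) (by simp)
    have n1 : a • (Pi.single 0 1 : V4) ≠ 0 := by simp [ha]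
    have n2 : b • (Pi.single 1 1 : V4) ≠ 0 := by simp [hb]
    have n3 : a • (Pi.single 0 1 : V4) + b • (Pi.single 1 1 : V4) ≠ 0 := by
      intro h
      have := congrFun h 0
      simp [ha] at this
    rcases key (om • a • (Pi.single 0 1 : V4)) (om • b • (Pi.single 1 1 : V4)) with h | h | h
    · exact moved _ n1 e1 h
    · exact moved _ n2 e2 h
    · rw [← smul_add] at h
      exact moved _ n3 (by rw [D.rho_add hy, e1, e2]) h

theorem ncard_preimage [Finite G] (P : V4 → Prop) :
    {x | x ∈ Q ∧ P (pi x)}.ncard = 2 * {v | P v}.ncard := by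
  choose s hs hps using D.pi_surj
  have hinj : Function.Injective s := fun v w h => by rw [← hps v, h, hps]
  have e : {x | x ∈ Q ∧ P (pi x)} = s '' {v | P v} ∪ (fun x => x * t) '' (s '' {v | P v}) := by
    ext x
    simp only [Set.mem_ofPred_eq, Set.mem_union, Set.mem_image, exists_exists_and_eq_and]
    constructor
    · rintro ⟨hx, hP⟩
      rcases (D.pi_eq_iff hx (hs (pi x))).1 (hps _).symm with h | h
      · exact .inl ⟨_, hP, h.symm⟩
      · exact .inr ⟨_, hP, h.symm⟩
    · rintro (⟨v, hv, rfl⟩ | ⟨v, hv, rfl⟩)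
      · exact ⟨hs v, by rwa [hps]⟩
      · refine ⟨mul_mem (hs v) D.t_mem, ?_⟩
        rwa [D.pi_mul _ (hs v) _ D.t_mem, D.pi_t, add_zero, hps]
  rw [e, Set.ncard_union_eq, Set.ncard_image_of_injective _ (mul_left_injective t),
    Set.ncard_image_of_injective _ hinj, two_mul]
  rw [Set.disjoint_left]
  rintro _ ⟨v, -, rfl⟩ ⟨_, ⟨w, -, rfl⟩, h⟩
  have h1 : pi (s w * t) = pi (s v) := congrArg pi h
  rw [D.pi_mul _ (hs w) _ D.t_mem, D.pi_t, add_zero, hps, hps] at h1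
  subst h1
  exact D.t_ne (by simpa using h)

theorem exists_conj_eq_mul_t {x : G} (hx : x ∈ Q) (h1 : x ≠ 1) (ht : x ≠ t) :
    ∃ y ∈ Q, y * x * y⁻¹ = x * t := by
  have h0 : pi x ≠ 0 := fun h => (D.pi_eq_zero x hx h).elim h1 ht
  obtain ⟨w, hw⟩ := exists_herm_ne_zero h0
  obtain ⟨a, ha⟩ : ∃ a : F4, tr4 (herm (a • w) (pi x)) ≠ 0 := by
    refine ⟨om * (herm w (pi x))⁻¹, ?_⟩
    have : herm w (pi x) ≠ 0 := by rw [← star_herm]; simpa using hw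
    rw [herm_smul_left, mul_assoc, inv_mul_cancel₀ this, mul_one, tr4_om]
    exact one_ne_zero
  obtain ⟨y, hy, e⟩ := D.pi_surj (a • w)
  refine ⟨y, hy, D.conj_eq_mul_t hy hx fun h => ha ?_⟩
  rw [← e]
  exact (D.commute_iff y hy x hx).1 h

/-- The centralizer of `t` is transitive on the noncentral involutions of `Q`, and their number is
twice an odd number. -/
theorem ncard_conj_class [Finite G] {s : G} (hs : s ∈ Q) (hs2 : s * s = 1) (h1 : s ≠ 1)
    (ht : s ≠ t) : ∃ m, Odd m ∧ {u | ∃ h ∈ C(t), u = h * s * h⁻¹}.ncard = 2 * m := by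
  refine ⟨_, odd_ncard_singular, ?_⟩
  rw [← D.ncard_preimage]
  congr 1
  have h0 : pi s ≠ 0 := fun h => (D.pi_eq_zero s hs h).elim h1 ht
  have hss := (D.sq_iff s hs).1 hs2
  ext u
  simp only [Set.mem_ofPred_eq]
  constructor
  · rintro ⟨h, hh, rfl⟩
    have hu := D.normal h hh s hs
    refine ⟨hu, ?_, ?_⟩
    · rw [← D.sq_iff _ hu]
      calc h * s * h⁻¹ * (h * s * h⁻¹) = h * (s * s) * h⁻¹ := by group
        _ = 1 := by rw [hs2]; simp
    · rw [← D.rho_pi h hh s hs]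
      intro h3
      apply h0
      rw [← D.rho_inv_rho hh (pi s), h3, D.rho_zero (inv_mem hh)]
  · rintro ⟨hu, hus, hu0⟩
    obtain ⟨A, hA⟩ := exists_act_sing_eq hss h0 hus hu0
    obtain ⟨h, hh, hr⟩ := D.exists_rho A
    have e : pi u = pi (h * s * h⁻¹) := by rw [← D.rho_pi h hh s hs, hr, hA]
    rcases (D.pi_eq_iff hu (D.normal h hh s hs)).1 e with h3 | h3
    · exact ⟨h, hh, h3⟩
    · obtain ⟨y, hy, e2⟩ := D.exists_conj_eq_mul_t hs h1 ht
      refine ⟨h * y, mul_mem hh (D.le hy), ?_⟩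
      rw [h3]
      calc h * s * h⁻¹ * t = h * s * (h⁻¹ * t) := by group
        _ = h * s * (t * h⁻¹) := by rw [mul_comm_of_mem (inv_mem hh)]
        _ = h * (y * s * y⁻¹) * h⁻¹ := by rw [e2]; group
        _ = h * y * s * (h * y)⁻¹ := by group

/-- Membership in `Q` is a symmetric relation between conjugates of `t`. The classes of `g t g⁻¹`
and `g⁻¹ t g` in the centralizer of `t` have equal lengths; that of the former is twice an odd
number, whereas outside `Q` the orbits of `Q` would have lengths divisible by `4`. -/
theorem conj_mem_of_conj_mem [Finite G] {g : G} (hs : g * t * g⁻¹ ∈ Q) (ht : g * t * g⁻¹ ≠ t) :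
    g⁻¹ * t * g ∈ Q := by
  have hs2 : g * t * g⁻¹ * (g * t * g⁻¹) = 1 := by
    calc g * t * g⁻¹ * (g * t * g⁻¹) = g * (t * t) * g⁻¹ := by group
      _ = 1 := by rw [D.t_sq]; simp
  have hs1 : g * t * g⁻¹ ≠ 1 := by
    intro h
    exact D.t_ne (by simpa using h)
  obtain ⟨m, hm, hcard⟩ := D.ncard_conj_class hs hs2 hs1 ht
  have h1 := ncard_conj_mul_card C(t) (g * t * g⁻¹)
  have h2 := ncard_conj_mul_card C(t) (g⁻¹ * t * g)
  rw [card_centralizer_inf_conj t g, ← h2] at h1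
  have h3 := Nat.eq_of_mul_eq_mul_right Nat.card_pos h1
  set N := {s | ∃ h ∈ C(t), s = h * (g⁻¹ * t * g) * h⁻¹} with hN
  have hnot : ¬ 4 ∣ N.ncard := by
    rw [← h3, hcard]
    rintro ⟨k, hk⟩
    have : m = 2 * k := by omega
    exact (Nat.not_even_iff_odd.2 hm) (this ▸ even_two_mul k)
  have hinv : ∀ a ∈ Q, ∀ s ∈ N, a * s * a⁻¹ ∈ N := by
    rintro a ha _ ⟨h, hh, rfl⟩
    exact ⟨a * h, mul_mem (D.le ha) hh, by group⟩
  -- `t` commutes with its conjugate, so that conjugate lies in the centralizer of `t`.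
  have hpt : g⁻¹ * t * g ∈ C(t) := by
    rw [Subgroup.mem_centralizer_singleton_iff]
    have := mul_comm_of_mem (D.le hs)
    calc g⁻¹ * t * g * t = g⁻¹ * (t * (g * t * g⁻¹)) * g := by group
      _ = g⁻¹ * (g * t * g⁻¹ * t) * g := by rw [this]
      _ = t * (g⁻¹ * t * g) := by group
  by_contra hcon
  refine hnot (four_dvd_ncard D.isPGroup hinv ?_)
  rintro _ ⟨h, hh, rfl⟩
  by_contra! hall
  have hmem := D.mem_of_few_conjugates (y := h * (g⁻¹ * t * g) * h⁻¹)
    (mul_mem (mul_mem hh hpt) (inv_mem hh)) ⟨1, by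
      rw [pow_one, pow_two]
      calc h * (g⁻¹ * t * g) * h⁻¹ * (h * (g⁻¹ * t * g) * h⁻¹) =
          h * g⁻¹ * (t * t) * g * h⁻¹ := by group
        _ = 1 := by rw [D.t_sq]; group⟩ (fun x1 hx1 x2 hx2 => by
      have := hall x1 hx1 x2 hx2
      tauto)
  apply hcon
  have := D.normal h⁻¹ (inv_mem hh) _ hmem
  simpa [mul_assoc] using this

end LocalData


/-! ### Isotropic subspaces over the field with two elements -/

theorem tr4_herm_comm (x y : V4) : tr4 (herm x y) = tr4 (herm y x) := by
  rw [← star_herm, tr4_star]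

theorem tr4_zero : tr4 0 = 0 := by simp [tr4]

theorem algebraMap_trace_F4 (a : F4) :
    algebraMap (ZMod 2) F4 (Algebra.trace (ZMod 2) F4 a) = tr4 a := by
  rw [FiniteField.algebraMap_trace_eq_sum_pow]
  simp [tr4, F4.star_def, GaloisField.finrank, Finset.sum_range_succ]

theorem trace_F4_eq_zero_iff (a : F4) : Algebra.trace (ZMod 2) F4 a = 0 ↔ tr4 a = 0 := by
  rw [← algebraMap_trace_F4]; simp

/-- The trace of the hermitian form, as a bilinear form over the field with two elements. -/
noncomputable def trForm : LinearMap.BilinForm (ZMod 2) V4 :=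
  LinearMap.mk₂ (ZMod 2) (fun x y => Algebra.trace (ZMod 2) F4 (herm x y))
    (fun x y z => by rw [herm_add_left, map_add])
    (fun c x y => by
      rw [← map_smul]; congr 1
      simp [herm, Finset.smul_sum])
    (fun x y z => by rw [herm_add_right, map_add])
    (fun c x y => by
      rw [← map_smul]; congr 1
      have hc : c ^ 2 = c := ZMod.pow_card c
      simp [herm, Finset.smul_sum, F4.star_def, smul_pow, hc])

theorem trForm_eq_zero_iff (x y : V4) : trForm x y = 0 ↔ tr4 (herm x y) = 0 :=
  trace_F4_eq_zero_iff _

theorem finrank_V4 : Module.finrank (ZMod 2) V4 = 8 := by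
  rw [Module.finrank_pi_fintype]; simp [GaloisField.finrank]

/-- A vector orthogonal to an isotropic subspace of half the dimension belongs to it. -/
theorem mem_of_forall_tr4_herm_eq_zero {U : AddSubgroup V4}
    (hU : ∀ x ∈ U, ∀ y ∈ U, tr4 (herm x y) = 0) (hc : 16 ≤ Nat.card U) {w : V4}
    (hw : ∀ x ∈ U, tr4 (herm x w) = 0) : w ∈ U := by
  let W : Submodule (ZMod 2) V4 := AddSubgroup.toZModSubmodule 2 U
  have hW : ∀ x, x ∈ W ↔ x ∈ U := fun x => Iff.rfl
  have hrefl : trForm.IsRefl := fun x y h => by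
    rw [trForm_eq_zero_iff] at h ⊢
    rwa [tr4_herm_comm]
  have hnd : trForm.Nondegenerate := by
    refine (LinearMap.IsRefl.nondegenerate_iff_separatingLeft hrefl).2 fun x hx => ?_
    refine eq_zero_of_herm fun y => ?_
    refine eq_of_tr4_mul fun c => ?_
    have := hx (star c • y)
    rw [trForm_eq_zero_iff, herm_smul_right, star_star] at this
    rw [this, mul_zero, tr4_zero]
  have h1 := LinearMap.BilinForm.finrank_orthogonal hnd W
  rw [finrank_V4] at h1
  have h2 : Nat.card W = 2 ^ Module.finrank (ZMod 2) W := by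
    rw [Module.natCard_eq_pow_finrank (K := ZMod 2)]; simp
  have h3 : 4 ≤ Module.finrank (ZMod 2) W := by
    by_contra h
    have h5 : Module.finrank (ZMod 2) W ≤ 3 := by omega
    have h6 := Nat.pow_le_pow_right (n := 2) (by norm_num) h5
    have h7 : Nat.card W = Nat.card U := rfl
    omega
  have hle : W ≤ trForm.orthogonal W := by
    intro x hx y hy
    exact (trForm_eq_zero_iff _ _).2 (hU y hy x hx)
  have heq := Submodule.eq_of_le_of_finrank_le hle (by omega)
  rw [← hW, heq]
  intro x hx
  exact (trForm_eq_zero_iff _ _).2 (hw x hx)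

theorem natCard_V4 : Nat.card V4 = 256 := by
  rw [Nat.card_fun, F4.natCard]; simp

/-- If `a` and `b` are fixed by the semilinear map `R`, then `a + ω b` determines both; so the
square of the number of fixed vectors is at most `256`. -/
theorem ncard_fixed_le {R : V4 → V4} (hadd : ∀ x y, R (x + y) = R x + R y)
    (hs : ∀ (a : F4) x, R (a • x) = star a • R x) : {x | R x = x}.ncard ≤ 16 := by
  have hinj : Function.Injective (fun z : {x | R x = x} × {x | R x = x} => z.1.1 + om • z.2.1) := by
    rintro ⟨⟨a, ha⟩, ⟨b, hb⟩⟩ ⟨⟨c, hc⟩, ⟨d, hd⟩⟩ h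
    simp only [Set.mem_ofPred_eq] at ha hb hc hd
    have h1 : a + om • b = c + om • d := h
    have h2 := congrArg R h1
    rw [hadd, hadd, hs, hs, ha, hb, hc, hd, star_om, add_smul, add_smul, one_smul, one_smul,
      ← add_assoc, ← add_assoc, h1] at h2
    have h3 : b = d := add_left_cancel h2
    subst h3
    have h4 : a = c := add_right_cancel h1
    subst h4
    rfl
  have := Nat.card_le_card_of_injective _ hinj
  rw [Nat.card_prod, natCard_V4, Nat.card_coe_set_eq] at this
  by_contra h
  have : 17 * 17 ≤ {x | R x = x}.ncard * {x | R x = x}.ncard := Nat.mul_le_mul (by omega) (by omega)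
  omega

theorem exists_orthogonal_herm_eq {v u : V4} (hv : v ≠ 0) (hu : ∀ a : F4, u ≠ a • v) (c : F4) :
    ∃ w, herm w v = 0 ∧ herm w u = c := by
  obtain ⟨x, hx⟩ : ∃ x, herm x v = 1 := by
    obtain ⟨y, hy⟩ := exists_herm_ne_zero hv
    have hy' : herm y v ≠ 0 := by rw [← star_herm]; simpa using hy
    exact ⟨(herm y v)⁻¹ • y, by rw [herm_smul_left, inv_mul_cancel₀ hy']⟩
  by_contra! h
  apply hu (star (herm x u))
  refine V4.eq_of_add_eq_zero (eq_zero_of_herm fun z => ?_)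
  have h0 : ∀ w, herm w v = 0 → herm w u = 0 := by
    intro w hw
    by_contra hne
    refine h ((c * (herm w u)⁻¹) • w) (by simp [hw]) ?_
    rw [herm_smul_left, mul_assoc, inv_mul_cancel₀ hne, mul_one]
  have h1 := h0 (z + herm z v • x) (by
    rw [herm_add_left, herm_smul_left, hx, mul_one, CharTwo.add_self_eq_zero])
  rw [herm_add_left, herm_smul_left] at h1
  rw [← star_herm, herm_add_right, herm_smul_right, star_star, mul_comm, h1, star_zero]

/-- A semilinear map moves some vector of the hyperplane orthogonal to `v` by a vector off the line
of `v`. -/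
theorem exists_add_not_mem_line {v : V4} (hv : v ≠ 0) {R : V4 → V4}
    (hs : ∀ (a : F4) x, R (a • x) = star a • R x) :
    ∃ w, herm w v = 0 ∧ ∀ a : F4, w + R w ≠ a • v := by
  obtain ⟨w, hw, hwv⟩ : ∃ w, herm w v = 0 ∧ ∀ a : F4, w ≠ a • v := by
    obtain ⟨x, hx⟩ := exists_herm_ne_zero hv
    obtain ⟨z, hz⟩ : ∃ z, ∀ a b : F4, z ≠ a • x + b • v := by
      by_contra! h
      choose a b hab using h
      have hinj : Function.Injective (fun z : V4 => (a z, b z)) := by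
        intro z1 z2 h
        simp only [Prod.mk.injEq] at h
        rw [hab z1, hab z2, h.1, h.2]
      have := Nat.card_le_card_of_injective _ hinj
      rw [Nat.card_prod, natCard_V4, F4.natCard] at this
      omega
    have hx' : herm x v ≠ 0 := by rw [← star_herm]; simpa using hx
    refine ⟨z + (herm z v * (herm x v)⁻¹) • x, ?_, fun a h => ?_⟩
    · rw [herm_add_left, herm_smul_left, mul_assoc, inv_mul_cancel₀ hx', mul_one,
        CharTwo.add_self_eq_zero]
    · refine hz (herm z v * (herm x v)⁻¹) a ?_
      rw [← h, add_comm z, ← add_assoc, V4.add_self, zero_add]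
  by_contra! h
  obtain ⟨a, ha⟩ := h w hw
  obtain ⟨b, hb⟩ := h (om • w) (by rw [herm_smul_left, hw, mul_zero])
  have h1 : R w = w + a • v := by rw [← ha, ← add_assoc, V4.add_self, zero_add]
  rw [hs, h1, star_om] at hb
  refine hwv (b + (om + 1) * a) (?_ : w = _)
  rw [add_smul, ← hb]
  ext i
  simp only [Pi.add_apply, Pi.smul_apply, smul_eq_mul]
  grind

/-- The commutator of the unipotent map with parameter `w` and a semilinear isometry `R` fixing `v`
is the unipotent map with parameter `w + R w`. -/
theorem unipFun_comp_semilinear {v w u : V4} {m : F4} (hvv : herm v v = 0) (hw : herm w v = 0)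
    {R : V4 → V4} (hadd : ∀ x y, R (x + y) = R x + R y)
    (hs : ∀ (a : F4) x, R (a • x) = star a • R x)
    (hh : ∀ x y, herm (R x) (R y) = star (herm x y)) (hRv : R v = v) (hu : u = w + R w) (x : V4) :
    unipFun v u (m + star m + herm (R w) u) (R (unipFun v w m x)) = unipFun v w m (R x) := by
  have h1 : R (unipFun v w m x) = unipFun v (R w) (star m) (R x) := by
    have e1 : herm (R x) v = star (herm x v) := by rw [← hh, hRv]
    rw [unipFun_apply, unipFun_apply, hadd, hadd, hs, hs, hRv, hh, e1, star_add, star_mul,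
      mul_comm (star (herm x v))]
  have h2 : herm (R w) v = 0 := by rw [← hRv, hh, hw, star_zero]
  rw [h1, unipFun_unipFun hvv (by rw [hu, herm_add_left, hw, h2, add_zero]) h2]
  have e1 : u + R w = w := by rw [hu, add_assoc, V4.add_self, add_zero]
  have e2 : ∀ a b c : F4, a + b + c + b + c = a := by intro a b c; grind
  rw [e1, e2]

theorem exists_tr4_eq_herm_self (w : V4) : ∃ m, tr4 m = herm w w := by
  rcases (F4.fixed_iff _).1 (star_herm_self w) with h | h
  · exact ⟨0, by rw [h, tr4_zero]⟩
  · exact ⟨om, by rw [h, tr4_om]⟩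

theorem unipFun_self {v w : V4} (hvv : herm v v = 0) (hw : herm w v = 0) (m : F4) :
    unipFun v w m v = v := by
  have : herm v w = 0 := by rw [← star_herm, hw, star_zero]
  simp [unipFun_apply, hvv, this]

/-- A subgroup that is stable under the stabilizer of the singular vector `v` and contains enough
commutators with a semilinear involution fixing `v` contains the line of `v` and is large. -/
theorem line_le_and_card_le {U : AddSubgroup V4} {v : V4} (hv : v ≠ 0) (hvv : herm v v = 0)
    {R : V4 → V4} (hadd : ∀ x y, R (x + y) = R x + R y)
    (hs : ∀ (a : F4) x, R (a • x) = star a • R x)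
    (hh : ∀ x y, herm (R x) (R y) = star (herm x y)) (hRv : R v = v) (hRR : ∀ x, R (R x) = x)
    (hU1 : ∀ x, tr4 (herm x v) = 0 → x + R x ∈ U)
    (hU2 : ∀ A : SU42, A.act v = v → ∀ x ∈ U, A.act x ∈ U) :
    (∀ a : F4, a • v ∈ U) ∧ 16 ≤ Nat.card U := by
  have hline : ∀ a : F4, a • v ∈ U := by
    intro a
    obtain ⟨w, hw, hwv⟩ := exists_add_not_mem_line hv hs
    have hyU := hU1 w (by rw [hw, tr4_zero])
    have hRw : herm (R w) v = 0 := by rw [← hRv, hh, hw, star_zero]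
    set y := w + R w with hy
    have hyv : herm y v = 0 := by rw [hy, herm_add_left, hw, hRw, add_zero]
    obtain ⟨u, huv, huy⟩ := exists_orthogonal_herm_eq hv hwv (star a)
    obtain ⟨m, hm⟩ := exists_tr4_eq_herm_self u
    obtain ⟨A, hA⟩ := exists_unip hvv huv hm
    have h1 := hU2 A ((hA v).trans (unipFun_self hvv huv m)) y hyU
    have h2 : herm y u = a := by rw [← star_herm, huy, star_star]
    rw [hA, hyv, zero_smul, add_zero, mul_zero, add_zero, h2] at h1
    have h3 := U.add_mem hyU h1
    rwa [← add_assoc, V4.add_self, zero_add] at h3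
  refine ⟨hline, ?_⟩
  obtain ⟨x0, hx0⟩ : ∃ x0, tr4 (herm x0 v) = 1 := by
    obtain ⟨x, hx⟩ := exists_herm_ne_zero hv
    have hx' : herm x v ≠ 0 := by rw [← star_herm]; simpa using hx
    exact ⟨(om * (herm x v)⁻¹) • x, by
      rw [herm_smul_left, mul_assoc, inv_mul_cancel₀ hx', mul_one, tr4_om]⟩
  -- An additive map into `U` with kernel contained in the fixed vectors of `R`.
  let F : V4 →+ V4 := AddMonoidHom.mk' (fun x => x + R x + tr4 (herm x v) • (x0 + R x0 + om • v))
    fun x y => by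
      rw [hadd, herm_add_left, tr4_add, add_smul]; abel
  have hF : ∀ x, F x = x + R x + tr4 (herm x v) • (x0 + R x0 + om • v) := fun x => rfl
  have hmem : ∀ x, F x ∈ U := by
    intro x
    rw [hF]
    rcases tr4_eq_zero_or_one (herm x v) with h | h
    · rw [h, zero_smul, add_zero]
      exact hU1 x h
    · rw [h, one_smul]
      have h1 := hU1 (x + x0) (by rw [herm_add_left, tr4_add, h, hx0, CharTwo.add_self_eq_zero])
      have h2 := U.add_mem h1 (hline om)
      rw [hadd] at h2
      convert h2 using 1
      abel
  have hker : ∀ x, F x = 0 → R x = x := by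
    intro x hx
    rw [hF] at hx
    rcases tr4_eq_zero_or_one (herm x v) with h | h
    · rw [h, zero_smul, add_zero] at hx
      exact (V4.eq_of_add_eq_zero hx).symm
    · exfalso
      rw [h, one_smul] at hx
      have h1 : x + R x + (x0 + R x0) = om • v := by
        apply V4.eq_of_add_eq_zero
        rw [← hx]; abel
      have h2 := congrArg R h1
      rw [hs, hRv, hadd, hadd, hadd, hRR, hRR, star_om, add_smul, one_smul, ← h1] at h2
      apply hv
      have h3 : x + R x + (x0 + R x0) + v = x + R x + (x0 + R x0) + 0 := by
        rw [← h2]; abel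
      exact add_left_cancel h3
  have h1 : Nat.card F.ker ≤ 16 := by
    refine le_trans ?_ (ncard_fixed_le hadd hs)
    rw [← Nat.card_coe_set_eq]
    exact Nat.card_le_card_of_injective (fun x : F.ker => (⟨x.1, hker _ x.2⟩ : {x | R x = x}))
      fun a b h => Subtype.ext (by simpa using h)
  have h2 : Nat.card F.range ≤ Nat.card U := by
    refine Nat.card_le_card_of_injective (fun x : F.range => (⟨x.1, ?_⟩ : U)) fun a b h =>
      Subtype.ext (by simpa using h)
    obtain ⟨y, hy⟩ := x.2
    rw [← hy]; exact hmem y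
  have h3 := AddSubgroup.card_eq_card_quotient_mul_card_addSubgroup F.ker
  rw [Nat.card_congr (QuotientAddGroup.quotientKerEquivRange F).toEquiv, natCard_V4] at h3
  by_contra h
  have : Nat.card F.range * Nat.card F.ker ≤ 15 * 16 := Nat.mul_le_mul (by omega) h1
  omega


/-! ### Conjugates of the involution inside its normal two-subgroup -/

namespace LocalData

variable {G : Type*} [Group G] {t : G} {Q : Subgroup G} {pi : G → V4} {rho : G → V4 → V4}
  (D : LocalData t Q pi rho)
include D

local notation "C(" t ")" => Subgroup.centralizer {t}

/-- The image in the hermitian space of a subgroup of `Q`. -/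
theorem exists_addSubgroup (K : Subgroup G) (hK : K ≤ Q) (ht : t ∈ K) :
    ∃ U : AddSubgroup V4, (∀ v, v ∈ U ↔ ∃ k ∈ K, pi k = v) ∧ (∀ x ∈ Q, pi x ∈ U → x ∈ K) := by
  refine ⟨{ carrier := {v | ∃ k ∈ K, pi k = v}
            add_mem' := ?_
            zero_mem' := ⟨1, K.one_mem, D.pi_one⟩
            neg_mem' := ?_ }, fun v => Iff.rfl, ?_⟩
  · rintro _ _ ⟨k, hk, rfl⟩ ⟨l, hl, rfl⟩
    exact ⟨k * l, K.mul_mem hk hl, D.pi_mul k (hK hk) l (hK hl)⟩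
  · rintro _ ⟨k, hk, rfl⟩
    exact ⟨k, hk, (V4.neg_eq _).symm⟩
  · rintro x hx ⟨k, hk, e⟩
    rcases (D.pi_eq_iff hx (hK hk)).1 e.symm with rfl | rfl
    · exact hk
    · exact K.mul_mem hk ht

theorem card_eq_two_mul [Finite G] {K : Subgroup G} (hK : K ≤ Q) {U : AddSubgroup V4}
    (hU : ∀ v, v ∈ U ↔ ∃ k ∈ K, pi k = v) (hU2 : ∀ x ∈ Q, pi x ∈ U → x ∈ K) :
    Nat.card K = 2 * Nat.card U := by
  have h := D.ncard_preimage (fun v => v ∈ U)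
  have e : {x | x ∈ Q ∧ pi x ∈ U} = (K : Set G) := by
    ext x
    exact ⟨fun h => hU2 x h.1 h.2, fun h => ⟨hK h, (hU _).2 ⟨x, h, rfl⟩⟩⟩
  rw [e] at h
  exact h

/-- The elements of `SU₄(2)` fixing the image of `p` are induced by elements commuting with `p`,
since `p` and `p * t` are conjugate under `Q`. -/
theorem exists_lift_stabilizer {p : G} (hp : p ∈ Q) (hp1 : p ≠ 1) (hpt : p ≠ t) {A : SU42}
    (hA : A.act (pi p) = pi p) :
    ∃ m ∈ C(t), m * p = p * m ∧ ∀ x, rho m x = A.act x := by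
  obtain ⟨h, hh, hr⟩ := D.exists_rho A
  have e : pi (h * p * h⁻¹) = pi p := by rw [← D.rho_pi h hh p hp, hr, hA]
  rcases (D.pi_eq_iff (D.normal h hh p hp) hp).1 e with h1 | h1
  · exact ⟨h, hh, conj_eq_iff.1 h1, hr⟩
  · obtain ⟨y, hy, e2⟩ := D.exists_conj_eq_mul_t hp hp1 hpt
    refine ⟨y * h, mul_mem (D.le hy) hh, ?_, fun x => ?_⟩
    · rw [← conj_eq_iff]
      calc y * h * p * (y * h)⁻¹ = y * (h * p * h⁻¹) * y⁻¹ := by group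
        _ = y * p * (t * y⁻¹) := by rw [h1]; group
        _ = y * p * (y⁻¹ * t) := by rw [mul_comm_of_mem (inv_mem (D.le hy))]
        _ = (y * p * y⁻¹) * t := by group
        _ = p := by rw [e2, mul_assoc, D.t_sq, mul_one]
    · rw [D.rho_mul (D.le hy) hh, D.rho_of_mem hy, hr]

/-- Two conjugates of `Q` have commuting elements in their intersection if the centres differ. -/
theorem commute_of_mem_of_conj_mem {g : G} (hg : g⁻¹ * t * g ≠ t) {x y : G}
    (h : x * y * x⁻¹ = y ∨ x * y * x⁻¹ = y * t) (hx' : g * x * g⁻¹ ∈ Q) (hy' : g * y * g⁻¹ ∈ Q) :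
    x * y = y * x := by
  by_contra hne
  have h1 : x * y * x⁻¹ = y * t := h.resolve_left fun h1 => hne (conj_eq_iff.1 h1)
  have h2 := D.conj_eq_mul_t hx' hy' (by
    rw [show g * x * g⁻¹ * (g * y * g⁻¹) = g * (x * y) * g⁻¹ by group,
      show g * y * g⁻¹ * (g * x * g⁻¹) = g * (y * x) * g⁻¹ by group]
    simpa using hne)
  have h3 : g * (x * y * x⁻¹) * g⁻¹ = g * y * g⁻¹ * t := by rw [← h2]; group
  rw [h1] at h3
  apply hg
  have h4 : g * t * g⁻¹ = t := by
    have h5 : g * y * g⁻¹ * (g * t * g⁻¹) = g * y * g⁻¹ * t := by rw [← h3]; group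
    exact mul_left_cancel h5
  calc g⁻¹ * t * g = g⁻¹ * (g * t * g⁻¹) * g := by rw [h4]
    _ = t := by group

/-- If `g` conjugates `t` to another element `s` of `Q`, then it transports the elements of `Q`
commuting with `s` to elements of the centralizer of `t` that act linearly. Otherwise `g⁻¹ Q g`
contains an element inducing a semilinear involution on `Q / ⟨t⟩`. Commutators with it show that `Q
∩ g⁻¹ Q g` is a maximal abelian subgroup of `g⁻¹ Q g`, and produce an element of `g⁻¹ Q g` that acts
as a transvection but centralizes `Q ∩ g⁻¹ Q g`. This element must lie in `Q` and hence act
trivially. -/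
theorem isLin_conj_of_commute [Finite G] {g r : G} (hs : g * t * g⁻¹ ∈ Q) (hst : g * t * g⁻¹ ≠ t)
    (hr : r ∈ Q) (hrs : r * (g * t * g⁻¹) = g * t * g⁻¹ * r) : IsLin (rho (g⁻¹ * r * g)) := by
  by_contra hl
  have hp := D.conj_mem_of_conj_mem hs hst
  obtain ⟨p, hpdef⟩ : ∃ p, p = g⁻¹ * t * g := ⟨_, rfl⟩
  obtain ⟨r', hr'def⟩ : ∃ r', r' = g⁻¹ * r * g := ⟨_, rfl⟩
  rw [← hpdef] at hp
  rw [← hr'def] at hl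
  have hgp : g * p * g⁻¹ = t := by rw [hpdef]; group
  have hgr : g * r' * g⁻¹ = r := by rw [hr'def]; group
  have hpt : p ≠ t := fun h => hst (by rw [h] at hgp; exact hgp)
  have hp1 : p ≠ 1 := fun h => D.t_ne (by rw [← hgp, h]; group)
  have hv : pi p ≠ 0 := fun h => (D.pi_eq_zero p hp h).elim hp1 hpt
  have hvv : herm (pi p) (pi p) = 0 := by
    rw [← D.sq_iff p hp, hpdef]
    calc g⁻¹ * t * g * (g⁻¹ * t * g) = g⁻¹ * (t * t) * g := by group
      _ = 1 := by rw [D.t_sq]; group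
  have hr'C : r' ∈ C(t) := by
    rw [Subgroup.mem_centralizer_singleton_iff, hr'def]
    calc g⁻¹ * r * g * t = g⁻¹ * (r * (g * t * g⁻¹)) * g := by group
      _ = t * (g⁻¹ * r * g) := by rw [hrs]; group
  have hr'p : p * r' = r' * p := by
    rw [hpdef, hr'def]
    calc g⁻¹ * t * g * (g⁻¹ * r * g) = g⁻¹ * (t * r) * g := by group
      _ = g⁻¹ * r * g * (g⁻¹ * t * g) := by rw [← mul_comm_of_mem (D.le hr)]; group
  -- Elements of the centralizer of `t` commuting with `p` normalize both `Q` and its conjugate.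
  have hM : ∀ m ∈ C(t), m * p = p * m → ∀ y, g * y * g⁻¹ ∈ Q → g * (m * y * m⁻¹) * g⁻¹ ∈ Q := by
    intro m _ hmp y hy
    have h1 : g * m * g⁻¹ ∈ C(t) := by
      rw [Subgroup.mem_centralizer_singleton_iff, ← hgp]
      calc g * m * g⁻¹ * (g * p * g⁻¹) = g * (m * p) * g⁻¹ := by group
        _ = g * p * g⁻¹ * (g * m * g⁻¹) := by rw [hmp]; group
    have h2 := D.normal _ h1 _ hy
    rwa [show g * m * g⁻¹ * (g * y * g⁻¹) * (g * m * g⁻¹)⁻¹ =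
      g * (m * y * m⁻¹) * g⁻¹ by group] at h2
  have hmul : ∀ x y, g * x * g⁻¹ ∈ Q → g * y * g⁻¹ ∈ Q → g * (x * y) * g⁻¹ ∈ Q := by
    intro x y hx hy
    have := mul_mem hx hy
    rwa [show g * x * g⁻¹ * (g * y * g⁻¹) = g * (x * y) * g⁻¹ by group] at this
  have hinv : ∀ x, g * x * g⁻¹ ∈ Q → g * x⁻¹ * g⁻¹ ∈ Q := by
    intro x hx
    have := inv_mem hx
    rwa [show (g * x * g⁻¹)⁻¹ = g * x⁻¹ * g⁻¹ by group] at this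
  have hgr' : g * r' * g⁻¹ ∈ Q := by rwa [hgr]
  have hRv : rho r' (pi p) = pi p := D.rho_pi_of_commute hr'C hp hr'p
  have hRR : ∀ x, rho r' (rho r' x) = x := by
    intro x
    rw [← D.rho_mul hr'C hr'C]
    apply D.rho_of_mem
    have e : r' * r' = g⁻¹ * (r * r) * g := by rw [hr'def]; group
    rw [e]
    rcases D.sq_mem hr with h | h
    · rw [h, show g⁻¹ * 1 * g = 1 by group]; exact one_mem _
    · rw [h, ← hpdef]; exact hp
  have hadd := D.rho_add hr'C
  have hsm := D.rho_smul_of_not_isLin hr'C hl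
  have hh := D.herm_rho_of_not_isLin hr'C hl
  let K : Subgroup G := Q ⊓ Q.comap (MulAut.conj g).toMonoidHom
  have hK : ∀ x, x ∈ K ↔ x ∈ Q ∧ g * x * g⁻¹ ∈ Q := fun x => Iff.rfl
  have hKQ : K ≤ Q := inf_le_left
  obtain ⟨U, hU, hU2⟩ := D.exists_addSubgroup K hKQ ((hK t).2 ⟨D.t_mem, hs⟩)
  have hcommK : ∀ y, y ∈ C(t) → g * y * g⁻¹ ∈ Q →
      ∀ k ∈ K, (y * k * y⁻¹ = k ∨ y * k * y⁻¹ = k * t) → y * k = k * y := by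
    intro y _ hy k hk h
    exact D.commute_of_mem_of_conj_mem (by rwa [← hpdef]) h hy hk.2
  have hKcomm : ∀ x ∈ K, ∀ y ∈ K, x * y = y * x := by
    intro x hx y hy
    refine hcommK x (D.le hx.1) hx.2 y hy ?_
    rw [← D.pi_eq_iff (D.normal x (D.le hx.1) y hy.1) hy.1, ← D.rho_pi x (D.le hx.1) y hy.1,
      D.rho_of_mem hx.1]
  have hisoU : ∀ x ∈ U, ∀ y ∈ U, tr4 (herm x y) = 0 := by
    intro x hx y hy
    obtain ⟨k, hk, rfl⟩ := (hU x).1 hx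
    obtain ⟨l, hl, rfl⟩ := (hU y).1 hy
    exact (D.commute_iff k hk.1 l hl.1).1 (hKcomm k hk l hl)
  obtain ⟨hline, hcard⟩ := line_le_and_card_le (U := U) hv hvv hadd hsm hh hRv hRR (by
    intro x hx
    obtain ⟨y, hy, rfl⟩ := D.pi_surj x
    have hyp := (D.commute_iff y hy p hp).2 hx
    refine (hU _).2 ⟨y * (r' * y⁻¹ * r'⁻¹), (hK _).2 ⟨mul_mem hy (D.normal r' hr'C _ (inv_mem hy)),
      ?_⟩, ?_⟩
    · have := hmul _ _ (hM y (D.le hy) hyp r' hgr') (hinv r' hgr')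
      rwa [show y * r' * y⁻¹ * r'⁻¹ = y * (r' * y⁻¹ * r'⁻¹) by group] at this
    · rw [D.pi_mul y hy _ (D.normal r' hr'C _ (inv_mem hy)), ← D.rho_pi r' hr'C _ (inv_mem hy),
        D.pi_inv hy]) (by
    intro A hA x hx
    obtain ⟨k, hk, rfl⟩ := (hU x).1 hx
    obtain ⟨m, hm, hmp, hr⟩ := D.exists_lift_stabilizer hp hp1 hpt hA
    refine (hU _).2 ⟨m * k * m⁻¹, (hK _).2 ⟨D.normal m hm k hk.1, hM m hm hmp k hk.2⟩, ?_⟩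
    rw [← D.rho_pi m hm k hk.1, hr])
  have hUv : ∀ x ∈ U, herm x (pi p) = 0 := by
    intro x hx
    refine eq_of_tr4_mul fun c => ?_
    have := hisoU x hx _ (hline (star c))
    rw [herm_smul_right, star_star] at this
    rw [this, mul_zero, tr4_zero]
  -- The transvection with centre `pi p` is a commutator of commutators with `r'`.
  obtain ⟨c, hcC, hgc, hc⟩ : ∃ c ∈ C(t), g * c * g⁻¹ ∈ Q ∧
      ∀ x, rho c x = x + herm x (pi p) • pi p := by
    obtain ⟨w, hw, hwv⟩ := exists_add_not_mem_line hv hsm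
    obtain ⟨u, huv, huw⟩ := exists_orthogonal_herm_eq hv hwv om
    obtain ⟨m1, hm1⟩ := exists_tr4_eq_herm_self w
    obtain ⟨m2, hm2⟩ := exists_tr4_eq_herm_self u
    obtain ⟨A1, hA1⟩ := exists_unip hvv hw hm1
    obtain ⟨A2, hA2⟩ := exists_unip hvv huv hm2
    obtain ⟨a1, ha1, ha1p, hr1⟩ := D.exists_lift_stabilizer hp hp1 hpt
      ((hA1 _).trans (unipFun_self hvv hw m1))
    obtain ⟨a2, ha2, ha2p, hr2⟩ := D.exists_lift_stabilizer hp hp1 hpt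
      ((hA2 _).trans (unipFun_self hvv huv m2))
    have hRw : herm (rho r' w) (pi p) = 0 := by
      have := hh w (pi p)
      rw [hRv, hw, star_zero] at this
      exact this
    obtain ⟨b, hb⟩ : ∃ b, b = a1 * r' * a1⁻¹ * r'⁻¹ := ⟨_, rfl⟩
    have hbC : b ∈ C(t) := hb ▸
      mul_mem (mul_mem (mul_mem ha1 hr'C) (inv_mem ha1)) (inv_mem hr'C)
    have hgb : g * b * g⁻¹ ∈ Q := hb ▸ hmul _ _ (hM a1 ha1 ha1p r' hgr') (hinv r' hgr')
    have hrb : ∀ x, rho b x =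
        unipFun (pi p) (w + rho r' w) (m1 + star m1 + herm (rho r' w) (w + rho r' w)) x := by
      intro x
      have h1 := unipFun_comp_semilinear hvv hw hadd hsm hh hRv rfl (m := m1)
        (rho a1⁻¹ (rho r'⁻¹ x))
      have e1 : ∀ y, unipFun (pi p) w m1 y = rho a1 y := fun y => by rw [hr1, hA1]; rfl
      rw [e1, D.rho_rho_inv ha1, D.rho_rho_inv hr'C] at h1
      rw [h1, e1, hb, D.rho_mul (mul_mem (mul_mem ha1 hr'C) (inv_mem ha1)) (inv_mem hr'C),
        D.rho_mul (mul_mem ha1 hr'C) (inv_mem ha1), D.rho_mul ha1 hr'C]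
    refine ⟨a2 * b * a2⁻¹ * b⁻¹, mul_mem (mul_mem (mul_mem ha2 hbC) (inv_mem ha2)) (inv_mem hbC),
      hmul _ _ (hM a2 ha2 ha2p b hgb) (hinv b hgb), fun x => ?_⟩
    obtain ⟨y, rfl⟩ : ∃ y, x = rho b (rho a2 y) :=
      ⟨rho a2⁻¹ (rho b⁻¹ x), by rw [D.rho_rho_inv ha2, D.rho_rho_inv hbC]⟩
    rw [D.rho_mul (mul_mem (mul_mem ha2 hbC) (inv_mem ha2)) (inv_mem hbC),
      D.rho_mul (mul_mem ha2 hbC) (inv_mem ha2), D.rho_mul ha2 hbC, D.rho_inv_rho hbC,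
      D.rho_inv_rho ha2]
    have hwv' : herm (w + rho r' w) (pi p) = 0 := by rw [herm_add_left, hw, hRw, add_zero]
    have e2 : ∀ y, rho a2 y = unipFun (pi p) u m2 y := fun y => by rw [hr2, hA2]; rfl
    rw [e2, e2, hrb, hrb, unipFun_unipFun hvv huv hwv', unipFun_unipFun hvv hwv' huv]
    have e3 : herm (w + rho r' w) u = star om := by rw [← star_herm, huw]
    have hpu : herm (pi p) u = 0 := by rw [← star_herm, huv, star_zero]
    have hpw : herm (pi p) (w + rho r' w) = 0 := by rw [← star_herm, hwv', star_zero]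
    rw [e3, huw, star_om]
    generalize m1 + star m1 + herm (rho r' w) (w + rho r' w) = n
    generalize w + rho r' w = z at *
    simp only [unipFun_apply, herm_add_left, herm_smul_left, herm_add_right, huv, hwv', hvv,
      mul_zero, add_zero]
    ext i
    simp only [Pi.add_apply, Pi.smul_apply, smul_eq_mul]
    ring
  have hcK : ∀ k ∈ K, c * k = k * c := by
    intro k hk
    refine hcommK c hcC hgc k hk ?_
    rw [← D.pi_eq_iff (D.normal c hcC k hk.1) hk.1, ← D.rho_pi c hcC k hk.1, hc,
      hUv _ ((hU _).2 ⟨k, hk, rfl⟩), zero_smul, add_zero]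
  -- Conjugation by `g` makes `c` an element of `Q` that centralizes a maximal abelian subgroup.
  obtain ⟨U', hU', hU2'⟩ := D.exists_addSubgroup (K.map (MulAut.conj g).toMonoidHom) (by
    rintro _ ⟨k, hk, rfl⟩
    exact hk.2) ⟨p, (hK p).2 ⟨hp, by rw [hgp]; exact D.t_mem⟩, hgp⟩
  have hcard' : 16 ≤ Nat.card U' := by
    have h1 := D.card_eq_two_mul hKQ hU hU2
    have h2 := D.card_eq_two_mul (by
      rintro _ ⟨k, hk, rfl⟩
      exact hk.2) hU' hU2'
    rw [← Nat.card_congr (K.equivMapOfInjective _ (MulAut.conj g).injective).toEquiv] at h2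
    omega
  have hconj : ∀ x y, x * y = y * x →
      g * x * g⁻¹ * (g * y * g⁻¹) = g * y * g⁻¹ * (g * x * g⁻¹) := by
    intro x y h
    calc g * x * g⁻¹ * (g * y * g⁻¹) = g * (x * y) * g⁻¹ := by group
      _ = g * y * g⁻¹ * (g * x * g⁻¹) := by rw [h]; group
  have hcU := mem_of_forall_tr4_herm_eq_zero (U := U') (by
    intro x hx y hy
    obtain ⟨_, ⟨k, hk, rfl⟩, rfl⟩ := (hU' x).1 hx
    obtain ⟨_, ⟨l, hl, rfl⟩, rfl⟩ := (hU' y).1 hy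
    exact (D.commute_iff _ hk.2 _ hl.2).1 (hconj k l (hKcomm k hk l hl))) hcard'
    (w := pi (g * c * g⁻¹)) (by
    intro x hx
    obtain ⟨_, ⟨k, hk, rfl⟩, rfl⟩ := (hU' x).1 hx
    exact (D.commute_iff _ hk.2 _ hgc).1 (hconj k c (hcK k hk).symm))
  obtain ⟨k, hk, e⟩ := hU2' _ hgc hcU
  have hck : c = k := by
    have : g * k * g⁻¹ = g * c * g⁻¹ := e
    simpa using this.symm
  obtain ⟨x, hx⟩ := exists_herm_ne_zero hv
  have h1 := hc x
  rw [D.rho_of_mem (hck ▸ hk.1)] at h1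
  have h2 : herm x (pi p) • pi p = 0 := by simpa using h1
  rcases smul_eq_zero.1 h2 with h | h
  · rw [← star_herm, h, star_zero] at hx
    exact hx rfl
  · exact hv h

end LocalData


/-! ### Linearity of elements transported along conjugation -/

/-- Let `s` be a conjugate of `t` and `y` an element commuting with `s`. Then `y` is twisted at `s`
if conjugation of `s` to `t` takes `y` to an element of the centralizer of `t` that does not act
linearly. -/
def Twisted {G : Type*} [Group G] (t : G) (rho : G → V4 → V4) (s y : G) : Prop :=
  ∃ g, s = g * t * g⁻¹ ∧ ¬ IsLin (rho (g⁻¹ * y * g))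

theorem Twisted.conj {G : Type*} [Group G] {t : G} {rho : G → V4 → V4} {s y : G}
    (h : Twisted t rho s y) (a : G) : Twisted t rho (a * s * a⁻¹) (a * y * a⁻¹) := by
  obtain ⟨g, rfl, h⟩ := h
  refine ⟨a * g, by group, ?_⟩
  rwa [show (a * g)⁻¹ * (a * y * a⁻¹) * (a * g) = g⁻¹ * y * g by group]

theorem twisted_conj_iff {G : Type*} [Group G] {t : G} {rho : G → V4 → V4} {s y : G} (a : G) :
    Twisted t rho (a * s * a⁻¹) y ↔ Twisted t rho s (a⁻¹ * y * a) := by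
  constructor
  · intro h
    have := h.conj a⁻¹
    rwa [show a⁻¹ * (a * s * a⁻¹) * a⁻¹⁻¹ = s by group, inv_inv] at this
  · intro h
    have := h.conj a
    rwa [show a * (a⁻¹ * y * a) * a⁻¹ = y by group] at this

/-- A fixed point `a` of `a ↦ star a + s` has trace `s`, and its norm is determined by `s`. -/
theorem norm_eq_of_star_add_eq {a s : F4} (h : star a + s = a) :
    (s = 0 ∧ a * star a = a) ∨ (s = 1 ∧ a * star a = 1) := by
  have h1 : s = tr4 a := by simp only [tr4]; grind
  rcases tr4_eq_zero_or_one a with h0 | h0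
  · refine .inl ⟨h1.trans h0, ?_⟩
    rw [(tr4_eq_zero_iff a).1 h0]
    rcases (F4.fixed_iff a).1 ((tr4_eq_zero_iff a).1 h0) with h | h <;> rw [h] <;> simp
  · refine .inr ⟨h1.trans h0, F4.mul_star_self ?_⟩
    rintro rfl
    rw [tr4_zero] at h0
    exact zero_ne_one h0

theorem herm_self_eq_zero_of_sig {w : V4} (h : sig w = w) : herm w w = 0 := by
  have hi : ∀ i, star (w i) + ∑ k, star (w k) = w i := fun i => congrFun h i
  have hs : ∑ k, star (w k) = 0 ∨ ∑ k, star (w k) = 1 := by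
    rcases norm_eq_of_star_add_eq (hi 0) with h | h
    · exact .inl h.1
    · exact .inr h.1
  rcases hs with hs | hs
  · have hk : ∀ i, w i * star (w i) = star (w i) := by
      intro i
      rcases norm_eq_of_star_add_eq (hi i) with h | h
      · rw [h.2, ← hi i, hs, add_zero, star_star, ← add_zero (star (w i)), ← hs, hi i]
      · exact absurd (hs.symm.trans h.1) zero_ne_one
    rw [herm, Finset.sum_congr rfl fun i _ => hk i, hs]
  · have hk : ∀ i, w i * star (w i) = 1 := by
      intro i
      rcases norm_eq_of_star_add_eq (hi i) with h | h
      · exact absurd (h.1.symm.trans hs) zero_ne_one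
      · exact h.2
    rw [herm, Finset.sum_congr rfl fun i _ => hk i]
    simp; grind

theorem sig_smul (a : F4) (v : V4) : sig (a • v) = star a • sig v := by
  ext i
  simp only [sig, Pi.smul_apply, smul_eq_mul, star_mul', mul_add, Finset.mul_sum]

theorem sig_ones : sig (fun _ => 1) = fun _ => 1 := by
  ext i; simp [sig]; grind

theorem sig_v0 : sig v0 = v0 := by
  ext i
  have h : ∑ k, star (v0 k) = 0 := by
    simp [Fin.sum_univ_four, v0]; grind
  have h2 : star (v0 i) = v0 i := by fin_cases i <;> simp [v0]
  rw [sig, h, h2, add_zero]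

theorem sig_sig (v : V4) : sig (sig v) = v := by
  ext i
  simp only [sig, Fin.sum_univ_four, star_add, star_star]
  grind

namespace LocalData

variable {G : Type*} [Group G] {t : G} {Q : Subgroup G} {pi : G → V4} {rho : G → V4 → V4}
  (D : LocalData t Q pi rho)
include D

local notation "C(" t ")" => Subgroup.centralizer {t}

/-- Being twisted does not depend on the choice of the conjugating element. -/
theorem twisted_iff {g y : G} (h : y * (g * t * g⁻¹) = g * t * g⁻¹ * y) :
    Twisted t rho (g * t * g⁻¹) y ↔ ¬ IsLin (rho (g⁻¹ * y * g)) := by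
  refine ⟨?_, fun h => ⟨g, rfl, h⟩⟩
  rintro ⟨k, hk, hl⟩ hl'
  apply hl
  have hc : k⁻¹ * g ∈ C(t) := by
    rw [Subgroup.mem_centralizer_singleton_iff]
    calc k⁻¹ * g * t = k⁻¹ * (g * t * g⁻¹) * g := by group
      _ = t * (k⁻¹ * g) := by rw [hk]; group
  have := (D.isLin_conj hc (conj_mem_centralizer h)).2 hl'
  rwa [show k⁻¹ * g * (g⁻¹ * y * g) * (k⁻¹ * g)⁻¹ = k⁻¹ * y * k by group] at this

theorem twisted_mul {g y z : G} (hy : y * (g * t * g⁻¹) = g * t * g⁻¹ * y)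
    (hz : z * (g * t * g⁻¹) = g * t * g⁻¹ * z) :
    Twisted t rho (g * t * g⁻¹) (y * z) ↔
      ¬ (Twisted t rho (g * t * g⁻¹) y ↔ Twisted t rho (g * t * g⁻¹) z) := by
  have hyz : y * z * (g * t * g⁻¹) = g * t * g⁻¹ * (y * z) := by
    rw [mul_assoc, hz, ← mul_assoc, hy, mul_assoc]
  rw [D.twisted_iff hy, D.twisted_iff hz, D.twisted_iff hyz,
    show g⁻¹ * (y * z) * g = g⁻¹ * y * g * (g⁻¹ * z * g) by group,
    D.isLin_mul (conj_mem_centralizer hy) (conj_mem_centralizer hz), not_iff_not]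
  tauto

theorem twisted_self {y : G} (hy : y ∈ C(t)) : Twisted t rho t y ↔ ¬ IsLin (rho y) := by
  have := D.twisted_iff (g := 1) (y := y) (by simpa using mul_comm_of_mem hy)
  simpa using this

theorem not_twisted_of_mem [Finite G] {g r : G} (hs : g * t * g⁻¹ ∈ Q) (hst : g * t * g⁻¹ ≠ t)
    (hr : r ∈ Q) (hrs : r * (g * t * g⁻¹) = g * t * g⁻¹ * r) :
    ¬ Twisted t rho (g * t * g⁻¹) r := by
  rw [D.twisted_iff hrs, not_not]
  exact D.isLin_conj_of_commute hs hst hr hrs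

/-- The number of conjugates of `t` in its centralizer at which `t` is twisted is divisible by `4`:
these conjugates lie outside `Q`, so that `Q` has no orbits of length less than `4` on them. -/
theorem four_dvd_ncard_twisted [Finite G] :
    4 ∣ {s | (∃ g, s = g * t * g⁻¹) ∧ s * t = t * s ∧ Twisted t rho s t}.ncard := by
  refine four_dvd_ncard D.isPGroup ?_ ?_
  · rintro a ha _ ⟨⟨g, rfl⟩, h1, h2⟩
    have hat := mul_comm_of_mem (D.le ha)
    refine ⟨⟨a * g, by group⟩, ?_, ?_⟩
    · exact (mul_mem (mul_mem (D.le ha) (Subgroup.mem_centralizer_singleton_iff.2 h1))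
        (inv_mem (D.le ha)) : _ ∈ C(t)) |> mul_comm_of_mem
    · rw [twisted_conj_iff, mul_assoc a⁻¹, ← hat]
      simpa using h2
  · rintro s ⟨⟨g, rfl⟩, h1, h2⟩
    by_contra! hall
    have hmem := D.mem_of_few_conjugates (Subgroup.mem_centralizer_singleton_iff.2 h1)
      ⟨1, by
        rw [pow_one, pow_two]
        calc g * t * g⁻¹ * (g * t * g⁻¹) = g * (t * t) * g⁻¹ := by group
          _ = 1 := by rw [D.t_sq]; group⟩ (fun x1 hx1 x2 hx2 => by
        have := hall x1 hx1 x2 hx2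
        tauto)
    have hne : g * t * g⁻¹ ≠ t := by
      intro h
      rw [h, D.twisted_self (self_mem_centralizer t)] at h2
      exact h2 (D.isLin_of_mem D.t_mem)
    exact D.not_twisted_of_mem hmem hne D.t_mem h1.symm h2

end LocalData


/-! ### Counting the conjugates at which an element is twisted -/

namespace LocalData

variable {G : Type*} [Group G] {t : G} {Q : Subgroup G} {pi : G → V4} {rho : G → V4 → V4}
  (D : LocalData t Q pi rho)
include D

local notation "C(" t ")" => Subgroup.centralizer {t}

theorem not_isLin_of_sig {d : G} (hd : d ∈ C(t)) (hr : ∀ v, rho d v = sig v) :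
    ¬ IsLin (rho d) :=
  D.not_isLin_of_semilinear hd fun a v => by rw [hr, hr, sig_smul]

theorem rho_rho_of_sq {d : G} (hd : d ∈ C(t)) (hd2 : d * d = 1 ∨ d * d = t) (v : V4) :
    rho d (rho d v) = v := by
  rw [← D.rho_mul hd hd]
  refine D.rho_of_mem ?_ v
  rcases hd2 with h | h <;> rw [h]
  exacts [one_mem _, D.t_mem]

/-- The elements of `Q` whose image is fixed by the action of `d` commute with `d`. -/
theorem mem_inf_iff {d : G} (hd : d ∈ C(t)) (hr : ∀ v, rho d v = sig v)
    (hd2 : d * d = 1 ∨ d * d = t) (x : G) :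
    x ∈ Q ⊓ Subgroup.centralizer {d} ↔ x ∈ Q ∧ rho d (pi x) = pi x := by
  rw [Subgroup.mem_inf, Subgroup.mem_centralizer_singleton_iff]
  refine and_congr_right fun hx => ⟨fun h => D.rho_pi_of_commute hd hx h, fun h => ?_⟩
  -- Up to `t`, such an element is a product of some `y` and its conjugate by `d`.
  obtain ⟨y, hy, hpy⟩ := D.pi_surj (om • pi x)
  have hy' := D.normal d hd y hy
  have hpy' : pi (d * y * d⁻¹) = star om • pi x := by
    rw [← D.rho_pi d hd y hy, hpy, D.rho_smul_of_not_isLin hd (D.not_isLin_of_sig hd hr), h]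
  have hw : herm (pi x) (pi x) = 0 := herm_self_eq_zero_of_sig (by rw [← hr, h])
  have hc : y * (d * y * d⁻¹) = d * y * d⁻¹ * y := by
    rw [D.commute_iff y hy _ hy', hpy, hpy', herm_smul_left, herm_smul_right, hw]
    simp [tr4_zero]
  have e : pi x = pi (y * (d * y * d⁻¹)) := by
    rw [D.pi_mul y hy _ hy', hpy, hpy', ← add_smul]
    have : om + star om = 1 := tr4_om
    rw [this, one_smul]
  have hdd : d * d * y = y * (d * d) := by
    rcases hd2 with h | h <;> rw [h]
    · simp
    · exact (mul_comm_of_mem (D.le hy)).symm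
  have hz : d * (y * (d * y * d⁻¹)) = y * (d * y * d⁻¹) * d := by
    rw [hc]
    calc d * (d * y * d⁻¹ * y) = d * d * y * d⁻¹ * y := by group
      _ = y * (d * d) * d⁻¹ * y := by rw [hdd]
      _ = y * (d * y * d⁻¹) * d := by group
      _ = d * y * d⁻¹ * y * d := by rw [hc]
  have ht := mul_comm_of_mem hd
  rcases (D.pi_eq_iff hx (mul_mem hy hy')).1 e with h1 | h1
  · rw [h1, hz]
  · rw [h1]
    calc y * (d * y * d⁻¹) * t * d = y * (d * y * d⁻¹) * (t * d) := by group
      _ = y * (d * y * d⁻¹) * d * t := by rw [← ht]; group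
      _ = d * (y * (d * y * d⁻¹) * t) := by rw [← hz]; group

/-- An element centralizing all of `Q ∩ C(d)` acts trivially or like `d`. -/
theorem mem_or_mem_of_forall_commute {d : G} (hd : d ∈ C(t)) (hr : ∀ v, rho d v = sig v)
    (hd2 : d * d = 1 ∨ d * d = t) {s : G} (hs2 : s * s = 1) (hsd : s * d = d * s)
    (h : ∀ a ∈ Q ⊓ Subgroup.centralizer {d}, a * s = s * a) :
    s ∈ Q ⊓ Subgroup.centralizer {d} ∨ s * d⁻¹ ∈ Q ⊓ Subgroup.centralizer {d} := by
  have hA := D.mem_inf_iff hd hr hd2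
  have hdl := D.not_isLin_of_sig hd hr
  have hRR := D.rho_rho_of_sq hd hd2
  have hst : s ∈ C(t) := by
    rw [Subgroup.mem_centralizer_singleton_iff]
    exact (h t ((hA t).2 ⟨D.t_mem, by rw [D.pi_t, D.rho_zero hd]⟩)).symm
  have hfix : ∀ v, rho d v = v → rho s v = v := by
    intro v hv
    obtain ⟨x, hx, rfl⟩ := D.pi_surj v
    exact D.rho_pi_of_commute hst hx (h x ((hA x).2 ⟨hx, hv⟩))
  -- A linear map fixing the vectors fixed by `d` is the identity, since these span.
  have span : ∀ f : V4 → V4, (∀ v w, f (v + w) = f v + f w) → IsLin f →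
      (∀ v, rho d v = v → f v = v) → ∀ v, f v = v := by
    intro f hf hl hfd v
    have h1 := hfd (v + rho d v) (by rw [D.rho_add hd, hRR, add_comm])
    have h2 := hfd (om • v + rho d (om • v)) (by rw [D.rho_add hd, hRR, add_comm])
    have e : v = (om • v + rho d (om • v)) + (om + 1) • (v + rho d v) := by
      rw [D.rho_smul_of_not_isLin hd hdl, star_om]
      ext i
      simp only [Pi.add_apply, Pi.smul_apply, smul_eq_mul]
      grind
    rw [e, hf, hl, h1, h2]
  have hcomm : ∀ x ∈ Q, x * d = d * x → x ∈ Q ⊓ Subgroup.centralizer {d} := fun x hx h =>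
    ⟨hx, Subgroup.mem_centralizer_singleton_iff.2 h⟩
  have p4 : ∀ y : G, y ^ 4 = y * y * (y * y) := fun y => by simp [pow_succ, mul_assoc]
  by_cases hl : IsLin (rho s)
  · left
    refine hcomm s (D.mem_of_rho s hst (span _ (D.rho_add hst) hl hfix) ⟨1, ?_⟩) hsd
    rw [pow_one, pow_two, hs2]
  · right
    have hsd' : s * d⁻¹ ∈ C(t) := mul_mem hst (inv_mem hd)
    have hdi : ¬ IsLin (rho d⁻¹) := by
      intro h1
      have := D.isLin_mul hd (inv_mem hd)
      rw [mul_inv_cancel] at this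
      exact hdl ((this.1 (D.isLin_of_mem Q.one_mem)).2 h1)
    have hl' : IsLin (rho (s * d⁻¹)) := (D.isLin_mul hst (inv_mem hd)).2 (by tauto)
    have hcd : Commute s d⁻¹ := (show Commute s d from hsd).inv_right
    refine hcomm _ (D.mem_of_rho _ hsd' (span _ (D.rho_add hsd') hl' fun v hv => ?_) ⟨2, ?_⟩) ?_
    · rw [D.rho_mul hst (inv_mem hd)]
      have : rho d⁻¹ v = v := by
        conv_lhs => rw [← hv]
        exact D.rho_inv_rho hd v
      rw [this, hfix v hv]
    · have h4 : d⁻¹ ^ 4 = 1 := by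
        rw [inv_pow, inv_eq_one, p4]
        rcases hd2 with h | h <;> rw [h]
        · simp
        · exact D.t_sq
      rw [show (2 ^ 2 : ℕ) = 4 by norm_num, hcd.mul_pow, h4, p4, hs2]
      simp
    · rw [mul_assoc, inv_mul_cancel, ← mul_assoc, ← hsd, mul_assoc, mul_inv_cancel]

theorem commute_of_mem_inf {d : G} (hd : d ∈ C(t)) (hr : ∀ v, rho d v = sig v)
    (hd2 : d * d = 1 ∨ d * d = t) {a b : G} (ha : a ∈ Q ⊓ Subgroup.centralizer {d})
    (hb : b ∈ Q ⊓ Subgroup.centralizer {d}) : a * b = b * a := by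
  rw [D.mem_inf_iff hd hr hd2] at ha hb
  rw [D.commute_iff a ha.1 b hb.1, tr4_eq_zero_iff,
    ← D.herm_rho_of_not_isLin hd (D.not_isLin_of_sig hd hr), ha.2, hb.2]

/-- Multiplication by `t` pairs off the elements `s ≠ t` of `Q ∩ C(d)` at which `d` is twisted: it
is conjugation by an element of `Q`, which changes `d` by an element of `Q` not twisted at `s`. -/
theorem even_ncard_twisted_inf [Finite G] {d : G} (hd : d ∈ C(t)) :
    Even {s | ((∃ g, s = g * t * g⁻¹) ∧ s * d = d * s ∧ Twisted t rho s d) ∧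
      s ∈ Q ∧ s ≠ t}.ncard := by
  refine even_ncard_of_involution _ (fun s => s * t) ?_ ?_ ?_
  · rintro s ⟨⟨⟨g, rfl⟩, hsd, htw⟩, hs, hst⟩
    have hs1 : g * t * g⁻¹ ≠ 1 := fun h => D.t_ne (by simpa using h)
    obtain ⟨x, hx, e⟩ := D.exists_conj_eq_mul_t hs hs1 hst
    have hx' := D.normal d⁻¹ (inv_mem hd) _ (inv_mem hx)
    rw [inv_inv] at hx'
    have hrQ : d⁻¹ * x⁻¹ * d * x ∈ Q := mul_mem hx' hx
    have hstd : g * t * g⁻¹ * t * d = d * (g * t * g⁻¹ * t) := by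
      rw [mul_assoc _ t, ← mul_comm_of_mem hd, ← mul_assoc, hsd, mul_assoc]
    -- The commutator of `x` and `d` commutes with `s`, as both conjugate `s` to `s * t`.
    have hrs : d⁻¹ * x⁻¹ * d * x * (g * t * g⁻¹) = g * t * g⁻¹ * (d⁻¹ * x⁻¹ * d * x) := by
      generalize g * t * g⁻¹ = s at *
      have e1 : x * s = s * t * x := by rw [← e]; group
      have e2 : x⁻¹ * (s * t) = s * x⁻¹ := by rw [← e]; group
      calc d⁻¹ * x⁻¹ * d * x * s = d⁻¹ * x⁻¹ * d * (x * s) := by group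
        _ = d⁻¹ * x⁻¹ * (d * (s * t)) * x := by rw [e1]; group
        _ = d⁻¹ * (x⁻¹ * (s * t)) * d * x := by rw [← hstd]; group
        _ = d⁻¹ * (s * d) * d⁻¹ * x⁻¹ * d * x := by rw [e2]; group
        _ = s * (d⁻¹ * x⁻¹ * d * x) := by rw [hsd]; group
    refine ⟨⟨⟨x * g, by rw [← e]; group⟩, hstd, ?_⟩, mul_mem hs D.t_mem, ?_⟩
    · rw [← e, twisted_conj_iff, show x⁻¹ * d * x = d * (d⁻¹ * x⁻¹ * d * x) by group,
        D.twisted_mul hsd.symm hrs]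
      have := D.not_twisted_of_mem hs hst hrQ hrs
      tauto
    · simpa using hs1
  · intro s _
    rw [mul_assoc, D.t_sq, mul_one]
  · intro s _ h
    exact D.t_ne (by simpa using h)

/-- The conjugates of `t` in the coset of `Q ∩ C(d)` containing `d` at which `d` is twisted are even
in number. An element `x` of `Q` is chosen whose commutator `r` with `d` commutes with `x` and with
these conjugates. Conjugation by `x` pairs off those at which `r` is not twisted, and at the others
it exchanges twistedness and untwistedness of `d`; the total number of the latter is divisible by
`4`, as the subgroup of `Q` centralizing `r` moves them in orbits of length at least `4`. -/
theorem even_ncard_twisted_coset [Finite G] {d : G} (hd : d ∈ C(t)) (hr : ∀ v, rho d v = sig v)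
    (hd2 : d * d = 1 ∨ d * d = t) :
    Even {s | ((∃ g, s = g * t * g⁻¹) ∧ s * d = d * s ∧ Twisted t rho s d) ∧
      s * d⁻¹ ∈ Q ⊓ Subgroup.centralizer {d}}.ncard := by
  have hA := D.mem_inf_iff hd hr hd2
  have hAA := fun {a b : G} => D.commute_of_mem_inf hd hr hd2 (a := a) (b := b)
  have hdl := D.not_isLin_of_sig hd hr
  have hRR := D.rho_rho_of_sq hd hd2
  have hAd : ∀ a ∈ Q ⊓ Subgroup.centralizer {d}, a * d = d * a := fun a ha =>
    Subgroup.mem_centralizer_singleton_iff.1 ha.2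
  have hsq : ∀ g : G, g * t * g⁻¹ * (g * t * g⁻¹) = 1 := fun g => by
    calc g * t * g⁻¹ * (g * t * g⁻¹) = g * (t * t) * g⁻¹ := by group
      _ = 1 := by rw [D.t_sq]; group
  rcases hd2 with hd2 | hd2
  swap
  · -- Here the coset contains no involutions.
    have empty : ∀ S : Set G, (∀ s, s ∉ S) → Even S.ncard := fun S h => by
      rw [Set.eq_empty_of_forall_notMem h, Set.ncard_empty]
      exact Even.zero
    refine empty _ ?_
    rintro s ⟨⟨⟨g, rfl⟩, hsd, -⟩, ha⟩
    have h1 := hsq g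
    generalize g * t * g⁻¹ = s at *
    have h2 := hAd _ ha
    obtain ⟨a, rfl⟩ : ∃ a, s = a * d := ⟨s * d⁻¹, by group⟩
    rw [mul_inv_cancel_right] at h2 ha
    have h3 : a * a = 1 := by
      rw [D.sq_iff a ha.1]
      exact herm_self_eq_zero_of_sig (by rw [← hr, ((hA a).1 ha).2])
    apply D.t_ne
    calc t = a * a * (d * d) := by rw [h3, hd2, one_mul]
      _ = a * (a * d) * d := by group
      _ = a * (d * a) * d := by rw [h2]
      _ = a * d * (a * d) := by group
      _ = 1 := h1
  obtain ⟨w0, hw0⟩ : ∃ w0 : V4, w0 = fun _ => 1 := ⟨_, rfl⟩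
  have hw0s : sig w0 = w0 := by rw [hw0, sig_ones]
  have hw0n : w0 ≠ 0 := fun h => one_ne_zero (congrFun (hw0.symm.trans h) 0)
  have hw00 : herm w0 w0 = 0 := herm_self_eq_zero_of_sig hw0s
  have hv0w0 : herm v0 w0 = 0 := by
    rw [hw0]; simp [herm_eq, v0]; grind
  obtain ⟨x, hx, hpx⟩ := D.pi_surj (om • w0)
  have hds := D.rho_smul_of_not_isLin hd hdl
  have hadd := D.rho_add hd
  have hcomQ : ∀ y ∈ Q, y * d * y⁻¹ * d⁻¹ ∈ Q ∧ pi (y * d * y⁻¹ * d⁻¹) = pi y + rho d (pi y) := by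
    intro y hy
    have h1 := D.normal d hd _ (inv_mem hy)
    rw [show y * d * y⁻¹ * d⁻¹ = y * (d * y⁻¹ * d⁻¹) by group]
    exact ⟨mul_mem hy h1, by
      rw [D.pi_mul y hy _ h1, ← D.rho_pi d hd _ (inv_mem hy), D.pi_inv hy]⟩
  obtain ⟨r, hrdef⟩ : ∃ r, r = x⁻¹ * d * x * d⁻¹ := ⟨_, rfl⟩
  have hrQ : r ∈ Q ∧ pi r = w0 := by
    have h1 := hcomQ x⁻¹ (inv_mem hx)
    rw [inv_inv, ← hrdef, D.pi_inv hx, hpx, hds, hr, hw0s, ← add_smul] at h1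
    have : om + star om = 1 := tr4_om
    rwa [this, one_smul] at h1
  have hrA : r ∈ Q ⊓ Subgroup.centralizer {d} := (hA r).2 ⟨hrQ.1, by rw [hrQ.2, hr, hw0s]⟩
  have hcr : ∀ w, herm w w0 = 0 → ∀ y ∈ Q, pi y = om • w → y * r = r * y := by
    intro w hw y hy hpy
    rw [D.commute_iff y hy r hrQ.1, hpy, hrQ.2, herm_smul_left, hw, mul_zero, tr4_zero]
  have hxr := hcr w0 hw00 x hx hpx
  let E : G → Prop := fun s => (∃ g, s = g * t * g⁻¹) ∧ s * d⁻¹ ∈ Q ⊓ Subgroup.centralizer {d}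
  have hE : ∀ s, E s → ∃ a ∈ Q ⊓ Subgroup.centralizer {d}, s = a * d := fun s hs =>
    ⟨s * d⁻¹, hs.2, by group⟩
  have hEd : ∀ s, E s → s * d = d * s := by
    intro s hs
    obtain ⟨a, ha, rfl⟩ := hE s hs
    rw [hAd a ha, mul_assoc, hAd a ha]
  have hEr : ∀ s, E s → r * s = s * r := by
    intro s hs
    obtain ⟨a, ha, rfl⟩ := hE s hs
    rw [← mul_assoc, hAA hrA ha, mul_assoc, hAd r hrA, mul_assoc]
  have hErho : ∀ s, E s → s ∈ C(t) ∧ ∀ v, rho s v = rho d v := by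
    intro s hs
    obtain ⟨a, ha, rfl⟩ := hE s hs
    exact ⟨mul_mem (D.le ha.1) hd, fun v => by rw [D.rho_mul (D.le ha.1) hd, D.rho_of_mem ha.1]⟩
  have hEconj : ∀ y ∈ Q, ∀ s, E s → E (y * s * y⁻¹) := by
    intro y hy s hs
    obtain ⟨⟨g, hg⟩, ha⟩ := hs
    refine ⟨⟨y * g, by rw [hg]; group⟩, ?_⟩
    have h1 := D.normal y (D.le hy) _ ha.1
    have h2 := hcomQ y hy
    have h3 := (hA _).1 ha
    rw [show y * s * y⁻¹ * d⁻¹ = y * (s * d⁻¹) * y⁻¹ * (y * d * y⁻¹ * d⁻¹) by group, hA]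
    refine ⟨mul_mem h1 h2.1, ?_⟩
    rw [D.pi_mul _ h1 _ h2.1, ← D.rho_pi y (D.le hy) _ ha.1, D.rho_of_mem hy, h2.2, hadd, hadd,
      hRR, h3.2, add_comm (pi y)]
  have hmove : ∀ w, sig w = w → w ≠ 0 → ∀ y ∈ Q, pi y = om • w → ∀ s, E s → y * s ≠ s * y := by
    intro w hw hw0 y hy hpy s hs h
    have h1 := D.rho_pi_of_commute (hErho s hs).1 hy h
    rw [(hErho s hs).2, hpy, hds, hr, hw, star_om, add_smul, one_smul] at h1
    exact hw0 (by simpa using h1)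
  have htwx : ∀ s, E s → (Twisted t rho (x * s * x⁻¹) d ↔
      ¬ (Twisted t rho s r ↔ Twisted t rho s d)) := by
    intro s hs
    have h1 := hEr s hs
    have h2 := hEd s hs
    obtain ⟨⟨g, rfl⟩, -⟩ := hs
    rw [twisted_conj_iff, show x⁻¹ * d * x = r * d by rw [hrdef]; group,
      D.twisted_mul h1 h2.symm]
  have htwr : ∀ y, y * r = r * y → ∀ s, (Twisted t rho (y * s * y⁻¹) r ↔ Twisted t rho s r) := by
    intro y hy s
    rw [twisted_conj_iff, mul_assoc, ← hy, inv_mul_cancel_left]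
  have hxx : ∀ s, E s → x * (x * s * x⁻¹) * x⁻¹ = s := by
    intro s hs
    have h1 : x * x * s = s * (x * x) := by
      rcases D.sq_mem hx with h | h <;> rw [h]
      · simp
      · exact (mul_comm_of_mem (hErho s hs).1).symm
    calc x * (x * s * x⁻¹) * x⁻¹ = x * x * s * (x * x)⁻¹ := by group
      _ = s := by rw [h1]; group
  have hxs : ∀ s, E s → x * s * x⁻¹ ≠ s := fun s hs h =>
    hmove w0 hw0s hw0n x hx hpx s hs (conj_eq_iff.1 h)
  -- Where `r` is not twisted, conjugation by `x` preserves twistedness of `d`.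
  have hB0 : Even {s | E s ∧ Twisted t rho s d ∧ ¬ Twisted t rho s r}.ncard := by
    refine even_ncard_of_involution _ (fun s => x * s * x⁻¹) ?_ (fun s hs => hxx s hs.1)
      (fun s hs => hxs s hs.1)
    rintro s ⟨hs, h1, h2⟩
    refine ⟨hEconj x hx s hs, (htwx s hs).2 (by tauto), ?_⟩
    rwa [htwr x hxr]
  -- Where `r` is twisted, conjugation by `x` changes twistedness of `d`.
  have hB1 : Even {s | E s ∧ Twisted t rho s d ∧ Twisted t rho s r}.ncard := by
    have h4 : 4 ∣ {s | E s ∧ Twisted t rho s r}.ncard := by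
      refine four_dvd_ncard (P := Q ⊓ Subgroup.centralizer {r}) (D.isPGroup.to_le inf_le_left) ?_ ?_
      · rintro y ⟨hy, hyr⟩ s ⟨hs, h1⟩
        exact ⟨hEconj y hy s hs,
          (htwr y (Subgroup.mem_centralizer_singleton_iff.1 hyr) s).2 h1⟩
      · rintro s ⟨hs, -⟩
        obtain ⟨y, hy, hpy⟩ := D.pi_surj (om • v0)
        refine ⟨x, ⟨hx, Subgroup.mem_centralizer_singleton_iff.2 hxr⟩, y,
          ⟨hy, Subgroup.mem_centralizer_singleton_iff.2 (hcr v0 hv0w0 y hy hpy)⟩,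
          hmove w0 hw0s hw0n x hx hpx s hs, hmove v0 sig_v0 v0_ne_zero y hy hpy s hs,
          hmove (w0 + v0) ?_ ?_ _ (mul_mem (inv_mem hx) hy) ?_ s hs⟩
        · rw [← hr, hadd, hr, hr, hw0s, sig_v0]
        · intro h
          have := congrFun h 2
          simp [hw0, v0] at this
        · rw [D.pi_mul _ (inv_mem hx) _ hy, D.pi_inv hx, hpx, hpy, smul_add]
    have e1 : {s | E s ∧ ¬ Twisted t rho s d ∧ Twisted t rho s r} =
        (fun s => x * s * x⁻¹) '' {s | E s ∧ Twisted t rho s d ∧ Twisted t rho s r} := by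
      ext s
      constructor
      · rintro ⟨hs, h1, h2⟩
        exact ⟨x * s * x⁻¹, ⟨hEconj x hx s hs, (htwx s hs).2 (by tauto), (htwr x hxr s).2 h2⟩,
          hxx s hs⟩
      · rintro ⟨u, ⟨hu, h1, h2⟩, rfl⟩
        exact ⟨hEconj x hx u hu, by
          have := htwx u hu
          tauto, (htwr x hxr u).2 h2⟩
    have e2 : {s | E s ∧ Twisted t rho s r} =
        {s | E s ∧ Twisted t rho s d ∧ Twisted t rho s r} ∪
        {s | E s ∧ ¬ Twisted t rho s d ∧ Twisted t rho s r} := by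
      ext s
      simp only [Set.mem_ofPred_eq, Set.mem_union]
      tauto
    have hinj : Function.Injective (fun s => x * s * x⁻¹) := (MulAut.conj x).injective
    rw [e2, Set.ncard_union_eq (by
      rw [Set.disjoint_left]
      rintro s ⟨-, h1, -⟩ ⟨-, h2, -⟩
      exact h2 h1), e1, Set.ncard_image_of_injective _ hinj] at h4
    obtain ⟨k, hk⟩ := h4
    exact ⟨k, by omega⟩
  have e : {s | ((∃ g, s = g * t * g⁻¹) ∧ s * d = d * s ∧ Twisted t rho s d) ∧
      s * d⁻¹ ∈ Q ⊓ Subgroup.centralizer {d}} =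
      {s | E s ∧ Twisted t rho s d ∧ ¬ Twisted t rho s r} ∪
      {s | E s ∧ Twisted t rho s d ∧ Twisted t rho s r} := by
    ext s
    simp only [Set.mem_ofPred_eq, Set.mem_union]
    constructor
    · rintro ⟨⟨h1, -, h2⟩, h3⟩
      have : E s := ⟨h1, h3⟩
      tauto
    · have := hEd s
      rintro (⟨h1, h2, -⟩ | ⟨h1, h2, -⟩) <;> exact ⟨⟨h1.1, this h1, h2⟩, h1.2⟩
  rw [e, Set.ncard_union_eq (by
    rw [Set.disjoint_left]
    rintro s ⟨-, -, h1⟩ ⟨-, -, h2⟩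
    exact h1 h2)]
  exact hB0.add hB1

/-- The element `d` is twisted at an odd number of the conjugates of `t` commuting with it. Modulo
`2` only those fixed by the `2`-group `Q ∩ C(d)` count. These are `t` itself and others in `Q ∩
C(d)` or its coset of `d`, which are even in number. -/
theorem odd_ncard_twisted [Finite G] {d : G} (hd : d ∈ C(t)) (hr : ∀ v, rho d v = sig v)
    (hd2 : d * d = 1 ∨ d * d = t) :
    Odd {s | (∃ g, s = g * t * g⁻¹) ∧ s * d = d * s ∧ Twisted t rho s d}.ncard := by
  set N := {s | (∃ g, s = g * t * g⁻¹) ∧ s * d = d * s ∧ Twisted t rho s d} with hN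
  have hdl := D.not_isLin_of_sig hd hr
  have hAd : ∀ a ∈ Q ⊓ Subgroup.centralizer {d}, a * d = d * a := fun a ha =>
    Subgroup.mem_centralizer_singleton_iff.1 ha.2
  have hAA := fun {a b : G} => D.commute_of_mem_inf hd hr hd2 (a := a) (b := b)
  have h1 := ncard_modEq_fixed (P := Q ⊓ Subgroup.centralizer {d}) (N := N)
    (D.isPGroup.to_le inf_le_left) (by
    rintro a ha s ⟨⟨g, rfl⟩, h1, h2⟩
    have had := hAd a ha
    refine ⟨⟨a * g, by group⟩, ?_, ?_⟩
    · exact Subgroup.mem_centralizer_singleton_iff.1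
        (mul_mem (mul_mem ha.2 (Subgroup.mem_centralizer_singleton_iff.2 h1)) (inv_mem ha.2))
    · rwa [twisted_conj_iff, mul_assoc a⁻¹, ← had, inv_mul_cancel_left])
  have e : {s | s ∈ N ∧ ∀ a ∈ Q ⊓ Subgroup.centralizer {d}, a * s = s * a} =
      insert t {s | s ∈ N ∧ s ∈ Q ∧ s ≠ t} ∪
        {s | s ∈ N ∧ s * d⁻¹ ∈ Q ⊓ Subgroup.centralizer {d}} := by
    ext s
    simp only [Set.mem_ofPred_eq, Set.mem_union, Set.mem_insert_iff]
    constructor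
    · rintro ⟨hs, h⟩
      have hs2 : s * s = 1 := by
        obtain ⟨⟨g, rfl⟩, -⟩ := hs
        calc g * t * g⁻¹ * (g * t * g⁻¹) = g * (t * t) * g⁻¹ := by group
          _ = 1 := by rw [D.t_sq]; group
      rcases D.mem_or_mem_of_forall_commute hd hr hd2 hs2 hs.2.1 h with h3 | h3
      · by_cases hst : s = t
        · exact .inl (.inl hst)
        · exact .inl (.inr ⟨hs, h3.1, hst⟩)
      · exact .inr ⟨hs, h3⟩
    · rintro ((rfl | ⟨hs, hsQ, -⟩) | ⟨hs, hsA⟩)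
      · exact ⟨⟨⟨1, by group⟩, (mul_comm_of_mem hd).symm, (D.twisted_self hd).2 hdl⟩,
          fun a ha => mul_comm_of_mem (D.le ha.1)⟩
      · exact ⟨hs, fun a ha => hAA ha ⟨hsQ, Subgroup.mem_centralizer_singleton_iff.2 hs.2.1⟩⟩
      · refine ⟨hs, fun a ha => ?_⟩
        have h2 := hAA ha hsA
        have h3 := hAd a ha
        calc a * s = a * (s * d⁻¹) * d := by group
          _ = s * d⁻¹ * (a * d) := by rw [h2]; group
          _ = s * a := by rw [h3]; group
  rw [e, Set.ncard_union_eq, Set.ncard_insert_of_notMem (fun h => h.2.2 rfl)] at h1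
  · have h2 : Even {s | s ∈ N ∧ s ∈ Q ∧ s ≠ t}.ncard := D.even_ncard_twisted_inf hd
    have h3 : Even {s | s ∈ N ∧ s * d⁻¹ ∈ Q ⊓ Subgroup.centralizer {d}}.ncard :=
      D.even_ncard_twisted_coset hd hr hd2
    have h4 := (h2.add_one).add_even h3
    rw [Nat.odd_iff] at h4 ⊢
    rw [← h4]
    exact h1
  · have hdQ : d ∉ Q := fun h => hdl (D.isLin_of_mem h)
    rw [Set.disjoint_left]
    rintro s h ⟨-, hs2⟩
    have hsQ : s ∈ Q := by
      rcases h with rfl | h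
      exacts [D.t_mem, h.2.1]
    apply hdQ
    have := Q.mul_mem (Q.inv_mem hs2.1) hsQ
    rwa [show (s * d⁻¹)⁻¹ * s = d by group] at this

end LocalData


/-! ### The transfer of a sign character -/

section Transfer

variable {G : Type*} [Group G] {H : Subgroup G} {φ : H →* ℤˣ} {P : G → Prop}

theorem sign_conj_iff (hP : ∀ y (hy : y ∈ H), P y ↔ φ ⟨y, hy⟩ = -1) {y h : G} (hy : y ∈ H)
    (hh : h ∈ H) : P (h⁻¹ * y * h) ↔ P y := by
  rw [hP _ (mul_mem (mul_mem (inv_mem hh) hy) hh), hP y hy]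
  have : (⟨h⁻¹ * y * h, mul_mem (mul_mem (inv_mem hh) hy) hh⟩ : H) =
    (⟨h, hh⟩ : H)⁻¹ * ⟨y, hy⟩ * ⟨h, hh⟩ := rfl
  rw [this, map_mul, map_mul, map_inv, mul_comm (φ ⟨h, hh⟩)⁻¹, inv_mul_cancel_right]

/-- The transfer of a sign character at an element `d` with `d ^ 4 = 1`, in terms of the numbers of
cosets in the orbits of length one and two of `d` that contribute a sign. -/
theorem exists_transfer_eq_neg_one_pow [Finite G] (hP : ∀ y (hy : y ∈ H), P y ↔ φ ⟨y, hy⟩ = -1)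
    (d : G) (hd : d ^ 4 = 1) : ∃ b,
      {x : G ⧸ H | Function.minimalPeriod (d • ·) x = 2 ∧
        P (x.out⁻¹ * d ^ 2 * x.out)}.ncard = 2 * b ∧
      φ.transfer d = (-1) ^
        ({x : G ⧸ H | Function.minimalPeriod (d • ·) x = 1 ∧
          P (x.out⁻¹ * d * x.out)}.ncard + b) := by
  classical
  let : Fintype (G ⧸ H) := Fintype.ofFinite _
  let per : G ⧸ H → ℕ := fun x => Function.minimalPeriod (d • ·) x
  let W : G ⧸ H → Prop := fun x => P (x.out⁻¹ * d ^ per x * x.out)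
  let Ω := Quotient (MulAction.orbitRel (Subgroup.zpowers d) (G ⧸ H))
  let : Fintype Ω := Fintype.ofFinite _
  let f : G ⧸ H → Ω := fun x => Quotient.mk'' x
  have hmem : ∀ x : G ⧸ H, x.out⁻¹ * d ^ per x * x.out ∈ H := fun x =>
    QuotientGroup.out_conj_pow_minimalPeriod_mem H d x
  have hf : ∀ x, ∃ c ∈ Subgroup.zpowers d, (f x).out = c • x := by
    intro x
    have h : (MulAction.orbitRel (Subgroup.zpowers d) (G ⧸ H)).r (f x).out x :=
      Quotient.exact (Quotient.out_eq (f x))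
    obtain ⟨⟨c, hc⟩, h⟩ := h
    exact ⟨c, hc, h.symm⟩
  have hper : ∀ x, per (f x).out = per x := by
    intro x
    obtain ⟨c, hc, h⟩ := hf x
    rw [h]
    refine Function.minimalPeriod_eq_minimalPeriod_iff.2 fun n => ?_
    have hcd : Commute (d ^ n) c := by
      obtain ⟨k, rfl⟩ := hc
      exact (Commute.refl d).pow_left n |>.zpow_right k
    simp only [Function.IsPeriodicPt, Function.IsFixedPt, smul_iterate]
    rw [← mul_smul, hcd.eq, mul_smul]
    simp
  have hW : ∀ x, W (f x).out ↔ W x := by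
    intro x
    obtain ⟨c, hc, h⟩ := hf x
    have hcd : Commute (d ^ per x) c := by
      obtain ⟨k, rfl⟩ := hc
      exact (Commute.refl d).pow_left _ |>.zpow_right k
    have h1 : (c * x.out)⁻¹ * (f x).out.out ∈ H := by
      rw [← QuotientGroup.eq, QuotientGroup.out_eq', h]
      conv_rhs => rw [← QuotientGroup.out_eq' x]
      rfl
    change P ((f x).out.out⁻¹ * d ^ per (f x).out * (f x).out.out) ↔ P (x.out⁻¹ * d ^ per x * x.out)
    rw [hper, ← sign_conj_iff hP (hmem x) h1]
    have e : d ^ per x = c⁻¹ * d ^ per x * c := by rw [mul_assoc, hcd.eq, inv_mul_cancel_left]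
    conv_rhs => rw [e]
    refine iff_of_eq (congrArg P ?_)
    group
  have hfib : ∀ q : Ω, (Finset.univ.filter fun x => f x = q).card = per q.out := by
    intro q
    rw [show per q.out = _ from MulAction.minimalPeriod_eq_card d q.out, Fintype.card_subtype]
    congr 1
    ext x
    simp only [Finset.mem_filter, Finset.mem_univ, true_and]
    conv_lhs => rw [← Quotient.out_eq q]
    exact Quotient.eq''
  have hcount : ∀ j, {x | per x = j ∧ W x}.ncard =
      j * (Finset.univ.filter fun q : Ω => per q.out = j ∧ W q.out).card := by
    intro j
    have e : {x | per x = j ∧ W x} = (Finset.univ.filter fun x => per x = j ∧ W x : Finset _) := by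
      ext x; simp
    rw [e, Set.ncard_coe_finset, Finset.card_eq_sum_card_fiberwise (f := f)
      (t := Finset.univ.filter fun q : Ω => per q.out = j ∧ W q.out) (by
        intro x hx
        simp only [Finset.coe_filter, Finset.mem_univ, true_and, Set.mem_ofPred_eq] at hx ⊢
        rwa [hper, hW]), mul_comm]
    refine Finset.sum_const_nat fun q hq => ?_
    simp only [Finset.mem_filter, Finset.mem_univ, true_and] at hq
    refine Eq.trans ?_ ((hfib q).trans hq.1)
    congr 1
    ext x
    simp only [Finset.mem_filter, Finset.mem_univ, true_and, and_iff_right_iff_imp]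
    rintro rfl
    rwa [hper, hW] at hq
  have e1 : {x : G ⧸ H | Function.minimalPeriod (d • ·) x = 1 ∧ P (x.out⁻¹ * d * x.out)} =
      {x | per x = 1 ∧ W x} := by
    ext x
    refine and_congr_right fun h => ?_
    change _ ↔ P (x.out⁻¹ * d ^ Function.minimalPeriod (d • ·) x * x.out)
    rw [h, pow_one]
  have e2 : {x : G ⧸ H | Function.minimalPeriod (d • ·) x = 2 ∧ P (x.out⁻¹ * d ^ 2 * x.out)} =
      {x | per x = 2 ∧ W x} := by
    ext x
    refine and_congr_right fun h => ?_
    change _ ↔ P (x.out⁻¹ * d ^ Function.minimalPeriod (d • ·) x * x.out)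
    rw [h]
  refine ⟨_, by rw [e2, hcount 2], ?_⟩
  have hterm : ∀ q : Ω, φ ⟨q.out.out⁻¹ * d ^ Function.minimalPeriod (d • ·) q.out * q.out.out,
      QuotientGroup.out_conj_pow_minimalPeriod_mem H d q.out⟩ = if W q.out then -1 else 1 := by
    intro q
    split_ifs with h
    · exact (hP _ (hmem q.out)).1 h
    · exact (Int.units_eq_one_or _).resolve_right fun h1 => h ((hP _ (hmem q.out)).2 h1)
  rw [MonoidHom.transfer_eq_prod_quotient_orbitRel_zpowers_quot, Finset.prod_congr rfl
    fun q _ => hterm q, Finset.prod_ite, Finset.prod_const, Finset.prod_const_one, mul_one, e1,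
    hcount 1, one_mul, ← Finset.card_union_of_disjoint]
  · congr 2
    ext q
    simp only [Finset.mem_filter, Finset.mem_univ, true_and, Finset.mem_union]
    constructor
    · intro h
      have hdvd : per q.out ∣ 4 := by
        refine Function.IsPeriodicPt.minimalPeriod_dvd ?_
        simp only [Function.IsPeriodicPt, Function.IsFixedPt, smul_iterate, hd, one_smul]
      have h4 : per q.out ≠ 4 := by
        intro h4
        have h1 := (hP _ (hmem q.out)).1 h
        have h2 : (⟨q.out.out⁻¹ * d ^ per q.out * q.out.out, hmem q.out⟩ : H) = 1 :=
          Subtype.ext (by simp [h4, hd])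
        rw [h2, map_one] at h1
        exact absurd h1 (by decide)
      have hle := Nat.le_of_dvd (by norm_num) hdvd
      interval_cases h5 : per q.out
      · simp at hdvd
      · exact .inl ⟨rfl, h⟩
      · exact .inr ⟨rfl, h⟩
      · norm_num at hdvd
      · exact absurd rfl h4
    · rintro (h | h) <;> exact h.2
  · rw [Finset.disjoint_filter]
    rintro q - ⟨h1, -⟩ ⟨h2, -⟩
    omega

/-- The conjugates of `t` correspond to the cosets of its centralizer. -/
theorem ncard_coset_eq_ncard_conj [Finite G] (t : G) (p : G → G → Prop) :
    {x : G ⧸ Subgroup.centralizer {t} | p (x.out * t * x.out⁻¹) x.out}.ncard =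
      {s | ∃ x : G ⧸ Subgroup.centralizer {t}, s = x.out * t * x.out⁻¹ ∧ p s x.out}.ncard := by
  have hinj : Function.Injective
      (fun x : G ⧸ Subgroup.centralizer {t} => x.out * t * x.out⁻¹) := by
    intro x y h
    have h1 : x.out * t * x.out⁻¹ = y.out * t * y.out⁻¹ := h
    rw [← QuotientGroup.out_eq' x, ← QuotientGroup.out_eq' y, QuotientGroup.eq,
      Subgroup.mem_centralizer_singleton_iff]
    calc x.out⁻¹ * y.out * t = x.out⁻¹ * (y.out * t * y.out⁻¹) * y.out := by group
      _ = t * (x.out⁻¹ * y.out) := by rw [← h1]; group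
  rw [← Set.ncard_image_of_injective _ hinj]
  congr 1
  ext s
  constructor
  · rintro ⟨x, hx, rfl⟩
    exact ⟨x, rfl, hx⟩
  · rintro ⟨x, rfl, hx⟩
    exact ⟨x, hx, rfl⟩

end Transfer


/-! ### The subgroup of index two -/

theorem commute_iff_smul_eq {G : Type*} [Group G] (t d : G) (x : G ⧸ Subgroup.centralizer {t}) :
    x.out * t * x.out⁻¹ * d = d * (x.out * t * x.out⁻¹) ↔ d • x = x := by
  have e : d • x = ((d * x.out : G) : G ⧸ Subgroup.centralizer {t}) := by
    conv_lhs => rw [← QuotientGroup.out_eq' x]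
    rfl
  have e2 : (x = ((d * x.out : G) : G ⧸ Subgroup.centralizer {t})) =
      ((x.out : G ⧸ Subgroup.centralizer {t}) = ((d * x.out : G) : G ⧸ Subgroup.centralizer {t})) := by
    rw [QuotientGroup.out_eq']
  rw [e, eq_comm (b := x), e2, QuotientGroup.eq, Subgroup.mem_centralizer_singleton_iff]
  generalize x.out = g
  rw [show g⁻¹ * (d * g) * t = g⁻¹ * (d * (g * t * g⁻¹)) * g by group,
    show t * (g⁻¹ * (d * g)) = g⁻¹ * (g * t * g⁻¹ * d) * g by group]
  simp [eq_comm]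

namespace LocalData

variable {G : Type*} [Group G] {t : G} {Q : Subgroup G} {pi : G → V4} {rho : G → V4 → V4}
  (D : LocalData t Q pi rho)
include D

local notation "C(" t ")" => Subgroup.centralizer {t}

/-- The sign character of the centralizer of `t` that separates linear and semilinear elements. -/
theorem exists_sign : ∃ φ : C(t) →* ℤˣ, ∀ y (hy : y ∈ C(t)), ¬ IsLin (rho y) ↔ φ ⟨y, hy⟩ = -1 := by
  classical
  refine ⟨MonoidHom.mk' (fun y => if IsLin (rho y) then 1 else -1) ?_, ?_⟩
  · rintro ⟨g, hg⟩ ⟨h, hh⟩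
    have := D.isLin_mul hg hh
    simp only [MulMemClass.mk_mul_mk]
    by_cases h1 : IsLin (rho g) <;> by_cases h2 : IsLin (rho h) <;> simp [this, h1, h2]
  · intro y hy
    by_cases h : IsLin (rho y)
    · simp only [MonoidHom.mk'_apply, h, not_true, if_true, false_iff]
      decide
    · simp [h]

/-- The square of an element acting as `sig` is fixed by it modulo `⟨t⟩`, and every vector fixed by
`sig` has the form `v + sig v`; so the element can be changed by an element of `Q` to have square in
`⟨t⟩`. -/
theorem exists_sig_sq : ∃ d ∈ C(t), (∀ v, rho d v = sig v) ∧ (d * d = 1 ∨ d * d = t) := by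
  obtain ⟨d, hd, ⟨k, hk⟩, hr⟩ := D.exists_sig
  have hdd : d * d ∈ Q := by
    refine D.mem_of_rho _ (mul_mem hd hd) (fun v => ?_) ⟨k, ?_⟩
    · rw [D.rho_mul hd hd, hr, hr, sig_sig]
    · rw [(Commute.refl d).mul_pow, hk, one_mul]
  have hw : sig (pi (d * d)) = pi (d * d) := by
    rw [← hr, D.rho_pi d hd _ hdd]
    congr 1; group
  obtain ⟨x, hx, hpx⟩ := D.pi_surj (om • pi (d * d))
  have hx' := D.normal d hd x hx
  refine ⟨x * d, mul_mem (D.le hx) hd, fun v => ?_, ?_⟩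
  · rw [D.rho_mul (D.le hx) hd, D.rho_of_mem hx, hr]
  · rw [show x * d * (x * d) = x * (d * x * d⁻¹) * (d * d) by group]
    refine D.pi_eq_zero _ (mul_mem (mul_mem hx hx') hdd) ?_
    rw [D.pi_mul _ (mul_mem hx hx') _ hdd, D.pi_mul x hx _ hx', ← D.rho_pi d hd x hx, hpx, hr,
      sig_smul, hw, ← add_smul]
    have : om + star om = 1 := tr4_om
    rw [this, one_smul, V4.add_self]

theorem exists_out_iff (s y : G) :
    (∃ x : G ⧸ C(t), s = x.out * t * x.out⁻¹ ∧ s * y = y * s ∧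
        ¬ IsLin (rho (x.out⁻¹ * y * x.out))) ↔
      (∃ g, s = g * t * g⁻¹) ∧ s * y = y * s ∧ Twisted t rho s y := by
  constructor
  · rintro ⟨x, h, h1, h2⟩
    exact ⟨⟨_, h⟩, h1, x.out, h, h2⟩
  · rintro ⟨⟨g, h⟩, h1, h2⟩
    obtain ⟨c, hc⟩ := QuotientGroup.mk_out_eq_mul C(t) g
    have e : s = (g : G ⧸ C(t)).out * t * (g : G ⧸ C(t)).out⁻¹ := by
      rw [h, hc]
      calc g * t * g⁻¹ = g * (t * c) * (c : G)⁻¹ * g⁻¹ := by group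
        _ = g * c * t * (g * c)⁻¹ := by rw [← mul_comm_of_mem c.2]; group
    refine ⟨g, e, h1, ?_⟩
    rw [e] at h1 h2
    exact (D.twisted_iff h1.symm).1 h2

/-- The transfer of the sign character to `G` is nontrivial at an element acting as `sig`. -/
theorem exists_index_two [Finite G] : ∃ N : Subgroup G, N.index = 2 := by
  obtain ⟨φ, hφ⟩ := D.exists_sign
  obtain ⟨d, hd, hr, hd2⟩ := D.exists_sig_sq
  have hd4 : d ^ 4 = 1 := by
    have p4 : d ^ 4 = d * d * (d * d) := by simp [pow_succ, mul_assoc]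
    rw [p4]
    rcases hd2 with h | h <;> rw [h]
    · simp
    · exact D.t_sq
  obtain ⟨b, hb, htr⟩ := exists_transfer_eq_neg_one_pow hφ d hd4
  have h1 : {x : G ⧸ C(t) | Function.minimalPeriod (d • ·) x = 1 ∧
      ¬ IsLin (rho (x.out⁻¹ * d * x.out))}.ncard =
      {s | (∃ g, s = g * t * g⁻¹) ∧ s * d = d * s ∧ Twisted t rho s d}.ncard := by
    have := ncard_coset_eq_ncard_conj t (fun s g => s * d = d * s ∧ ¬ IsLin (rho (g⁻¹ * d * g)))
    simp only [commute_iff_smul_eq] at this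
    simp only [Function.minimalPeriod_eq_one_iff_isFixedPt, Function.IsFixedPt]
    rw [this]
    congr 1
    ext s
    exact D.exists_out_iff s d
  have h2 : Even b := by
    have hdd : d ^ 2 = d * d := pow_two d
    rcases hd2 with h | h
    · -- An involution contributes no sign at its orbits of length two.
      have e : {x : G ⧸ C(t) | Function.minimalPeriod (d • ·) x = 2 ∧
          ¬ IsLin (rho (x.out⁻¹ * d ^ 2 * x.out))} = ∅ := by
        refine Set.eq_empty_of_forall_notMem fun x hx => hx.2 ?_
        rw [hdd, h, mul_one, inv_mul_cancel]
        exact D.isLin_of_mem Q.one_mem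
      rw [e, Set.ncard_empty] at hb
      have : b = 0 := by omega
      rw [this]
      exact Even.zero
    · have e : {x : G ⧸ C(t) | Function.minimalPeriod (d • ·) x = 2 ∧
          ¬ IsLin (rho (x.out⁻¹ * d ^ 2 * x.out))} =
          {x : G ⧸ C(t) | x.out * t * x.out⁻¹ * t = t * (x.out * t * x.out⁻¹) ∧
            ¬ IsLin (rho (x.out⁻¹ * t * x.out))} := by
        ext x
        rw [hdd, h]
        refine and_congr_left fun hx => ?_
        have hper : t • x = x ↔ Function.IsPeriodicPt (d • ·) 2 x := by
          simp only [Function.IsPeriodicPt, Function.IsFixedPt, smul_iterate]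
          rw [hdd, h]
        rw [commute_iff_smul_eq, hper]
        constructor
        · intro h2
          rw [← h2]
          exact Function.isPeriodicPt_minimalPeriod _ _
        · intro h2
          refine ((Nat.dvd_prime Nat.prime_two).1 h2.minimalPeriod_dvd).resolve_left fun h1 => ?_
          -- The square of an element commuting with a conjugate of `t` is not twisted there.
          have h3 := (commute_iff_smul_eq t d x).2
            (Function.minimalPeriod_eq_one_iff_isFixedPt.1 h1)
          have h4 := D.twisted_mul h3.symm h3.symm
          rw [h] at h4
          exact h4.1 ⟨_, rfl, hx⟩ Iff.rfl
      have h3 := D.four_dvd_ncard_twisted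
      have h4 := ncard_coset_eq_ncard_conj t
        (fun s g => s * t = t * s ∧ ¬ IsLin (rho (g⁻¹ * t * g)))
      simp only [D.exists_out_iff] at h4
      rw [← h4, ← e, hb] at h3
      obtain ⟨k, hk⟩ := h3
      exact ⟨k, by omega⟩
  have hneg : φ.transfer d = -1 := by
    rw [htr, h1]
    exact ((D.odd_ncard_twisted hd hr hd2).add_even h2).neg_one_pow
  refine ⟨φ.transfer.ker, ?_⟩
  rw [Subgroup.index_ker]
  have : φ.transfer.range = ⊤ := by
    rw [eq_top_iff]
    rintro u -
    rcases Int.units_eq_one_or u with rfl | rfl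
    exacts [one_mem _, ⟨d, hneg⟩]
  rw [this, Subgroup.card_top]
  simp [Nat.card_eq_fintype_card]

end LocalData


/-! ### Maps and forms compatible with the action of the special unitary group -/

/-- Every vector is a sum of singular vectors. -/
theorem sing_induction {p : V4 → Prop} (hs : ∀ c, herm c c = 0 → p c)
    (hadd : ∀ x y, p x → p y → p (x + y)) (x : V4) : p x := by
  have hom := om_sq
  have h1 : ∀ (i : Fin 4) (a : F4), p (Pi.single i a) := by
    intro i a
    obtain ⟨j, hij⟩ : ∃ j : Fin 4, i ≠ j := ⟨i + 1, by fin_cases i <;> decide⟩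
    have hn : ∀ b : F4, b ≠ 0 → herm (b • Pi.single i 1 + Pi.single j 1)
        (b • Pi.single i 1 + Pi.single j 1) = 0 := by
      intro b hb
      have := F4.mul_star_self hb
      simp [herm_single, hij, hij.symm]
      grind
    have e : (Pi.single i a : V4) = (a * om) • ((1 : F4) • Pi.single i 1 + Pi.single j 1) +
        (a * om) • (om • Pi.single i 1 + Pi.single j 1) := by
      rw [← smul_add, add_add_add_comm, V4.add_self, add_zero, ← add_smul, smul_smul]
      have : a * om * (1 + om) = a := by grind
      rw [this, ← Pi.single_smul, smul_eq_mul, mul_one]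
    rw [e]
    refine hadd _ _ (hs _ ?_) (hs _ ?_) <;> rw [herm_smul_left, herm_smul_right]
    · rw [hn 1 one_ne_zero]; simp
    · rw [hn om om_ne_zero]; simp
  rw [← Finset.univ_sum_single x]
  exact Finset.sum_induction _ p hadd (hs 0 (by simp)) fun i _ => h1 i _

theorem exists_herm_eq_one {v : V4} (hv : v ≠ 0) : ∃ x, herm x v = 1 := by
  obtain ⟨y, hy⟩ := exists_herm_ne_zero hv
  have hy' : herm y v ≠ 0 := by rw [← star_herm]; simpa using hy
  exact ⟨(herm y v)⁻¹ • y, by rw [herm_smul_left, inv_mul_cancel₀ hy']⟩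

/-- The additive maps commuting with the special unitary group are the scalars. -/
theorem exists_smul_of_commute {f : V4 → V4} (hadd : ∀ x y, f (x + y) = f x + f y)
    (hf : ∀ (A : SU42) x, f (A.act x) = A.act (f x)) : ∃ a : F4, ∀ x, f x = a • x := by
  obtain ⟨y, hy⟩ := exists_herm_eq_one v0_ne_zero
  have h1 := hf (tv v0) y
  rw [tv_act v0_sing, tv_act v0_sing, hadd, hy, one_smul] at h1
  have h2 := add_left_cancel h1
  refine ⟨herm (f y) v0, sing_induction (fun c hc => ?_)
    fun x y hx hy => by rw [hadd, hx, hy, smul_add]⟩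
  by_cases h0 : c = 0
  · have : f 0 = 0 := by simpa using hadd 0 0
    rw [h0, this, smul_zero]
  · obtain ⟨A, rfl⟩ := exists_act_sing_eq v0_sing v0_ne_zero hc h0
    rw [hf, h2, SU42.act_smul]

theorem eq_zero_of_invariant {g : V4 → F4} (hadd : ∀ x y, g (x + y) = g x + g y)
    (hg : ∀ (A : SU42) x, g (A.act x) = g x) (x : V4) : g x = 0 := by
  refine sing_induction (p := fun x => g x = 0) (fun c hc => ?_)
    (fun x y hx hy => by rw [hadd, hx, hy, add_zero]) x
  by_cases h0 : c = 0
  · rw [h0]; simpa using hadd 0 0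
  · obtain ⟨y, hy⟩ := exists_herm_eq_one h0
    have := hg (tv c) y
    rw [tv_act hc, hadd, hy, one_smul] at this
    simpa using this

/-- The trace pairing of the field with four elements is perfect. -/
theorem exists_tr4_mul {g : F4 → F4} (hadd : ∀ a b, g (a + b) = g a + g b)
    (h01 : ∀ a, g a = 0 ∨ g a = 1) : ∃ u, ∀ a, g a = tr4 (a * u) := by
  have h0 : g 0 = 0 := by simpa using hadd 0 0
  have hom := om_sq
  have h4 := F4.pow_four om
  refine ⟨g om + g 1 + g 1 * om, fun a => ?_⟩
  have hs : ∀ a, star (g a) = g a := fun a => (F4.fixed_iff _).2 (h01 a)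
  have e : g (om + 1) = g om + g 1 := hadd _ _
  rcases F4.cases a with rfl | rfl | rfl | rfl <;>
    simp only [tr4, star_mul', star_add, hs, star_om, star_zero, star_one, h0, e] <;> grind

/-- Every additive functional with values in the prime field comes from the trace form. -/
theorem exists_tr4_herm {g : V4 → F4} (hadd : ∀ a b, g (a + b) = g a + g b)
    (h01 : ∀ a, g a = 0 ∨ g a = 1) : ∃ u, ∀ x, g x = tr4 (herm x u) := by
  have h0 : g 0 = 0 := by simpa using hadd 0 0
  have h := fun i : Fin 4 => exists_tr4_mul (g := fun a => g (Pi.single i a))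
    (fun a b => by rw [Pi.single_add, hadd]) (fun a => h01 _)
  choose u hu using h
  let gh : V4 →+ F4 := AddMonoidHom.mk' g hadd
  let th : F4 →+ F4 := AddMonoidHom.mk' tr4 tr4_add
  refine ⟨fun i => star (u i), fun x => ?_⟩
  have h1 : gh x = ∑ i, gh (Pi.single i (x i)) := by rw [← map_sum, Finset.univ_sum_single]
  have h2 : th (herm x fun i => star (u i)) = ∑ i, th (x i * u i) := by
    rw [← map_sum]; simp [herm]
  exact h1.trans ((Finset.sum_congr rfl fun i _ => hu i (x i)).trans h2.symm)

/-- The trace of the hermitian form is the only nonzero alternating form over the prime field that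
is invariant under the special unitary group. -/
theorem eq_tr4_herm {β : V4 → V4 → F4} (h01 : ∀ x y, β x y = 0 ∨ β x y = 1)
    (hl : ∀ x x' y, β (x + x') y = β x y + β x' y) (hr : ∀ x y y', β x (y + y') = β x y + β x y')
    (hinv : ∀ (A : SU42) x y, β (A.act x) (A.act y) = β x y) (halt : ∀ x, β x x = 0)
    (hne : ∃ x y, β x y ≠ 0) (x y : V4) : β x y = tr4 (herm x y) := by
  have h := fun y => exists_tr4_herm (g := fun x => β x y) (fun a b => hl a b y) (fun a => h01 a y)
  choose f hf using h
  have uniq : ∀ u v, (∀ x, tr4 (herm x u) = tr4 (herm x v)) → u = v := by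
    intro u v h
    refine V4.eq_of_add_eq_zero (eq_zero_of_herm fun x => ?_)
    rw [← star_herm, herm_add_right, star_eq_zero]
    refine eq_of_tr4_mul fun c => ?_
    have := h (c • x)
    rw [herm_smul_left, herm_smul_left] at this
    rw [mul_add, tr4_add, this, mul_zero, tr4_zero, CharTwo.add_self_eq_zero]
  obtain ⟨a, ha⟩ := exists_smul_of_commute (f := f)
    (fun y y' => uniq _ _ fun x => by
      rw [herm_add_right, tr4_add, ← hf, ← hf, ← hf, hr])
    (fun A y => uniq _ _ fun x => by
      rw [← hf, ← SU42.act_act_inv A x, hinv, SU42.herm_act, hf])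
  have hβ : ∀ x y, β x y = tr4 (star a * herm x y) := fun x y => by
    rw [← herm_smul_right, ← ha]
    exact hf y x
  have h1 := halt (Pi.single 0 1)
  rw [hβ, herm_single, Pi.single_eq_same, mul_one, tr4_star, tr4_eq_zero_iff, F4.fixed_iff] at h1
  rcases h1 with h1 | h1
  · obtain ⟨x, y, hxy⟩ := hne
    rw [hβ, h1, star_zero, zero_mul, tr4_zero] at hxy
    exact absurd rfl hxy
  · rw [hβ, h1, star_one, one_mul]

/-- The hermitian norm is the only quadratic form over the prime field with its polarization that is
invariant under the special unitary group. -/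
theorem eq_herm_self {q : V4 → F4} (hq : ∀ x y, q (x + y) = q x + q y + tr4 (herm x y))
    (hinv : ∀ (A : SU42) x, q (A.act x) = q x) (x : V4) : q x = herm x x := by
  have := eq_zero_of_invariant (g := fun x => q x + herm x x) (fun x y => by
    simp only [hq, herm_add_left, herm_add_right, tr4, star_herm]
    grind) (fun A x => by simp only [hinv, SU42.herm_act]) x
  grind

/-- The additive bijections normalizing the special unitary group are linear or semilinear. -/
theorem linear_or_semilinear {f f' : V4 → V4} (hadd : ∀ x y, f (x + y) = f x + f y)
    (hff : ∀ x, f (f' x) = x) (hff' : ∀ x, f' (f x) = x)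
    (hn : ∀ A : SU42, ∃ B : SU42, ∀ x, f (B.act x) = A.act (f x)) :
    (∀ (a : F4) x, f (a • x) = a • f x) ∨ ∀ (a : F4) x, f (a • x) = star a • f x := by
  have hadd' : ∀ x y, f' (x + y) = f' x + f' y := fun x y => by
    rw [← hff' (f' x + f' y), hadd, hff, hff]
  have h := fun a : F4 => exists_smul_of_commute (f := fun x => f (a • f' x))
    (fun x y => by rw [hadd', smul_add, hadd]) (fun A x => by
      obtain ⟨B, hB⟩ := hn A
      have : f' (A.act x) = B.act (f' x) := by rw [← hff' (B.act (f' x)), hB, hff]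
      rw [this, ← SU42.act_smul, hB])
  choose σ hσ using h
  have hs : ∀ (a : F4) x, f (a • x) = σ a • f x := fun a x => by
    have := hσ a (f x)
    rwa [hff'] at this
  obtain ⟨y, hy⟩ : ∃ y, f y = v0 := ⟨f' v0, hff v0⟩
  have hinj : ∀ a b : F4, a • v0 = b • v0 → a = b := fun a b h =>
    smul_left_injective F4 v0_ne_zero h
  have h1 : σ 1 = 1 := by
    apply hinj
    rw [← hy, ← hs, one_smul, one_smul]
  have hσa : ∀ a b, σ (a + b) = σ a + σ b := by
    intro a b
    apply hinj
    rw [add_smul, ← hy, ← hs, ← hs, ← hs, add_smul, hadd]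
  have hσm : ∀ a b, σ (a * b) = σ a * σ b := by
    intro a b
    apply hinj
    rw [mul_smul, ← hy, ← hs, ← hs, ← hs, mul_smul]
  have h0 : σ 0 = 0 := by simpa using hσa 0 0
  have hom : σ om * σ om = σ om + 1 := by
    rw [← hσm, ← h1, ← hσa, ← pow_two, om_sq]
  have e : σ (om + 1) = σ om + 1 := by rw [hσa, h1]
  have hw := om_sq
  have hcase : σ om = om ∨ σ om = om + 1 := by
    rcases F4.cases (σ om) with h | h | h | h
    · rw [h] at hom; simp at hom
    · rw [h] at hom
      exact absurd hom (by intro h; simp at h)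
    · exact .inl h
    · exact .inr h
  rcases hcase with h | h
  · left
    intro a x
    rw [hs]
    congr 1
    rcases F4.cases a with rfl | rfl | rfl | rfl <;> simp only [h0, h1, h, e]
  · right
    intro a x
    rw [hs]
    congr 1
    rcases F4.cases a with rfl | rfl | rfl | rfl <;>
      simp only [h0, h1, h, e, star_zero, star_one, star_om, star_add]

/-- The field automorphism of the special unitary group. -/
noncomputable def SU42.frob : MulAut SU42 :=
  have hmem : ∀ A : SU42, A.1.map star ∈ Matrix.specialUnitaryGroup (Fin 4) F4 := fun A => by
    have h := Matrix.mem_specialUnitaryGroup_iff.1 A.2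
    rw [Matrix.mem_specialUnitaryGroup_iff, Matrix.mem_unitaryGroup_iff]
    constructor
    · have h1 := congrArg (fun M : Matrix (Fin 4) (Fin 4) F4 => M.map (starRingEnd F4))
        (Matrix.mem_unitaryGroup_iff.1 h.1)
      rw [Matrix.map_mul] at h1
      have h2 : star (A.1.map star) = (star A.1).map (starRingEnd F4) := by
        ext i j; simp only [Matrix.star_apply, Matrix.map_apply, starRingEnd_apply]
      have h3 : (1 : Matrix (Fin 4) (Fin 4) F4).map (starRingEnd F4) = 1 := by simp
      rw [h2, ← h3]
      exact h1
    · have h1 := (starRingEnd F4).map_det A.1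
      rw [h.2, map_one] at h1
      exact h1.symm
  { toFun A := ⟨A.1.map star, hmem A⟩
    invFun A := ⟨A.1.map star, hmem A⟩
    left_inv A := by ext; simp
    right_inv A := by ext; simp
    map_mul' A B := Subtype.ext (Matrix.map_mul (f := starRingEnd F4)) }

theorem SU42.frob_act (A : SU42) (x : V4) : (SU42.frob A).act (star x) = star (A.act x) := by
  ext i
  simp [SU42.frob, SU42.act, Matrix.mulVec, dotProduct]


/-! ### From the natural module to the local structure -/

/-- The identification `pi` of `Q / ⟨t⟩` with the hermitian space makes it the natural module for
`SU₄(2)`, which is embedded in the quotient of the centralizer of `t` by `Q` with representatives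
`lift`, as a normal subgroup on which the field automorphism is induced. -/
structure NaturalData {G : Type*} [Group G] (t : G) (Q : Subgroup G) (pi : G → V4)
    (lift : SU42 → G) : Prop extends VectorQuotient t Q pi where
  exists_not_commute : ∃ x ∈ Q, ∃ y ∈ Q, x * y ≠ y * x
  lift_mem : ∀ A, lift A ∈ Subgroup.centralizer {t}
  pi_lift : ∀ A, ∀ x ∈ Q, pi (lift A * x * (lift A)⁻¹) = A.act (pi x)
  lift_conj : ∀ h ∈ Subgroup.centralizer {t}, ∀ A, ∃ B, ∃ q ∈ Q, h * lift A * h⁻¹ = lift B * q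
  exists_frob : ∃ h ∈ Subgroup.centralizer {t}, ∀ A, ∃ q ∈ Q,
    h * lift A * h⁻¹ = lift (SU42.frob A) * q
  mem_of_commute : ∀ h ∈ Subgroup.centralizer {t},
    (∀ A, ∃ q ∈ Q, h * lift A * h⁻¹ = lift A * q) → (∃ k, h ^ 2 ^ k = 1) → h ∈ Q

namespace NaturalData

variable {G : Type*} [Group G] {t : G} {Q : Subgroup G} {pi : G → V4} {lift : SU42 → G}
  (D : NaturalData t Q pi lift)
include D

local notation "C(" t ")" => Subgroup.centralizer {t}

/-- The commutator of two elements of `Q`, as a value in the prime field, determined by images. -/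
theorem exists_commutator_form : ∃ β : V4 → V4 → F4, (∀ v w, β v w = 0 ∨ β v w = 1) ∧
    ∀ x ∈ Q, ∀ y ∈ Q, (x * y = y * x ↔ β (pi x) (pi y) = 0) := by
  classical
  choose s hs hps using D.pi_surj
  refine ⟨fun v w => if s v * s w = s w * s v then 0 else 1, fun v w => ?_, fun x hx y hy => ?_⟩
  · dsimp only
    split_ifs <;> simp
  · have key : ∀ x ∈ Q, ∀ y ∈ Q, ∀ x' ∈ Q, pi x = pi x' → (x * y = y * x ↔ x' * y = y * x') := by
      intro x hx y hy x' hx' h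
      have hy' := mul_comm_of_mem (D.le hy)
      rcases (D.pi_eq_iff hx hx').1 h with rfl | rfl
      · rfl
      · rw [mul_assoc, ← hy', ← mul_assoc, ← mul_assoc, mul_left_inj]
    have h1 := key x hx y hy _ (hs (pi x)) (hps _).symm
    have h2 := key y hy _ (hs (pi x)) _ (hs (pi y)) (hps _).symm
    rw [h1, eq_comm, h2, eq_comm]
    simp

theorem commute_iff {x y : G} (hx : x ∈ Q) (hy : y ∈ Q) :
    x * y = y * x ↔ tr4 (herm (pi x) (pi y)) = 0 := by
  obtain ⟨β, h01, hβ⟩ := D.exists_commutator_form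
  have hne : ∀ x ∈ Q, ∀ y ∈ Q, x * y * x⁻¹ = y * t → β (pi x) (pi y) = 1 := by
    intro x hx y hy h
    refine (h01 _ _).resolve_left fun h0 => ?_
    rw [← hβ x hx y hy] at h0
    rw [h0, mul_inv_cancel_right] at h
    exact D.t_ne (by simpa using h.symm)
  have heq : ∀ x ∈ Q, ∀ y ∈ Q, x * y * x⁻¹ = y → β (pi x) (pi y) = 0 := by
    intro x hx y hy h
    rw [← hβ x hx y hy]
    exact conj_eq_iff.1 h
  have hl : ∀ v v' w, β (v + v') w = β v w + β v' w := by
    intro v v' w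
    obtain ⟨x, hx, rfl⟩ := D.pi_surj v
    obtain ⟨x', hx', rfl⟩ := D.pi_surj v'
    obtain ⟨y, hy, rfl⟩ := D.pi_surj w
    rw [← D.pi_mul x hx x' hx']
    have e : x * x' * y * (x * x')⁻¹ = x * (x' * y * x'⁻¹) * x⁻¹ := by group
    have et : x * (y * t) * x⁻¹ = x * y * x⁻¹ * t := by
      have := mul_comm_of_mem (inv_mem (D.le hx))
      calc x * (y * t) * x⁻¹ = x * y * (t * x⁻¹) := by group
        _ = x * y * x⁻¹ * t := by rw [← this]; group
    rcases D.conj_eq_or hx hy with h | h <;> rcases D.conj_eq_or hx' hy with h' | h'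
    · rw [heq x hx y hy h, heq x' hx' y hy h', add_zero]
      exact heq _ (mul_mem hx hx') y hy (by rw [e, h', h])
    · rw [heq x hx y hy h, hne x' hx' y hy h', zero_add]
      exact hne _ (mul_mem hx hx') y hy (by rw [e, h', et, h])
    · rw [hne x hx y hy h, heq x' hx' y hy h', add_zero]
      exact hne _ (mul_mem hx hx') y hy (by rw [e, h', h])
    · rw [hne x hx y hy h, hne x' hx' y hy h', CharTwo.add_self_eq_zero]
      exact heq _ (mul_mem hx hx') y hy (by rw [e, h', et, h, mul_assoc, D.t_sq, mul_one])
  have eq_of_iff : ∀ v w v' w', (β v w = 0 ↔ β v' w' = 0) → β v w = β v' w' := by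
    intro v w v' w' h
    rcases h01 v w with h1 | h1 <;> rcases h01 v' w' with h2 | h2 <;> simp_all
  have hsymm : ∀ v w, β v w = β w v := by
    intro v w
    refine eq_of_iff _ _ _ _ ?_
    obtain ⟨x, hx, rfl⟩ := D.pi_surj v
    obtain ⟨y, hy, rfl⟩ := D.pi_surj w
    rw [← hβ x hx y hy, ← hβ y hy x hx, eq_comm]
  rw [hβ x hx y hy, eq_tr4_herm (β := β) h01 hl ?_ ?_ ?_ ?_]
  · intro v w w'
    rw [hsymm, hl, hsymm w, hsymm w']
  · intro A v w
    refine eq_of_iff _ _ _ _ ?_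
    obtain ⟨x, hx, rfl⟩ := D.pi_surj v
    obtain ⟨y, hy, rfl⟩ := D.pi_surj w
    rw [← D.pi_lift A x hx, ← D.pi_lift A y hy, ← hβ x hx y hy,
      ← hβ _ (D.normal _ (D.lift_mem A) x hx) _ (D.normal _ (D.lift_mem A) y hy)]
    generalize lift A = g
    rw [show g * x * g⁻¹ * (g * y * g⁻¹) = g * (x * y) * g⁻¹ by group,
      show g * y * g⁻¹ * (g * x * g⁻¹) = g * (y * x) * g⁻¹ by group]
    simp
  · intro v
    obtain ⟨x, hx, rfl⟩ := D.pi_surj v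
    exact (hβ x hx x hx).1 rfl
  · obtain ⟨x, hx, y, hy, h⟩ := D.exists_not_commute
    exact ⟨pi x, pi y, fun h0 => h ((hβ x hx y hy).2 h0)⟩

theorem sq_iff {x : G} (hx : x ∈ Q) : x * x = 1 ↔ herm (pi x) (pi x) = 0 := by
  classical
  choose s hs hps using D.pi_surj
  let q : V4 → F4 := fun v => if s v * s v = 1 then 0 else 1
  have sqt : ∀ y ∈ Q, y * t * (y * t) = y * y := by
    intro y hy
    have := mul_comm_of_mem (D.le hy)
    calc y * t * (y * t) = y * (t * y) * t := by group
      _ = y * y * (t * t) := by rw [← this]; group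
      _ = y * y := by rw [D.t_sq, mul_one]
  have hq : ∀ y ∈ Q, q (pi y) = if y * y = 1 then 0 else 1 := by
    intro y hy
    have : s (pi y) * s (pi y) = y * y := by
      rcases (D.pi_eq_iff (hs (pi y)) hy).1 (hps _) with h | h <;> rw [h]
      exact sqt y hy
    simp only [q, this]
  have h1 := eq_herm_self (q := q) (fun v w => by
    obtain ⟨a, ha, rfl⟩ := D.pi_surj v
    obtain ⟨b, hb, rfl⟩ := D.pi_surj w
    rw [← D.pi_mul a ha b hb, hq _ (mul_mem ha hb), hq a ha, hq b hb]
    have hc := D.commute_iff hb ha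
    rw [tr4_herm_comm] at hc
    have e : a * b * (a * b) = a * (b * a * b⁻¹) * (b * b) := by group
    have hat := mul_comm_of_mem (D.le ha)
    have htne := D.t_ne
    have htt := D.t_sq
    rw [e]
    rcases D.conj_eq_or hb ha with h | h
    · rw [hc.1 (conj_eq_iff.1 h), h]
      rcases D.sq_mem ha with h1 | h1 <;> rcases D.sq_mem hb with h2 | h2 <;>
        simp [h1, h2, htt, htne, CharTwo.add_self_eq_zero]
    · have h0 : tr4 (herm (pi a) (pi b)) = 1 := by
        refine (tr4_eq_zero_or_one _).resolve_left fun h0 => ?_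
        have := hc.2 h0
        rw [this, mul_inv_cancel_right] at h
        exact D.t_ne (by simpa using h.symm)
      rw [h0, h, ← mul_assoc a a t]
      rcases D.sq_mem ha with h1 | h1 <;> rcases D.sq_mem hb with h2 | h2 <;>
        simp [h1, h2, htt, htne, CharTwo.add_self_eq_zero]) (fun A v => by
    obtain ⟨a, ha, rfl⟩ := D.pi_surj v
    rw [← D.pi_lift A a ha, hq a ha, hq _ (D.normal _ (D.lift_mem A) a ha)]
    generalize lift A = g
    rw [show g * a * g⁻¹ * (g * a * g⁻¹) = g * (a * a) * g⁻¹ by group]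
    simp) (pi x)
  rw [← h1, hq x hx]
  split_ifs with h <;> simp [h]

theorem exists_action :
    ∃ rho : G → V4 → V4, ∀ h ∈ C(t), ∀ x ∈ Q, rho h (pi x) = pi (h * x * h⁻¹) := by
  choose s hs hps using D.pi_surj
  refine ⟨fun h v => pi (h * s v * h⁻¹), fun h hh x hx => ?_⟩
  rcases (D.pi_eq_iff (hs (pi x)) hx).1 (hps _) with e | e
  · simp only [e]
  · have e2 : h * s (pi x) * h⁻¹ = h * x * h⁻¹ * t := by
      rw [e]
      calc h * (x * t) * h⁻¹ = h * x * (t * h⁻¹) := by group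
        _ = h * x * h⁻¹ * t := by rw [← mul_comm_of_mem (inv_mem hh)]; group
    simp only [e2]
    rw [D.pi_mul _ (D.normal h hh x hx) t D.t_mem, D.pi_t, add_zero]

theorem smul {a : F4} (ha : a ≠ 0) : NaturalData t Q (fun x => a • pi x) lift :=
  { D with
    pi_mul := fun x hx y hy => by rw [D.pi_mul x hx y hy, smul_add]
    pi_surj := fun v => by
      obtain ⟨x, hx, h⟩ := D.pi_surj (a⁻¹ • v)
      exact ⟨x, hx, by rw [h, smul_inv_smul₀ ha]⟩
    pi_eq_zero := fun x hx h => D.pi_eq_zero x hx ((smul_eq_zero.1 h).resolve_left ha)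
    pi_t := by rw [D.pi_t, smul_zero]
    pi_lift := fun A x hx => by rw [D.pi_lift A x hx, SU42.act_smul] }

/-- By Schur's lemma, an element inducing the field automorphism acts as a multiple of the
coordinatewise conjugation. -/
theorem exists_smul_star : ∃ a : F4, a ≠ 0 ∧ ∃ h ∈ C(t), ∀ x ∈ Q,
    pi (h * x * h⁻¹) = a • star (pi x) := by
  obtain ⟨h, hh, hF⟩ := D.exists_frob
  obtain ⟨rho, hrho⟩ := D.exists_action
  have hadd : ∀ v w, rho h (v + w) = rho h v + rho h w := by
    intro v w
    obtain ⟨x, hx, rfl⟩ := D.pi_surj v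
    obtain ⟨y, hy, rfl⟩ := D.pi_surj w
    rw [← D.pi_mul x hx y hy, hrho h hh _ (mul_mem hx hy), hrho h hh x hx, hrho h hh y hy,
      ← D.pi_mul _ (D.normal h hh x hx) _ (D.normal h hh y hy)]
    congr 1; group
  have hact : ∀ (A : SU42) v, rho h (A.act v) = (SU42.frob A).act (rho h v) := by
    intro A v
    obtain ⟨x, hx, rfl⟩ := D.pi_surj v
    obtain ⟨q, hq, e⟩ := hF A
    have hhx := D.normal h hh x hx
    have hqx := D.normal q (D.le hq) _ hhx
    have e2 : h * (lift A * x * (lift A)⁻¹) * h⁻¹ =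
        lift (SU42.frob A) * (q * (h * x * h⁻¹) * q⁻¹) * (lift (SU42.frob A))⁻¹ := by
      calc h * (lift A * x * (lift A)⁻¹) * h⁻¹ =
          (h * lift A * h⁻¹) * (h * x * h⁻¹) * (h * lift A * h⁻¹)⁻¹ := by group
        _ = _ := by rw [e]; group
    rw [← D.pi_lift A x hx, hrho h hh _ (D.normal _ (D.lift_mem A) x hx), e2,
      D.pi_lift _ _ hqx, hrho h hh x hx]
    congr 1
    rcases D.conj_eq_or hq hhx with h1 | h1 <;> rw [h1]
    rw [D.pi_mul _ hhx _ D.t_mem, D.pi_t, add_zero]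
  obtain ⟨a, ha⟩ := exists_smul_of_commute (f := fun v => star (rho h v))
    (fun v w => by rw [hadd, star_add]) (fun A v => by
      rw [hact, ← SU42.frob_act]
      have : SU42.frob (SU42.frob A) = A := by
        refine SU42.ext_act fun x => ?_
        conv_lhs => rw [← star_star x]
        rw [SU42.frob_act, SU42.frob_act, star_star]
      rw [this])
  have hx : ∀ x ∈ Q, pi (h * x * h⁻¹) = star a • star (pi x) := by
    intro x hx
    rw [← hrho h hh x hx, ← star_star (rho h (pi x)), ha, star_smul]
  refine ⟨star a, ?_, h, hh, hx⟩
  rintro h0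
  obtain ⟨x, hxQ, e⟩ := D.pi_surj v0
  have h1 := hx x hxQ
  rw [h0, zero_smul] at h1
  apply v0_ne_zero
  rw [← e]
  rcases D.pi_eq_zero _ (D.normal h hh x hxQ) h1 with h2 | h2
  · have : x = 1 := by simpa using h2
    rw [this, D.pi_one]
  · have h3 : x = t := by
      have h4 := mul_comm_of_mem hh
      rw [mul_inv_eq_iff_eq_mul, ← h4] at h2
      exact mul_left_cancel h2
    rw [h3, D.pi_t]

theorem exists_localData [Finite G] (hF : ∃ h ∈ C(t), ∀ x ∈ Q, pi (h * x * h⁻¹) = star (pi x)) :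
    ∃ rho, LocalData t Q pi rho := by
  obtain ⟨rho, hrho⟩ := D.exists_action
  have hmul : ∀ g ∈ C(t), ∀ h ∈ C(t), ∀ v, rho (g * h) v = rho g (rho h v) := by
    intro g hg h hh v
    obtain ⟨x, hx, rfl⟩ := D.pi_surj v
    rw [hrho _ (mul_mem hg hh) x hx, hrho h hh x hx, hrho g hg _ (D.normal h hh x hx)]
    congr 1; group
  have hone : ∀ q ∈ Q, ∀ v, rho q v = v := by
    intro q hq v
    obtain ⟨x, hx, rfl⟩ := D.pi_surj v
    rw [hrho q (D.le hq) x hx]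
    rcases D.conj_eq_or hq hx with h | h <;> rw [h]
    rw [D.pi_mul x hx t D.t_mem, D.pi_t, add_zero]
  have hadd : ∀ h ∈ C(t), ∀ v w, rho h (v + w) = rho h v + rho h w := by
    intro h hh v w
    obtain ⟨x, hx, rfl⟩ := D.pi_surj v
    obtain ⟨y, hy, rfl⟩ := D.pi_surj w
    rw [← D.pi_mul x hx y hy, hrho h hh _ (mul_mem hx hy), hrho h hh x hx, hrho h hh y hy,
      ← D.pi_mul _ (D.normal h hh x hx) _ (D.normal h hh y hy)]
    congr 1; group
  have hlift : ∀ A v, rho (lift A) v = A.act v := by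
    intro A v
    obtain ⟨x, hx, rfl⟩ := D.pi_surj v
    rw [hrho _ (D.lift_mem A) x hx, D.pi_lift A x hx]
  have hconj : ∀ h ∈ C(t), ∀ A B : SU42, ∀ q ∈ Q, h * lift A * h⁻¹ = lift B * q →
      ∀ v, rho h (A.act v) = B.act (rho h v) := by
    intro h hh A B q hq e v
    have e2 : h * lift A = lift B * (q * h) := by rw [← mul_assoc, ← e]; group
    rw [← hlift A, ← hmul h hh _ (D.lift_mem A), e2, hmul _ (D.lift_mem B) _ (mul_mem (D.le hq) hh),
      hmul q (D.le hq) h hh, hone q hq, hlift]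
  have hinv : ∀ h ∈ C(t), ∀ v, rho h (rho h⁻¹ v) = v ∧ rho h⁻¹ (rho h v) = v := by
    intro h hh v
    rw [← hmul h hh _ (inv_mem hh), ← hmul _ (inv_mem hh) h hh, mul_inv_cancel, inv_mul_cancel]
    exact ⟨hone 1 Q.one_mem v, hone 1 Q.one_mem v⟩
  refine ⟨rho, { D with
    rho_pi := hrho
    commute_iff := fun x hx y hy => D.commute_iff hx hy
    sq_iff := fun x hx => D.sq_iff hx
    exists_rho := fun A => ⟨lift A, D.lift_mem A, hlift A⟩
    semilinear := ?_
    mem_of_rho := ?_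
    exists_sig := ?_ }⟩
  · intro h hh
    refine linear_or_semilinear (hadd h hh) (fun v => (hinv h hh v).1) (fun v => (hinv h hh v).2)
      fun A => ?_
    obtain ⟨B, q, hq, e⟩ := D.lift_conj h⁻¹ (inv_mem hh) A
    refine ⟨B, fun v => ?_⟩
    have h1 := hconj h⁻¹ (inv_mem hh) A B q hq e (rho h v)
    rw [(hinv h hh v).2] at h1
    rw [← h1, (hinv h hh _).1]
  · intro h hh hid hk
    refine D.mem_of_commute h hh (fun A => ?_) hk
    obtain ⟨B, q, hq, e⟩ := D.lift_conj h hh A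
    have : A = B := SU42.ext_act fun v => by
      have := hconj h hh A B q hq e v
      rwa [hid, hid] at this
    exact ⟨q, hq, this ▸ e⟩
  · obtain ⟨h, hh, hs⟩ := hF
    have hones : herm (fun _ => 1 : V4) (fun _ => 1) = 0 := herm_self_eq_zero_of_sig sig_ones
    obtain ⟨g, hg⟩ : ∃ g, g = lift (tv fun _ => 1) * h := ⟨_, rfl⟩
    have hgC : g ∈ C(t) := hg ▸ mul_mem (D.lift_mem _) hh
    have hgs : ∀ v, rho g v = sig v := by
      intro v
      rw [hg, hmul _ (D.lift_mem _) h hh, hlift]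
      obtain ⟨x, hx, rfl⟩ := D.pi_surj v
      rw [hrho h hh x hx, hs x hx, tv_act hones]
      ext i
      simp [sig, herm]
    -- The odd power of this element that is a `2`-element acts in the same way.
    obtain ⟨k, m, ⟨j, hj⟩, hkm⟩ := Nat.exists_eq_two_pow_mul_odd (orderOf_pos g).ne'
    have hpow : ∀ j : ℕ, (g * g) ^ j ∈ C(t) ∧ ∀ v, rho ((g * g) ^ j) v = v := by
      intro j
      induction j with
      | zero => exact ⟨by rw [pow_zero]; exact one_mem _, fun v => by
          rw [pow_zero]; exact hone 1 Q.one_mem v⟩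
      | succ j ih =>
        refine ⟨pow_mem (mul_mem hgC hgC) _, fun v => ?_⟩
        rw [pow_succ, hmul _ ih.1 _ (mul_mem hgC hgC), hmul g hgC g hgC, hgs, hgs, sig_sig, ih.2]
    have hgm : g ^ m = g * (g * g) ^ j := by
      rw [hj, pow_succ', pow_mul, pow_two]
    refine ⟨g ^ m, pow_mem hgC _, ⟨k, ?_⟩, fun v => ?_⟩
    · rw [← pow_mul, mul_comm, ← hkm, pow_orderOf_eq_one]
    · rw [hgm, hmul g hgC _ (hpow j).1, (hpow j).2, hgs]

/-- After rescaling the identification with the natural module, an element inducing the field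
automorphism acts as the coordinatewise conjugation. -/
theorem exists_index_two [Finite G] : ∃ N : Subgroup G, N.index = 2 := by
  obtain ⟨a, ha, h, hh, hx⟩ := D.exists_smul_star
  obtain ⟨rho, hrho⟩ := (D.smul ha).exists_localData ⟨h, hh, fun x hxQ => by
    rw [hx x hxQ, star_smul, smul_smul, F4.star_def, ← pow_two]⟩
  exact hrho.exists_index_two

end NaturalData


/-! ### The natural module in the centralizer of the involution -/

theorem zpowers_subgroupOf_le_generalizedFitting {G : Type*} [Group G] [Finite G] {t : G}
    (ht : orderOf t = 2) :
    (Subgroup.zpowers t).subgroupOf (Subgroup.centralizer {t}) ≤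
      generalizedFitting (Subgroup.centralizer {t}) := by
  refine le_trans (b := fittingSubgroup _)
    (le_sSup (show _ ∧ _ from ⟨inferInstance, ?_⟩)) le_sup_left
  have h2 : IsPGroup 2 (Subgroup.zpowers t) := IsPGroup.of_card (n := 1) (by
    rw [Nat.card_zpowers, ht, pow_one])
  have h3 : IsPGroup 2 ((Subgroup.zpowers t).subgroupOf (Subgroup.centralizer {t})) :=
    h2.comap_of_injective _ Subtype.val_injective
  have : Fact (Nat.Prime 2) := ⟨Nat.prime_two⟩
  exact h3.isNilpotent

theorem mem_zpowers_of_orderOf_eq_two {G : Type*} [Group G] {t x : G} (ht : orderOf t = 2)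
    (hx : x ∈ Subgroup.zpowers t) : x = 1 ∨ x = t := by
  have ht2 : t ^ 2 = 1 := ht ▸ pow_orderOf_eq_one t
  obtain ⟨k, rfl⟩ := Subgroup.mem_zpowers_iff.1 hx
  rcases Int.even_or_odd' k with ⟨m, rfl | rfl⟩
  · left
    rw [zpow_mul, zpow_ofNat, ht2, one_zpow]
  · right
    rw [zpow_add, zpow_mul, zpow_ofNat, ht2, one_zpow, one_mul, zpow_one]

theorem eq_one_of_card_dvd_three {C : Type*} [Group C] (h : Nat.card C ∣ 3) {x : C}
    (hx : ∃ k, x ^ 2 ^ k = 1) : x = 1 := by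
  obtain ⟨k, hk⟩ := hx
  have h1 : orderOf x ∣ 3 := (orderOf_dvd_natCard x).trans h
  have h2 : orderOf x ∣ 2 ^ k := orderOf_dvd_of_pow_eq_one hk
  have h3 : Nat.Coprime 3 (2 ^ k) := Nat.Coprime.pow_right k (by norm_num)
  rw [← orderOf_eq_one_iff]
  exact Nat.eq_one_of_dvd_coprimes h3 h1 h2

/-- Translation of the hypotheses. That the field automorphism is induced comes from the full
automorphism group acting on a normal copy of `SU₄(2)`, which is the copy in the natural module
condition by `range_eq_of_le_generalizedFitting`. -/
theorem exists_naturalData {G : Type*} [Group G] [Finite G] (t : G) (ht : orderOf t = 2)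
    (hQ : IsExtraspecial 2 (generalizedFitting (Subgroup.centralizer {t})))
    (hcard : Nat.card (generalizedFitting (Subgroup.centralizer {t})) = 2 ^ 9)
    (hX : HasFullNormalCopy SU42
      (Subgroup.centralizer {t} ⧸ generalizedFitting (Subgroup.centralizer {t})))
    (hV : IsNaturalModule (generalizedFitting (Subgroup.centralizer {t}))
      ((Subgroup.zpowers t).subgroupOf (Subgroup.centralizer {t}))) :
    ∃ Q pi lift, NaturalData t Q pi lift := by
  classical
  have hle := zpowers_subgroupOf_le_generalizedFitting ht
  set F := generalizedFitting (Subgroup.centralizer {t})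
  obtain ⟨ψ, e, hψ, hact⟩ := hV
  obtain ⟨j, hj, hjn, hα, hC⟩ := hX
  let p : SU42 →* Subgroup.centralizer {t} ⧸ F :=
    (generalizedFitting (Subgroup.centralizer {t} ⧸ F)).subtype.comp ψ
  have hp : Function.Injective p := Subtype.val_injective.comp hψ
  have : Finite SU42 := Finite.of_injective p hp
  have hrange : p.range = j.range :=
    range_eq_of_le_generalizedFitting SU42.exists_not_commute j hj hC p hp (by
      rintro _ ⟨A, rfl⟩
      exact (ψ A).2)
  choose l hl using fun A => QuotientGroup.mk_surjective (p A)
  have ht2 : t * t = 1 := by rw [← pow_two, ← ht, pow_orderOf_eq_one]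
  have htne : t ≠ 1 := fun h => by rw [h, orderOf_one] at ht; omega
  have htC : t ∈ Subgroup.centralizer {t} := Subgroup.mem_centralizer_singleton_iff.2 rfl
  have htZ : (⟨t, htC⟩ : Subgroup.centralizer {t}) ∈
      (Subgroup.zpowers t).subgroupOf (Subgroup.centralizer {t}) := Subgroup.mem_zpowers t
  have htF : (⟨t, htC⟩ : Subgroup.centralizer {t}) ∈ F := hle htZ
  let pi : G → V4 := fun g =>
    if h : ∃ hg : g ∈ Subgroup.centralizer {t}, (⟨g, hg⟩ : Subgroup.centralizer {t}) ∈ F then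
      (e ((⟨⟨g, h.1⟩, h.2⟩ : F) : F ⧸ _)).toAdd else 0
  have hpi : ∀ x : F, pi x = (e (x : F ⧸ _)).toAdd := by
    rintro ⟨⟨x, hx⟩, hx'⟩
    simp only [pi]
    rw [dif_pos ⟨hx, hx'⟩]
  have hQ' : ∀ x ∈ F.map (Subgroup.centralizer {t}).subtype,
      ∃ y : F, ((y : Subgroup.centralizer {t}) : G) = x := by
    rintro _ ⟨y, hy, rfl⟩
    exact ⟨⟨y, hy⟩, rfl⟩
  have hmem : ∀ y : F,
      ((y : Subgroup.centralizer {t}) : G) ∈ F.map (Subgroup.centralizer {t}).subtype :=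
    fun y => ⟨y, y.2, rfl⟩
  -- A representative of a product in the quotient differs from the product by an element of `F`.
  have hrep : ∀ (h : Subgroup.centralizer {t}) (A B : SU42),
      (h : Subgroup.centralizer {t} ⧸ F) * p A *
      (h : Subgroup.centralizer {t} ⧸ F)⁻¹ = p B →
      ∃ q ∈ F.map (Subgroup.centralizer {t}).subtype, (h : G) * l A * (h : G)⁻¹ = l B * q := by
    intro h A B hAB
    rw [← hl A, ← hl B] at hAB
    have h1 : ((l B : Subgroup.centralizer {t})⁻¹ * (h * l A * h⁻¹)) ∈ F := by
      rw [← QuotientGroup.eq]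
      exact hAB.symm
    exact ⟨_, hmem ⟨_, h1⟩, by simp⟩
  refine ⟨F.map (Subgroup.centralizer {t}).subtype, pi, fun A => l A,
    { t_ne := htne
      t_sq := ht2
      t_mem := hmem ⟨_, htF⟩
      le := ?_
      normal := ?_
      pi_mul := ?_
      pi_surj := ?_
      pi_eq_zero := ?_
      pi_t := ?_
      exists_not_commute := ?_
      lift_mem := fun A => (l A).2
      pi_lift := ?_
      lift_conj := ?_
      exists_frob := ?_
      mem_of_commute := ?_ }⟩
  · rintro _ ⟨y, -, rfl⟩
    exact y.2
  · rintro h hh _ ⟨y, hy, rfl⟩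
    exact ⟨⟨h, hh⟩ * y * ⟨h, hh⟩⁻¹, (inferInstance : F.Normal).conj_mem y hy _, rfl⟩
  · intro x hx y hy
    obtain ⟨x, rfl⟩ := hQ' x hx
    obtain ⟨y, rfl⟩ := hQ' y hy
    have := hpi (x * y)
    rw [QuotientGroup.mk_mul, map_mul, toAdd_mul, ← hpi, ← hpi] at this
    exact this
  · intro v
    obtain ⟨x, hx⟩ := QuotientGroup.mk_surjective (e.symm (Multiplicative.ofAdd v))
    exact ⟨_, hmem x, by rw [hpi, hx]; simp⟩
  · intro x hx h0
    obtain ⟨x, rfl⟩ := hQ' x hx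
    rw [hpi, toAdd_eq_zero, map_eq_one_iff e e.injective, QuotientGroup.eq_one_iff] at h0
    exact mem_zpowers_of_orderOf_eq_two ht h0
  · have h := hpi ⟨_, htF⟩
    rw [(QuotientGroup.eq_one_iff (N := (((Subgroup.zpowers t).subgroupOf
      (Subgroup.centralizer {t})).subgroupOf F)) (⟨_, htF⟩ : F)).2 htZ, map_one, toAdd_one] at h
    exact h
  · by_contra! hcon
    have htop : Subgroup.center F = ⊤ := by
      rw [eq_top_iff]
      rintro x -
      rw [Subgroup.mem_center_iff]
      intro y
      exact Subtype.ext (Subtype.ext (hcon _ (hmem y) _ (hmem x)))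
    have h1 := hQ.2.1
    rw [htop, Subgroup.card_top, hcard] at h1
    norm_num at h1
  · intro A x hx
    obtain ⟨x, rfl⟩ := hQ' x hx
    have h1 := hact A (l A) (hl A) x
    rw [← hpi, ← hpi] at h1
    exact h1
  · intro h hh A
    have h1 : ((⟨h, hh⟩ : Subgroup.centralizer {t}) : Subgroup.centralizer {t} ⧸ F) * p A *
        ((⟨h, hh⟩ : Subgroup.centralizer {t}) : Subgroup.centralizer {t} ⧸ F)⁻¹ ∈ p.range := by
      rw [hrange]
      exact hjn.conj_mem _ (hrange ▸ ⟨A, rfl⟩) _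
    obtain ⟨B, hB⟩ := h1
    exact ⟨B, hrep ⟨h, hh⟩ A B hB.symm⟩
  · -- The field automorphism is transported to the copy on which all automorphisms are induced.
    let θ : SU42 ≃* SU42 := (MonoidHom.ofInjective hp).trans
      ((MulEquiv.subgroupCongr hrange).trans (MonoidHom.ofInjective hj).symm)
    have hθ : ∀ A, j (θ A) = p A := by
      intro A
      have h1 : MonoidHom.ofInjective hj (θ A) =
          MulEquiv.subgroupCongr hrange (MonoidHom.ofInjective hp A) :=
        (MonoidHom.ofInjective hj).apply_symm_apply _
      exact congrArg Subtype.val h1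
    obtain ⟨x, hx⟩ := hα (θ.symm.trans (SU42.frob.trans θ))
    obtain ⟨h, rfl⟩ := QuotientGroup.mk_surjective x
    refine ⟨h, h.2, fun A => hrep h A _ ?_⟩
    have h1 := hx (θ A)
    rw [hθ, MulEquiv.trans_apply, MulEquiv.trans_apply, MulEquiv.symm_apply_apply, hθ] at h1
    exact h1
  · rintro h hh hcomm ⟨k, hk⟩
    have hc : ((⟨h, hh⟩ : Subgroup.centralizer {t}) : Subgroup.centralizer {t} ⧸ F) ∈
        Subgroup.centralizer (j.range : Set (Subgroup.centralizer {t} ⧸ F)) := by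
      rw [← hrange, Subgroup.mem_centralizer_iff]
      rintro _ ⟨A, rfl⟩
      obtain ⟨_, ⟨q, hq, rfl⟩, hqe⟩ := hcomm A
      have h1 : (⟨h, hh⟩ : Subgroup.centralizer {t}) * l A = l A * q * ⟨h, hh⟩ := by
        apply Subtype.ext
        have h2 : h * l A * h⁻¹ * h = l A * q * h := by rw [hqe]; rfl
        rw [inv_mul_cancel_right] at h2
        exact h2
      have h3 := congrArg (QuotientGroup.mk' F) h1
      rw [map_mul, map_mul, map_mul, show QuotientGroup.mk' F q = 1 from
        (QuotientGroup.eq_one_iff q).2 hq, mul_one] at h3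
      rw [← hl A]
      exact h3.symm
    have h4 := eq_one_of_card_dvd_three hC (x := ⟨_, hc⟩) ⟨k, Subtype.ext (by
      have h5 : (⟨h, hh⟩ : Subgroup.centralizer {t}) ^ 2 ^ k = 1 := Subtype.ext (by simpa using hk)
      have h6 := congrArg (QuotientGroup.mk' F) h5
      rw [map_pow, map_one] at h6
      exact h6)⟩
    have h7 := congrArg Subtype.val h4
    exact hmem ⟨⟨h, hh⟩, (QuotientGroup.eq_one_iff _).1 h7⟩


theorem lemma2p12 {G : Type*} [Group G] [Finite G] (t : G) (ht : orderOf t = 2)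
    (hQ : IsExtraspecial 2 (generalizedFitting (Subgroup.centralizer {t})))
    (hcard : Nat.card (generalizedFitting (Subgroup.centralizer {t})) = 2 ^ 9)
    (hHQ : Nonempty
        ((Subgroup.centralizer {t} ⧸ generalizedFitting (Subgroup.centralizer {t}))
          ≃* MulAut SU42) ∨
      IsSU42Times3Colon2
        (Subgroup.centralizer {t} ⧸ generalizedFitting (Subgroup.centralizer {t})))
    (hV : IsNaturalModule (generalizedFitting (Subgroup.centralizer {t}))
      ((Subgroup.zpowers t).subgroupOf (Subgroup.centralizer {t}))) :
    ∃ N : Subgroup G, N.index = 2 := by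
  have hX : HasFullNormalCopy SU42
      (Subgroup.centralizer {t} ⧸ generalizedFitting (Subgroup.centralizer {t})) := by
    rcases hHQ with ⟨⟨f⟩⟩ | ⟨D, hD, hdec, ⟨f⟩⟩
    · exact (hasFullNormalCopy_mulAut SU42.exists_not_commute).of_mulEquiv f
    · exact (hasFullNormalCopy_of_not_decomposable SU42.exists_not_commute D hD hdec).of_mulEquiv f
  obtain ⟨Q, pi, lift, hD⟩ := exists_naturalData t ht hQ hcard hX hV
  exact hD.exists_index_two
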